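/- **Setting.** Let $\Omega\subset\mathbb R^3$ be a bounded Lipschitz domain with outward unit normal $n=(n_1,n_2,n_3)$ (defined almost everywhere on $\partial\Omega$ with respect to surface measure), and let $\partial\Omega=\Sigma_D\cup\Sigma_N$ with $\Sigma_D,\Sigma_N$ measurable and $\Sigma_D\cap\Sigma_N$ of surface measure zero. Put $$D=\begin{bmatrix}\partial_1&0&0\\0&\partial_2&0\\0&0&\partial_3\\\partial_2&\partial_1&0\\0&\partial_3&\partial_2\\\partial_3&0&\partial_1\end{bmatrix},\quad N=\begin{bmatrix}n_1&0&0\\0&n_2&0\\0&0&n_3\\n_2&n_1&0\\0&n_3&n_2\\n_3&0&n_1\end{bmatrix},\quad E=\begin{bmatrix}\lambda+2G&\lambda&\lambda&&&\\\lambda&\lambda+2G&\lambda&&&\\\lambda&\lambda&\lambda+2G&&&\\&&&G&&\\&&&&G&\\&&&&&G\end{bmatrix},$$ where the density $\rho>0$ is constant and $\lambda,G\in\mathbb R$ are such that $E$ is symmetric positive definite. The linear elastodynamics system $\rho\dot v=D^T\sigma$, $E^{-1}\dot\sigma=Dv$ in $\Omega$ with $N^T\sigma=\bar\tau$ on $\Sigma_N$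 and $v=\bar\nu$ on $\Sigma_D$ has the weak form $$\int_\Omega\delta v^T\rho\dot v-\delta v^TD^T\sigma\,d\Omega+\int_{\Sigma_N}\delta v^T(N^T\sigma-\bar\tau)\,d\Sigma_N=0,\qquad \int_\Omega\delta\sigma^TE^{-1}\dot\sigma-\delta\sigma^TDv\,d\Omega+\int_{\Sigma_D}\delta\sigma^TN(v-\bar\nu)\,d\Sigma_D=0\tag{W}$$ for all test functions $\delta v,\delta\sigma$. Let $\phi^T=[\phi_1,\phi_2,\dots]$ and $\psi^T=[\psi_1,\psi_2,\dots]$ be finite families of fields on $\overline\Omega$ with values in $\mathbb R^3$ and $\mathbb R^6$ respectively, each linearly independent in $L^2(\Omega)$. The fields are bounded and measurable, and at almost every boundary point their value is the limit from inside $\Omega$. The weak derivatives $D\phi_i$ lie in $L^2(\Omega)$. Let $\xi^T=[\xi_1,\dots]$ and $\zeta^T=[\zeta_1,\dots]$ be finite families of $\mathbb R^3$-valued $L^2$ fields on $\Sigma_N$ and $\Sigma_D$. Trial and test functions are taken from the same bases, $$v=\phi^T\hat v(t),\ \delta v=\phi^T\delta\hat v,\quad\sigma=\psi^T\hat\sigma(t),\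 \delta\sigma=\psi^T\delta\hat\sigma,\quad\bar\tau=\xi^T\hat\tau(t),\ \bar\nu=\zeta^T\hat\nu(t).$$ Define $$M_v=\int_\Omega\phi\rho\phi^T d\Omega,\quad M_\sigma=\int_\Omega\psi E^{-1}\psi^T d\Omega,\quad K=\int_\Omega(D\phi^T)^T\psi^T d\Omega-\int_{\Sigma_D}\phi N^T\psi^T d\Sigma_D,$$ $$G_v=\int_{\Sigma_N}\phi\xi^T d\Sigma_N,\quad G_\sigma=\int_{\Sigma_D}\psi N\zeta^T d\Sigma_D,$$ $$M=\begin{bmatrix}M_v&0\\0&M_\sigma\end{bmatrix},\quad J=\begin{bmatrix}0&-K\\K^T&0\end{bmatrix},\quad \mathcal G=\begin{bmatrix}G_v&0\\0&G_\sigma\end{bmatrix},\quad\hat e=\begin{bmatrix}\hat v\\\hat\sigma\end{bmatrix},\quad\hat u=\begin{bmatrix}\hat\tau\\\hat\nu\end{bmatrix},\quad\hat y=\mathcal G^T\hat e,\quad \hat H=\tfrac12\hat e^TM\hat e.$$ **Theorem.** 1. $M$ is symmetric positive definite (hence invertible), $J^T=-J$, and $\mathcal G^T=\operatorname{diag}(G_v^T,G_\sigma^T)$.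 2. $\hat H$ is the total energy $\frac12\int_\Omega\rho\,v^Tv+\varepsilon^TE\varepsilon\,d\Omega$ of the approximate fields, with velocity $v=\phi^T\hat v$ and strain $\varepsilon=E^{-1}\psi^T\hat\sigma$. Expressed in the energy variable $\hat p=M\hat e$ it is $\frac12\hat p^TM^{-1}\hat p$, and its gradient with respect to $\hat p$ is $\hat e$. 3. Let $\hat v,\hat\sigma$ be differentiable at the time $t$. If the weak derivatives $D^T\psi_j$ lie in $L^2(\Omega)$, then (W) holds at time $t$ for all $\delta\hat v,\delta\hat\sigma$ if and only if $$M\dot{\hat e}=J\hat e+\mathcal G\hat u\tag{S}$$ holds at time $t$. Without this condition on $\psi$ (e.g. for discontinuous stress bases), the same equivalence holds when the first equation of (W) is read in its partially integrated form $$\int_\Omega\delta v^T\rho\dot v+(D\delta v)^T\sigma\,d\Omega-\int_{\Sigma_D}\delta v^TN^T\sigma\,d\Sigma_D-\int_{\Sigma_N}\delta v^T\bar\tau\,d\Sigma_N=0.$$ 4. If $\hat v,\hat\sigma$ are differentiable at $t$ and (S) holds at $t$, then $\frac{d}{dt}\hat H=\hat v^TG_v\hat\tau+\hat\sigma^TG_\sigma\hat\nu=\hat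 y^T\hat u$ at $t$. -/

import Mathlib

open MeasureTheory Filter Topology Set
open scoped Matrix RealInnerProductSpace ContDiff

noncomputable section

namespace Elastodynamics

/-- Physical space `ℝ³` with its Euclidean structure. -/
abbrev Space := EuclideanSpace ℝ (Fin 3)

/-! ### The domain, its surface measure and its outward normal -/

/-- A bounded Lipschitz domain: a bounded open set that, near every boundary point and after a
rotation of coordinates, is the set of points above the graph of a Lipschitz function of two
variables. -/
def IsLipschitzDomain (Ω : Set Space) : Prop :=
  IsOpen Ω ∧ Bornology.IsBounded Ω ∧
    ∀ x ∈ frontier Ω, ∃ (R : Space ≃ₗᵢ[ℝ] Space) (g : EuclideanSpace ℝ (Fin 2) → ℝ) (L : NNReal),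
      LipschitzWith L g ∧ ∀ᶠ y in 𝓝 x, (y ∈ Ω ↔ g !₂[R y 0, R y 1] < R y 2)

/-- The two-dimensional surface measure (Hausdorff measure, normalised so that it is the area
on planes). -/
abbrev surf : Measure Space := Measure.euclideanHausdorffMeasure 2

/-- `n` is the outward unit normal of `Ω` at `x`: to first order at `x`, the set `Ω` is the
half-space `{y | ⟪y - x, n⟫ < 0}`. There is at most one such `n`. -/
def IsOutwardNormal (Ω : Set Space) (x n : Space) : Prop :=
  ‖n‖ = 1 ∧ ∀ ε > 0, ∀ᶠ y in 𝓝 x,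
    (⟪y - x, n⟫ < -ε * ‖y - x‖ → y ∈ Ω) ∧ (ε * ‖y - x‖ < ⟪y - x, n⟫ → y ∉ Ω)

open Classical in
/-- The outward unit normal field of `Ω`. On the boundary of a Lipschitz domain it exists almost
everywhere; the value `0` is used at the remaining points. -/
def normal (Ω : Set Space) (x : Space) : Space :=
  if h : ∃ n, IsOutwardNormal Ω x n then h.choose else 0

/-- The `6 × 3` matrix `N` of the components of the outward normal. -/
def normalMatrix (Ω : Set Space) (x : Space) : Matrix (Fin 6) (Fin 3) ℝ :=
  let n := normal Ω x
  !![n 0, 0,   0;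
     0,   n 1, 0;
     0,   0,   n 2;
     n 1, n 0, 0;
     0,   n 2, n 1;
     n 2, 0,   n 0]

/-! ### The differential operators `D` and `Dᵀ` -/

/-- Partial derivative `∂f/∂xᵢ`. -/
def pd (i : Fin 3) (f : Space → ℝ) (x : Space) : ℝ :=
  fderiv ℝ f x (EuclideanSpace.single i 1)

/-- The differential operator `D` on differentiable fields. -/
def classicalD (v : Space → Fin 3 → ℝ) (x : Space) : Fin 6 → ℝ :=
  ![pd 0 (v · 0) x,
    pd 1 (v · 1) x,
    pd 2 (v · 2) x,
    pd 1 (v · 0) x + pd 0 (v · 1) x,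
    pd 2 (v · 1) x + pd 1 (v · 2) x,
    pd 2 (v · 0) x + pd 0 (v · 2) x]

/-- The differential operator `Dᵀ` on differentiable fields. -/
def classicalDT (s : Space → Fin 6 → ℝ) (x : Space) : Fin 3 → ℝ :=
  ![pd 0 (s · 0) x + pd 1 (s · 3) x + pd 2 (s · 5) x,
    pd 1 (s · 1) x + pd 0 (s · 3) x + pd 2 (s · 4) x,
    pd 2 (s · 2) x + pd 1 (s · 4) x + pd 0 (s · 5) x]

/-- Smooth fields with compact support in `Ω`. -/
def IsTestField {m : ℕ} (Ω : Set Space) (η : Space → Fin m → ℝ) : Prop :=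
  ContDiff ℝ ∞ η ∧ HasCompactSupport η ∧ tsupport η ⊆ Ω

/-- `v, w ∈ L²(Ω)` and `D v = w` in the weak sense. -/
def IsWeakD (Ω : Set Space) (v : Space → Fin 3 → ℝ) (w : Space → Fin 6 → ℝ) : Prop :=
  MemLp v 2 (volume.restrict Ω) ∧ MemLp w 2 (volume.restrict Ω) ∧
    ∀ η : Space → Fin 6 → ℝ, IsTestField Ω η →
      ∫ x in Ω, η x ⬝ᵥ w x = -∫ x in Ω, classicalDT η x ⬝ᵥ v x

/-- `s, w ∈ L²(Ω)` and `Dᵀ s = w` in the weak sense. -/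
def IsWeakDT (Ω : Set Space) (s : Space → Fin 6 → ℝ) (w : Space → Fin 3 → ℝ) : Prop :=
  MemLp s 2 (volume.restrict Ω) ∧ MemLp w 2 (volume.restrict Ω) ∧
    ∀ η : Space → Fin 3 → ℝ, IsTestField Ω η →
      ∫ x in Ω, η x ⬝ᵥ w x = -∫ x in Ω, classicalD η x ⬝ᵥ s x

open Classical in
/-- The weak derivative `D v ∈ L²(Ω)` (unique up to a null set where it exists). -/
def weakD (Ω : Set Space) (v : Space → Fin 3 → ℝ) : Space → Fin 6 → ℝ :=
  if h : ∃ w, IsWeakD Ω v w then h.choose else 0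

open Classical in
/-- The weak derivative `Dᵀ s ∈ L²(Ω)` (unique up to a null set where it exists). -/
def weakDT (Ω : Set Space) (s : Space → Fin 6 → ℝ) : Space → Fin 3 → ℝ :=
  if h : ∃ w, IsWeakDT Ω s w then h.choose else 0

/-- Bounded (measurable) fields whose value at almost every boundary point is the limit from
inside `Ω`. Fields that are continuous on the closure of `Ω` and piecewise continuous finite
element fields are of this kind. -/
structure HasBoundaryValues {m : ℕ} (Ω : Set Space) (f : Space → Fin m → ℝ) : Prop where
  bounded : ∃ C : ℝ, ∀ x ∈ closure Ω, ‖f x‖ ≤ C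
  meas_interior : AEStronglyMeasurable f (volume.restrict Ω)
  meas_boundary : AEStronglyMeasurable f (surf.restrict (frontier Ω))
  limit : ∀ᵐ x ∂(surf.restrict (frontier Ω)), Tendsto f (𝓝[Ω] x) (𝓝 (f x))

/-! ### Elastodynamics: material law, energy, weak form -/

/-- The matrix of Hooke's law with Lamé coefficients `lam` and `G`. -/
def hooke (lam G : ℝ) : Matrix (Fin 6) (Fin 6) ℝ :=
  !![lam + 2 * G, lam, lam, 0, 0, 0;
     lam, lam + 2 * G, lam, 0, 0, 0;
     lam, lam, lam + 2 * G, 0, 0, 0;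
     0, 0, 0, G, 0, 0;
     0, 0, 0, 0, G, 0;
     0, 0, 0, 0, 0, G]

/-- The total energy of a velocity field `v` and a strain field `ε`. -/
def energy (Ω : Set Space) (rho : ℝ) (E : Matrix (Fin 6) (Fin 6) ℝ)
    (v : Space → Fin 3 → ℝ) (ε : Space → Fin 6 → ℝ) : ℝ :=
  (1 / 2) * ∫ x in Ω, (rho * (v x ⬝ᵥ v x) + ε x ⬝ᵥ (E *ᵥ ε x))

/-- The residual `δP_v` of the momentum balance on `Ω` and of the Neumann condition
`Nᵀ s = τ` on `SN`; `a` is the time derivative of the velocity. -/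
def residualV (Ω SN : Set Space) (rho : ℝ) (δv a : Space → Fin 3 → ℝ)
    (s : Space → Fin 6 → ℝ) (τ : Space → Fin 3 → ℝ) : ℝ :=
  (∫ x in Ω, (δv x ⬝ᵥ (rho • a x) - δv x ⬝ᵥ weakDT Ω s x)) +
    ∫ x in SN, δv x ⬝ᵥ ((normalMatrix Ω x)ᵀ *ᵥ s x - τ x) ∂surf

/-- The residual `δP_σ` of the kinematic equation on `Ω` and of the Dirichlet condition `v = ν`
on `SD`; `b` is the time derivative of the stress. -/
def residualS (Ω SD : Set Space) (E : Matrix (Fin 6) (Fin 6) ℝ) (δs b : Space → Fin 6 → ℝ)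
    (v ν : Space → Fin 3 → ℝ) : ℝ :=
  (∫ x in Ω, (δs x ⬝ᵥ (E⁻¹ *ᵥ b x) - δs x ⬝ᵥ weakD Ω v x)) +
    ∫ x in SD, δs x ⬝ᵥ (normalMatrix Ω x *ᵥ (v x - ν x)) ∂surf

/-- The residual `δP_v` in partially integrated form, which is meaningful also for stress fields
that have no weak derivative `Dᵀ s` in `L²(Ω)`. -/
def residualVInt (Ω SN SD : Set Space) (rho : ℝ) (δv a : Space → Fin 3 → ℝ)
    (s : Space → Fin 6 → ℝ) (τ : Space → Fin 3 → ℝ) : ℝ :=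
  (∫ x in Ω, δv x ⬝ᵥ (rho • a x)) + (∫ x in Ω, weakD Ω δv x ⬝ᵥ s x)
    - (∫ x in SD, δv x ⬝ᵥ ((normalMatrix Ω x)ᵀ *ᵥ s x) ∂surf)
    - ∫ x in SN, δv x ⬝ᵥ τ x ∂surf

/-! ### The Galerkin discretization -/

/-- The field `x ↦ b(x)ᵀ c` with coefficient vector `c` in the basis `b`. -/
def field {m : ℕ} {ι : Type*} [Fintype ι] (b : ι → Space → Fin m → ℝ) (c : ι → ℝ)
    (x : Space) : Fin m → ℝ :=
  ∑ i, c i • b i x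

/-- Linear independence of a finite family of fields as elements of `L²(Ω)`. -/
def LinIndepOn {m : ℕ} {ι : Type*} [Fintype ι] (Ω : Set Space)
    (b : ι → Space → Fin m → ℝ) : Prop :=
  ∀ c : ι → ℝ, (∀ᵐ x ∂(volume.restrict Ω), field b c x = 0) → c = 0

section Matrices

variable {ι κ α β : Type*}

/-- `M_v = ∫_Ω φ ρ φᵀ`. -/
def massV (Ω : Set Space) (rho : ℝ) (φ : ι → Space → Fin 3 → ℝ) : Matrix ι ι ℝ :=
  Matrix.of fun i j => ∫ x in Ω, φ i x ⬝ᵥ (rho • φ j x)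

/-- `M_σ = ∫_Ω ψ E⁻¹ ψᵀ`. -/
def massS (Ω : Set Space) (E : Matrix (Fin 6) (Fin 6) ℝ) (ψ : κ → Space → Fin 6 → ℝ) :
    Matrix κ κ ℝ :=
  Matrix.of fun i j => ∫ x in Ω, ψ i x ⬝ᵥ (E⁻¹ *ᵥ ψ j x)

/-- `K = ∫_Ω (D φᵀ)ᵀ ψᵀ - ∫_{SD} φ Nᵀ ψᵀ`. -/
def stiffK (Ω SD : Set Space) (φ : ι → Space → Fin 3 → ℝ) (ψ : κ → Space → Fin 6 → ℝ) :
    Matrix ι κ ℝ :=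
  Matrix.of fun i j =>
    (∫ x in Ω, weakD Ω (φ i) x ⬝ᵥ ψ j x) -
      ∫ x in SD, φ i x ⬝ᵥ ((normalMatrix Ω x)ᵀ *ᵥ ψ j x) ∂surf

/-- `G_v = ∫_{SN} φ ξᵀ`. -/
def inputV (SN : Set Space) (φ : ι → Space → Fin 3 → ℝ) (ξ : α → Space → Fin 3 → ℝ) :
    Matrix ι α ℝ :=
  Matrix.of fun i k => ∫ x in SN, φ i x ⬝ᵥ ξ k x ∂surf

/-- `G_σ = ∫_{SD} ψ N ζᵀ`. -/
def inputS (Ω SD : Set Space) (ψ : κ → Space → Fin 6 → ℝ) (ζ : β → Space → Fin 3 → ℝ) :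
    Matrix κ β ℝ :=
  Matrix.of fun j l => ∫ x in SD, ψ j x ⬝ᵥ (normalMatrix Ω x *ᵥ ζ l x) ∂surf

/-- `M = diag(M_v, M_σ)`. -/
def massM (Ω : Set Space) (rho : ℝ) (E : Matrix (Fin 6) (Fin 6) ℝ)
    (φ : ι → Space → Fin 3 → ℝ) (ψ : κ → Space → Fin 6 → ℝ) : Matrix (ι ⊕ κ) (ι ⊕ κ) ℝ :=
  Matrix.fromBlocks (massV Ω rho φ) 0 0 (massS Ω E ψ)

/-- `J = [[0, -K], [Kᵀ, 0]]`. -/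
def interJ (Ω SD : Set Space) (φ : ι → Space → Fin 3 → ℝ) (ψ : κ → Space → Fin 6 → ℝ) :
    Matrix (ι ⊕ κ) (ι ⊕ κ) ℝ :=
  Matrix.fromBlocks 0 (-stiffK Ω SD φ ψ) (stiffK Ω SD φ ψ)ᵀ 0

/-- `G = diag(G_v, G_σ)`. -/
def inputG (Ω SN SD : Set Space) (φ : ι → Space → Fin 3 → ℝ) (ψ : κ → Space → Fin 6 → ℝ)
    (ξ : α → Space → Fin 3 → ℝ) (ζ : β → Space → Fin 3 → ℝ) : Matrix (ι ⊕ κ) (α ⊕ β) ℝ :=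
  Matrix.fromBlocks (inputV SN φ ξ) 0 0 (inputS Ω SD ψ ζ)

end Matrices

/-- The quadratic form `½ eᵀ M e`. -/
def quadH {ι : Type*} [Fintype ι] (M : Matrix ι ι ℝ) (e : ι → ℝ) : ℝ :=
  (1 / 2) * (e ⬝ᵥ (M *ᵥ e))

end Elastodynamics

end

noncomputable section

namespace Elastodynamics

/-! In coefficients everything is finite-dimensional. The partially integrated momentum residual is
the dot product of the test vector with `M_v v' + K σ - G_v τ`, and the kinematic residual is the
dot product with `M_σ σ' - Kᵀ v - G_σ ν`, directly from the definition of `K`; no integration by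
parts is involved. Vanishing for all test vectors is therefore the state equation
(`weakForm_iff_stateEquation`). The same `K` occurs in both rows, once transposed and with opposite
sign, so `J` is skew and the power balance is `e · M e' = e · J e + e · G u = e · G u`. Positivity
of the masses is linear independence in `L²`, and the gradient statement is the derivative of a
symmetric quadratic form.

The analysis lies in the unintegrated momentum residual, which needs Green's formula `∫ v · Dᵀs + ∫
Dv · s = ∫_∂Ω v · Nᵀs` (`integral_weakDT_add_integral_weakD`). The fields are only bounded with
boundary limits almost everywhere, `Dv` controls only the symmetrised gradient of `v`, and the
boundary is only Lipschitz. With `S` the symmetric stress matrix, `F = S v` satisfies `F · n = v ·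
Nᵀs`, and two facts suffice.

Product rule (`hasWeakDiv_flux`): `F` has weak divergence `v · Dᵀs + Dv · s`. The variables are
doubled: a kernel `χ(x) ρ(x - y)` is inserted between `s(y)` and `v(x)`, each weak derivative is
used with the other variable frozen, and the derivatives of `ρ` cancel.

Divergence theorem (`integral_weakDiv`): a partition of unity reduces to one graph chart of height
function `γ`. There the test function is multiplied by a cutoff that rises from 0 to 1 in a layer of
thickness `δ` just above the graph of a smooth approximation of `γ`. The gradient of the cutoff is
`-1/δ` times the conormal; rescaling the height by `δ` fixes the slab, and dominated convergence
gives `∫ χ F · (∇γ, -1) dz`. The area formula (`surf_graph_image`), together with the fact that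
`(∇γ, -1)` is the outward unit normal times the area density, identifies this with the surface
integral for Hausdorff measure. -/

/-! ### Area formula for Lipschitz graphs -/

/-- The parameter plane of a graph. -/
abbrev Plane := EuclideanSpace ℝ (Fin 2)

/-- The point of space with horizontal part `z` and height `t`. -/
def lift (z : Plane) (t : ℝ) : Space := !₂[z 0, z 1, t]

/-- The horizontal part of a point of space. -/
def proj (y : Space) : Plane := !₂[y 0, y 1]

@[simp] lemma lift_zero (z : Plane) (t : ℝ) : lift z t 0 = z 0 := rfl
@[simp] lemma lift_one (z : Plane) (t : ℝ) : lift z t 1 = z 1 := rfl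
@[simp] lemma lift_two (z : Plane) (t : ℝ) : lift z t 2 = t := rfl
@[simp] lemma proj_zero (y : Space) : proj y 0 = y 0 := rfl
@[simp] lemma proj_one (y : Space) : proj y 1 = y 1 := rfl

@[simp] lemma proj_lift (z : Plane) (t : ℝ) : proj (lift z t) = z := by
  ext i; fin_cases i <;> rfl

@[simp] lemma lift_proj (y : Space) : lift (proj y) (y 2) = y := by
  ext i; fin_cases i <;> rfl

lemma proj_sub (x y : Space) : proj (x - y) = proj x - proj y := by
  ext i; fin_cases i <;> rfl

lemma lift_sub (z w : Plane) (s t : ℝ) : lift z s - lift w t = lift (z - w) (s - t) := by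
  ext i; fin_cases i <;> rfl

lemma norm_lift_sq (z : Plane) (t : ℝ) : ‖lift z t‖ ^ 2 = ‖z‖ ^ 2 + t ^ 2 := by
  simp [EuclideanSpace.norm_sq_eq, Fin.sum_univ_three]

lemma inner_lift (z w : Plane) (s t : ℝ) : ⟪lift z s, lift w t⟫ = ⟪z, w⟫ + s * t := by
  simp [PiLp.inner_apply, Fin.sum_univ_three]; ring

lemma norm_le_norm_lift (z : Plane) (t : ℝ) : ‖z‖ ≤ ‖lift z t‖ := by
  refine abs_le_of_sq_le_sq' ?_ (norm_nonneg _) |>.2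
  rw [norm_lift_sq]; nlinarith [sq_nonneg t]

lemma norm_lift_zero (t : ℝ) : ‖lift 0 t‖ = |t| := by
  have := norm_lift_sq 0 t
  rw [norm_zero, zero_pow two_ne_zero, zero_add] at this
  rw [← abs_norm, ← sq_eq_sq_iff_abs_eq_abs, this]

lemma norm_proj_le (y : Space) : ‖proj y‖ ≤ ‖y‖ := by
  simpa using norm_le_norm_lift (proj y) (y 2)

lemma continuous_lift : Continuous fun p : Plane × ℝ => lift p.1 p.2 := by
  unfold lift
  refine (PiLp.continuous_toLp 2 _).comp (continuous_pi fun i => ?_)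
  fin_cases i <;> simp <;> fun_prop

lemma continuous_proj : Continuous proj := by
  unfold proj
  refine (PiLp.continuous_toLp 2 _).comp (continuous_pi fun i => ?_)
  fin_cases i <;> simp <;> fun_prop

/-- Comparison of the areas of two images of a set, when distances compare. -/
lemma surf_image_le_of_dist_le {X : Type*} (f h : X → Space) (S : Set X) (K : NNReal)
    (hfh : ∀ x ∈ S, ∀ y ∈ S, dist (f x) (f y) ≤ K * dist (h x) (h y)) :
    surf (f '' S) ≤ (K : ENNReal) ^ 2 * surf (h '' S) := by
  rcases S.eq_empty_or_nonempty with rfl | hS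
  · simp
  have : Nonempty X := ⟨hS.some⟩
  -- Here `h` need not be injective: the hypothesis forces `f` to agree wherever `h` does, so `f`
  -- factors through `h` on `S` by a `K`-Lipschitz map, and such a map enlarges two-dimensional
  -- Hausdorff measure by at most `K ^ 2`.
  set g : Space → Space := fun u => f (Function.invFunOn h S u)
  have hg : LipschitzOnWith K g (h '' S) := by
    refine LipschitzOnWith.of_dist_le_mul ?_
    intro u hu v hv
    have := hfh _ (Function.invFunOn_mem hu) _ (Function.invFunOn_mem hv)
    rwa [Function.invFunOn_eq hu, Function.invFunOn_eq hv] at this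
  have himg : g '' (h '' S) = f '' S := by
    rw [image_image]
    refine image_congr fun x hx => ?_
    have hu : h x ∈ h '' S := mem_image_of_mem _ hx
    have := hfh _ (Function.invFunOn_mem hu) _ hx
    rw [Function.invFunOn_eq hu, dist_self, mul_zero] at this
    exact dist_le_zero.1 this
  have := hg.hausdorffMeasure_image_le (d := 2) (by norm_num)
  rw [himg] at this
  simp only [Measure.euclideanHausdorffMeasure_def, Measure.smul_apply, ENNReal.smul_def,
    smul_eq_mul, Nat.cast_ofNat]
  calc _ ≤ _ * ((K : ENNReal) ^ (2 : ℝ) * _) := by gcongr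
    _ = _ := by rw [ENNReal.rpow_two]; ring

/-- The area of the linear graph over a set. -/
lemma surf_image_linear (p : Plane) (S : Set Plane) :
    surf ((fun z => lift z ⟪p, z⟫) '' S) = ENNReal.ofReal √(1 + ‖p‖ ^ 2) * volume S := by
  set a := p 0
  set b := p 1
  have hp2 : ‖p‖ ^ 2 = a ^ 2 + b ^ 2 := by simp [EuclideanSpace.norm_sq_eq, a, b]
  rw [hp2]
  set r := √(1 + a ^ 2) with hr
  set q := √(1 + (a ^ 2 + b ^ 2)) with hq
  have hr2 : r ^ 2 = 1 + a ^ 2 := Real.sq_sqrt (by positivity)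
  have hq2 : q ^ 2 = 1 + (a ^ 2 + b ^ 2) := Real.sq_sqrt (by positivity)
  have hr0 : 0 < r := Real.sqrt_pos.2 (by positivity)
  have hq0 : 0 < q := Real.sqrt_pos.2 (by positivity)
  -- Gram–Schmidt on the tangent vectors `(1, 0, a)` and `(0, 1, b)` of the graph: the columns of
  -- `I` are the orthonormal vectors `(1, 0, a) / r` and `(-ab, r², b) / (rq)`. The triangular
  -- factor is the matrix `B` below, whose determinant `q` is the area factor.
  set I : Plane → Space := fun x =>
    !₂[x 0 / r - x 1 * (a * b) / (r * q), x 1 * r / q, x 0 * a / r + x 1 * b / (r * q)] with hI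
  have hiso : Isometry I := by
    refine Isometry.of_dist_eq fun x y => ?_
    rw [dist_eq_norm, dist_eq_norm]
    rw [← abs_norm, ← abs_norm (x - y), ← sq_eq_sq_iff_abs_eq_abs]
    simp only [EuclideanSpace.norm_sq_eq, Fin.sum_univ_three, Fin.sum_univ_two, hI,
      Real.norm_eq_abs, sq_abs, PiLp.sub_apply]
    simp only [Matrix.cons_val_zero, Matrix.cons_val_one, Matrix.cons_val]
    generalize x 0 = x0
    generalize y 0 = y0
    generalize x 1 = x1
    generalize y 1 = y1
    have e : (x0 / r - x1 * (a * b) / (r * q) - (y0 / r - y1 * (a * b) / (r * q))) ^ 2 +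
        (x1 * r / q - y1 * r / q) ^ 2 +
        (x0 * a / r + x1 * b / (r * q) - (y0 * a / r + y1 * b / (r * q))) ^ 2 =
        (x0 - y0) ^ 2 * ((1 + a ^ 2) / r ^ 2) +
        (x1 - y1) ^ 2 * (((1 + a ^ 2) * b ^ 2 + r ^ 2 * r ^ 2 - a ^ 2 * b ^ 2 +
          a ^ 2 * b ^ 2 - b ^ 2 * (1 + a ^ 2) + b ^ 2 * (1 + a ^ 2)) / (r ^ 2 * q ^ 2)) := by
      field_simp
      ring
    rw [e]
    -- The redundant terms cancel in pairs; what remains is `r² (b² + r²) = r² q²`, the unit length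
    -- of the second column.
    have e2 : (1 + a ^ 2) * b ^ 2 + r ^ 2 * r ^ 2 - a ^ 2 * b ^ 2 +
          a ^ 2 * b ^ 2 - b ^ 2 * (1 + a ^ 2) + b ^ 2 * (1 + a ^ 2) = r ^ 2 * q ^ 2 := by
      rw [hr2, hq2]; ring
    rw [e2, ← hr2, div_self (by positivity), div_self (by positivity)]; ring
  set B : Matrix (Fin 2) (Fin 2) ℝ := !![r, a * b / r; 0, q / r] with hB
  have hcomp : (fun z => lift z ⟪p, z⟫) = I ∘ (Matrix.toLpLin 2 2 B) := by
    funext z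
    have h0 : (Matrix.toLpLin 2 2 B z) 0 = r * z 0 + a * b / r * z 1 := by
      simp [hB, Matrix.toLpLin_apply, dotProduct, Fin.sum_univ_two]
    have h1 : (Matrix.toLpLin 2 2 B z) 1 = q / r * z 1 := by
      simp [hB, Matrix.toLpLin_apply, dotProduct, Fin.sum_univ_two]
    have hin : ⟪p, z⟫ = a * z 0 + b * z 1 := by
      simp [PiLp.inner_apply, Fin.sum_univ_two, a, b]; ring
    ext i
    simp only [hI, Function.comp_apply, h0, h1]
    fin_cases i
    · simp; field_simp; ring
    · simp; field_simp
    · simp [hin]; field_simp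
      linear_combination (z 1 * b) * hr2
  rw [hcomp, image_comp, hiso.euclideanHausdorffMeasure_image,
    EuclideanSpace.euclideanHausdorffMeasure_eq_volume, Measure.addHaar_image_linearMap,
    LinearMap.det_toLpLin, hB, Matrix.det_fin_two_of]
  congr 2
  rw [show r * (q / r) - a * b / r * 0 = q by field_simp; ring, abs_of_pos hq0]

/-- The parametrization of the graph of `γ`. -/
def graphMap (γ : Plane → ℝ) (z : Plane) : Space := lift z (γ z)

/-- The area density of the graph of `γ`. -/
def areaDensity (γ : Plane → ℝ) (z : Plane) : ℝ := √(1 + ‖fderiv ℝ γ z‖ ^ 2)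

lemma one_le_sqrt_one_add_sq (a : ℝ) : 1 ≤ √(1 + a ^ 2) := by
  rw [Real.one_le_sqrt]; nlinarith [sq_nonneg a]

/-- An additive error in the slope becomes a multiplicative error in the area density, because the
density is 1-Lipschitz in the slope and at least 1. A relative error survives summation over
countably many pieces of possibly infinite total area. -/
lemma sqrt_one_add_sq_le {a b δ : ℝ} (ha : 0 ≤ a) (hδ : 0 ≤ δ) (hb : 0 ≤ b) (h : a ≤ b + δ) :
    √(1 + a ^ 2) ≤ (1 + δ) * √(1 + b ^ 2) := by
  have h1 := one_le_sqrt_one_add_sq b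
  have h2 : b ≤ √(1 + b ^ 2) := Real.le_sqrt_of_sq_le (by linarith)
  have h3 : √(1 + b ^ 2) ^ 2 = 1 + b ^ 2 := Real.sq_sqrt (by positivity)
  rw [Real.sqrt_le_left (by positivity), mul_pow, h3]
  nlinarith [mul_nonneg hδ hb, mul_nonneg hδ hδ, sq_nonneg (b * δ), sq_nonneg δ, mul_nonneg hδ (sq_nonneg (b-1)), mul_nonneg hδ (sq_nonneg b)]

lemma continuous_graphMap {γ : Plane → ℝ} (hγ : Continuous γ) : Continuous (graphMap γ) :=
  continuous_lift.comp (continuous_id.prodMk hγ)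

lemma graphMap_injective (γ : Plane → ℝ) : Function.Injective (graphMap γ) := by
  intro x y h
  simpa [graphMap] using congrArg proj h

lemma measurable_areaDensity (γ : Plane → ℝ) : Measurable (areaDensity γ) := by
  unfold areaDensity
  have := measurable_fderiv ℝ γ
  fun_prop

/-- Comparison of a graph with a linear graph on a set where the function is almost linear. -/
lemma surf_graph_approx {γ : Plane → ℝ} {p : Plane} {S : Set Plane} {δ : NNReal}
    (h : ∀ x ∈ S, ∀ y ∈ S, |γ x - γ y - ⟪p, x - y⟫| ≤ δ * ‖x - y‖) :
    surf (graphMap γ '' S) ≤ (1 + δ : NNReal) ^ 2 * (ENNReal.ofReal √(1 + ‖p‖ ^ 2) * volume S) ∧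
    ENNReal.ofReal √(1 + ‖p‖ ^ 2) * volume S ≤
      (1 + δ : NNReal) ^ 2 * surf (graphMap γ '' S) := by
  rw [← surf_image_linear]
  -- Both graphs have the same horizontal part, so their increments differ by a vertical vector of
  -- length at most `δ ‖x - y‖`. Since `‖x - y‖` is bounded by either increment, distances compare
  -- with ratio `1 + δ` in both directions.
  have key : ∀ x ∈ S, ∀ y ∈ S,
      ‖(graphMap γ x - graphMap γ y) - (lift x ⟪p, x⟫ - lift y ⟪p, y⟫)‖ ≤ δ * ‖x - y‖ := by
    intro x hx y hy
    rw [graphMap, graphMap, lift_sub, lift_sub, lift_sub, sub_self, norm_lift_zero,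
      ← inner_sub_right]
    exact h x hx y hy
  constructor <;> refine surf_image_le_of_dist_le _ _ _ _ fun x hx y hy => ?_
  · rw [dist_eq_norm, dist_eq_norm]
    have h1 := key x hx y hy
    have h2 : ‖x - y‖ ≤ ‖lift x ⟪p, x⟫ - lift y ⟪p, y⟫‖ := by
      rw [lift_sub]; exact norm_le_norm_lift _ _
    have h3 := norm_le_norm_add_norm_sub' (graphMap γ x - graphMap γ y)
      (lift x ⟪p, x⟫ - lift y ⟪p, y⟫)
    push_cast
    nlinarith [mul_le_mul_of_nonneg_left h2 δ.2, δ.2]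
  · rw [dist_eq_norm, dist_eq_norm]
    have h1 := key x hx y hy
    have h2 : ‖x - y‖ ≤ ‖graphMap γ x - graphMap γ y‖ := by
      rw [graphMap, graphMap, lift_sub]; exact norm_le_norm_lift _ _
    have h3 := norm_le_norm_add_norm_sub (graphMap γ x - graphMap γ y)
      (lift x ⟪p, x⟫ - lift y ⟪p, y⟫)
    push_cast
    nlinarith [mul_le_mul_of_nonneg_left h2 δ.2, δ.2]

lemma dist_graphMap_le {γ : Plane → ℝ} {L : NNReal} (hγ : LipschitzWith L γ) (x y : Plane) :
    dist (graphMap γ x) (graphMap γ y) ≤ (1 + L : NNReal) * dist x y := by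
  rw [dist_eq_norm, dist_eq_norm, graphMap, graphMap, lift_sub]
  have h1 : lift (x - y) (γ x - γ y) = lift (x - y) 0 + lift 0 (γ x - γ y) := by
    ext i; fin_cases i <;> simp [lift]
  have h2 : ‖lift (x - y) 0‖ = ‖x - y‖ := by
    have := norm_lift_sq (x - y) 0
    rw [zero_pow two_ne_zero, add_zero] at this
    exact (pow_left_inj₀ (norm_nonneg _) (norm_nonneg _) two_ne_zero).1 this
  have h3 := hγ.dist_le_mul x y
  rw [Real.dist_eq, dist_eq_norm] at h3
  calc _ ≤ ‖lift (x - y) 0‖ + ‖lift 0 (γ x - γ y)‖ := by rw [h1]; exact norm_add_le _ _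
    _ ≤ ‖x - y‖ + L * ‖x - y‖ := by rw [h2, norm_lift_zero]; gcongr
    _ = _ := by push_cast; ring

/-- Comparison with the flat graph over the same set. It makes null parameter sets negligible on the
surface and bounded pieces of the surface finite in area. -/
lemma surf_graph_le {γ : Plane → ℝ} {L : NNReal} (hγ : LipschitzWith L γ) (S : Set Plane) :
    surf (graphMap γ '' S) ≤ (1 + L : NNReal) ^ 2 * volume S := by
  have h := surf_image_linear 0 S
  simp only [inner_zero_left, norm_zero, ne_eq, OfNat.ofNat_ne_zero, not_false_eq_true, zero_pow,
    add_zero, Real.sqrt_one, ENNReal.ofReal_one, one_mul] at h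
  rw [← h]
  refine surf_image_le_of_dist_le _ _ _ _ fun x _ y _ => (dist_graphMap_le hγ x y).trans ?_
  gcongr
  rw [dist_eq_norm, dist_eq_norm, lift_sub]
  exact norm_le_norm_lift _ _

/-- The set is cut into countably many pieces on which `γ` is `δ`-close to a linear function. On
each piece, replacing the graph by a linear one costs `(1 + δ) ^ 2` and replacing the area density
by its constant value costs another `1 + δ`, hence the cube. -/
lemma surf_graph_approx_lintegral {γ : Plane → ℝ} (hγ : Continuous γ) {S : Set Plane}
    (hS : MeasurableSet S) (hd : ∀ z ∈ S, DifferentiableAt ℝ γ z) {δ : NNReal} (hδ : δ ≠ 0) :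
    surf (graphMap γ '' S) ≤
      (1 + δ : NNReal) ^ 3 * ∫⁻ z in S, ENNReal.ofReal (areaDensity γ z) ∧
    ∫⁻ z in S, ENNReal.ofReal (areaDensity γ z) ≤
      (1 + δ : NNReal) ^ 3 * surf (graphMap γ '' S) := by
  rcases S.eq_empty_or_nonempty with rfl | hne
  · simp
  -- The partition and the derivative estimate are applied to the self-map `x ↦ γ x • e` of the
  -- plane; `‖e‖ = 1` keeps all norms unchanged.
  set e : Plane := EuclideanSpace.single 0 1
  have he : ‖e‖ = 1 := by simp [e]
  obtain ⟨t, A, htd, htm, hcov, happ, hA⟩ :=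
    exists_partition_approximatesLinearOn_of_hasFDerivWithinAt (fun x => γ x • e) S
      (fun x => (fderiv ℝ γ x).smulRight e)
      (fun x hx => ((hd x hx).hasFDerivAt.smul_const e).hasFDerivWithinAt) (fun _ => δ)
      (fun _ => hδ)
  choose y hyS hAy using hA hne
  set p : ℕ → Plane := fun n => (InnerProductSpace.toDual ℝ Plane).symm (fderiv ℝ γ (y n))
  have hp : ∀ n v, ⟪p n, v⟫ = fderiv ℝ γ (y n) v := fun n v =>
    InnerProductSpace.toDual_symm_apply
  have hpn : ∀ n, ‖p n‖ = ‖fderiv ℝ γ (y n)‖ := fun n => LinearIsometryEquiv.norm_map _ _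
  have hSm : ∀ n, MeasurableSet (S ∩ t n) := fun n => hS.inter (htm n)
  have hSd : Pairwise (Function.onFun Disjoint fun n => S ∩ t n) := fun i j hij =>
    (htd hij).mono inter_subset_right inter_subset_right
  have hSU : S = ⋃ n, S ∩ t n := by
    rw [← inter_iUnion]; exact (inter_eq_left.2 hcov).symm
  have hemb : MeasurableEmbedding (graphMap γ) :=
    (continuous_graphMap hγ).measurableEmbedding (graphMap_injective γ)
  have hsum1 : surf (graphMap γ '' S) = ∑' n, surf (graphMap γ '' (S ∩ t n)) := by
    conv_lhs => rw [hSU, image_iUnion]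
    refine measure_iUnion (fun i j hij => ?_) fun n => hemb.measurableSet_image.2 (hSm n)
    exact (disjoint_image_iff (graphMap_injective γ)).2 (hSd hij)
  have hsum2 : ∫⁻ z in S, ENNReal.ofReal (areaDensity γ z) =
      ∑' n, ∫⁻ z in S ∩ t n, ENNReal.ofReal (areaDensity γ z) := by
    conv_lhs => rw [hSU]
    exact lintegral_iUnion hSm hSd _
  -- At almost every point of a piece, namely at its density points, the linear approximation on the
  -- piece already determines the derivative up to `δ`.
  have hclose : ∀ n, ∀ᵐ x ∂volume.restrict (S ∩ t n), ‖fderiv ℝ γ x - fderiv ℝ γ (y n)‖ ≤ δ := by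
    intro n
    have := (happ n).norm_fderiv_sub_le volume (hSm n) (fun x => (fderiv ℝ γ x).smulRight e)
      (fun x hx => ((hd x hx.1).hasFDerivAt.smul_const e).hasFDerivWithinAt)
    filter_upwards [this] with x hx
    rw [hAy n, ← NNReal.coe_le_coe, coe_nnnorm] at hx
    have h2 : (fderiv ℝ γ x).smulRight e - (fderiv ℝ γ (y n)).smulRight e =
        (fderiv ℝ γ x - fderiv ℝ γ (y n)).smulRight e := by
      ext v; simp [sub_smul]
    rwa [h2, ContinuousLinearMap.norm_smulRight_apply, he, mul_one] at hx
  have happ' : ∀ n, ∀ x ∈ S ∩ t n, ∀ x' ∈ S ∩ t n,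
      |γ x - γ x' - ⟪p n, x - x'⟫| ≤ δ * ‖x - x'‖ := by
    intro n x hx x' hx'
    have := happ n x hx x' hx'
    rw [hAy n, ContinuousLinearMap.smulRight_apply, ← sub_smul, ← sub_smul, norm_smul, he,
      mul_one, Real.norm_eq_abs] at this
    rwa [hp]
  have hc : ∀ n, ENNReal.ofReal √(1 + ‖p n‖ ^ 2) * volume (S ∩ t n) ≤
      (1 + δ : NNReal) * ∫⁻ z in S ∩ t n, ENNReal.ofReal (areaDensity γ z) := by
    intro n
    rw [← setLIntegral_const, ← lintegral_const_mul' _ _ ENNReal.coe_ne_top]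
    refine lintegral_mono_ae ?_
    filter_upwards [hclose n] with x hx
    rw [← ENNReal.ofReal_coe_nnreal, ← ENNReal.ofReal_mul (NNReal.coe_nonneg _), hpn]
    refine ENNReal.ofReal_le_ofReal ?_
    push_cast
    refine sqrt_one_add_sq_le (norm_nonneg _) δ.2 (norm_nonneg _) ?_
    have := norm_le_norm_add_norm_sub (fderiv ℝ γ x) (fderiv ℝ γ (y n))
    exact this.trans (add_le_add le_rfl hx)
  have hc' : ∀ n, ∫⁻ z in S ∩ t n, ENNReal.ofReal (areaDensity γ z) ≤
      (1 + δ : NNReal) * (ENNReal.ofReal √(1 + ‖p n‖ ^ 2) * volume (S ∩ t n)) := by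
    intro n
    rw [← setLIntegral_const, ← lintegral_const_mul' _ _ ENNReal.coe_ne_top]
    refine lintegral_mono_ae ?_
    filter_upwards [hclose n] with x hx
    rw [← ENNReal.ofReal_coe_nnreal, ← ENNReal.ofReal_mul (NNReal.coe_nonneg _), hpn]
    refine ENNReal.ofReal_le_ofReal ?_
    push_cast
    refine sqrt_one_add_sq_le (norm_nonneg _) δ.2 (norm_nonneg _) ?_
    have := norm_le_norm_add_norm_sub' (fderiv ℝ γ x) (fderiv ℝ γ (y n))
    exact this.trans (add_le_add le_rfl hx)
  rw [hsum1, hsum2, ← ENNReal.tsum_mul_left, ← ENNReal.tsum_mul_left]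
  constructor <;> refine ENNReal.tsum_le_tsum fun n => ?_
  · refine (surf_graph_approx (happ' n)).1.trans ?_
    rw [pow_succ _ 2, mul_assoc]
    exact mul_le_mul_right (hc n) _
  · refine (hc' n).trans ?_
    rw [pow_succ' _ 2, mul_assoc]
    exact mul_le_mul_right (surf_graph_approx (happ' n)).2 _

lemma le_of_forall_one_add_pow_mul_le {a b : ENNReal}
    (h : ∀ δ : NNReal, δ ≠ 0 → a ≤ (1 + δ : NNReal) ^ 3 * b) : a ≤ b := by
  have hlim : Tendsto (fun δ : NNReal => (((1 + δ : NNReal) ^ 3 : NNReal) : ENNReal) * b) (𝓝[≠] 0)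
      (𝓝 (((1 + 0 : NNReal) ^ 3 : NNReal) * b)) := by
    refine ENNReal.Tendsto.mul_const ?_ (Or.inl (by simp))
    refine ENNReal.tendsto_coe.2 (Tendsto.mono_left ?_ nhdsWithin_le_nhds)
    exact Continuous.tendsto (by fun_prop) 0
  have := ge_of_tendsto hlim (eventually_nhdsWithin_of_forall fun δ hδ => by
    simpa using h δ hδ)
  simpa using this

/-- **Area formula** for the graph of a Lipschitz function. -/
theorem surf_graph_image {γ : Plane → ℝ} {L : NNReal} (hγ : LipschitzWith L γ) {S : Set Plane}
    (hS : MeasurableSet S) :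
    surf (graphMap γ '' S) = ∫⁻ z in S, ENNReal.ofReal (areaDensity γ z) := by
  set D := {z | DifferentiableAt ℝ γ z}
  have hD : MeasurableSet D := measurableSet_of_differentiableAt ℝ γ
  -- Rademacher's theorem: the non-differentiability set is null, and so is its image on the graph.
  -- Only differentiability points remain.
  have hnull : volume (S \ D) = 0 :=
    measure_mono_null (fun z hz => hz.2) hγ.ae_differentiableAt
  have hnull' : surf (graphMap γ '' (S \ D)) = 0 := by
    have := surf_graph_le hγ (S \ D)
    rwa [hnull, mul_zero, nonpos_iff_eq_zero] at this
  have h1 : surf (graphMap γ '' S) = surf (graphMap γ '' (S ∩ D)) := by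
    refine le_antisymm ?_ (measure_mono (image_mono inter_subset_left))
    conv_lhs => rw [← inter_union_sdiff S D, image_union]
    refine (measure_union_le _ _).trans ?_
    rw [hnull', add_zero]
  have h2 : ∫⁻ z in S, ENNReal.ofReal (areaDensity γ z) =
      ∫⁻ z in S ∩ D, ENNReal.ofReal (areaDensity γ z) := by
    refine setLIntegral_congr ?_
    refine (ae_eq_set.2 ⟨?_, ?_⟩)
    · rwa [sdiff_self_inter]
    · rw [inter_sdiff_assoc]; simp
  have h3 := fun δ hδ => surf_graph_approx_lintegral hγ.continuous (hS.inter hD)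
    (fun z hz => hz.2) (δ := δ) hδ
  rw [h1, h2]
  exact le_antisymm (le_of_forall_one_add_pow_mul_le fun δ hδ => (h3 δ hδ).1)
    (le_of_forall_one_add_pow_mul_le fun δ hδ => (h3 δ hδ).2)

/-! ### Graph charts of the boundary, the normal and the surface measure -/

/-- Moving from `x` along `n' - n` goes strictly inwards for `n` and strictly outwards for `n'`, so
a nearby point would lie both inside and outside `Ω`. -/
lemma IsOutwardNormal.unique {Ω : Set Space} {x n n' : Space} (h : IsOutwardNormal Ω x n)
    (h' : IsOutwardNormal Ω x n') : n = n' := by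
  by_contra hne
  set c := ⟪n, n'⟫
  have hc : c < 1 := inner_lt_one_iff_real_of_norm_eq_one h.1 h'.1 |>.2 hne
  set d := n' - n
  have hd0 : 0 < ‖d‖ := norm_pos_iff.2 (sub_ne_zero.2 (Ne.symm hne))
  have hd1 : ⟪d, n⟫ = c - 1 := by
    simp [d, c, inner_sub_left, real_inner_comm, h.1]
  have hd2 : ⟪d, n'⟫ = 1 - c := by
    simp [d, c, inner_sub_left, h'.1]
  -- Chosen so that `ε ‖d‖` is half of `1 - c`; both strict cone conditions then hold along the ray.
  set ε := (1 - c) / (2 * ‖d‖)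
  have hε : 0 < ε := by have := sub_pos.2 hc; positivity
  have hεd : ε * ‖d‖ = (1 - c) / 2 := by simp only [ε]; field_simp
  have hlim : Tendsto (fun t : ℝ => x + t • d) (𝓝[>] 0) (𝓝 x) := by
    have : Continuous fun t : ℝ => x + t • d := by fun_prop
    simpa using (this.tendsto 0).mono_left nhdsWithin_le_nhds
  obtain ⟨t, ⟨h1, h2⟩, ht⟩ :=
    (((hlim.eventually (h.2 ε hε)).and (hlim.eventually (h'.2 ε hε))).and
      self_mem_nhdsWithin).exists
  have ht : 0 < t := ht
  have e1 : x + t • d - x = t • d := by abel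
  rw [e1, norm_smul, real_inner_smul_left, Real.norm_of_nonneg ht.le] at h1 h2
  refine h2.2 ?_ (h1.1 ?_)
  · rw [hd2]; nlinarith
  · rw [hd1]; nlinarith

lemma normal_eq_of_isOutwardNormal {Ω : Set Space} {x n : Space} (h : IsOutwardNormal Ω x n) :
    normal Ω x = n := by
  have hex : ∃ n, IsOutwardNormal Ω x n := ⟨n, h⟩
  rw [normal, dif_pos hex]
  exact hex.choose_spec.unique h

lemma norm_normal_le (Ω : Set Space) (x : Space) : ‖normal Ω x‖ ≤ 1 := by
  rw [normal]
  split_ifs with h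
  · exact h.choose_spec.1.le
  · simp

/-- In the open set `B` and in the coordinates given by the isometry `R`, the set `Ω` is the set of
points above the graph of `γ`. -/
structure IsGraphChart (Ω : Set Space) (R : Space ≃ₗᵢ[ℝ] Space) (γ : Plane → ℝ) (L : NNReal)
    (B : Set Space) : Prop where
  lipschitz : LipschitzWith L γ
  isOpen : IsOpen B
  mem_iff : ∀ y ∈ B, y ∈ Ω ↔ γ (proj (R y)) < R y 2

lemma IsLipschitzDomain.exists_isGraphChart {Ω : Set Space} (hΩ : IsLipschitzDomain Ω) {x : Space}
    (hx : x ∈ frontier Ω) : ∃ R γ L B, IsGraphChart Ω R γ L B ∧ x ∈ B := by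
  obtain ⟨R, g, L, hg, hev⟩ := hΩ.2.2 x hx
  obtain ⟨B, hB, hBo, hxB⟩ := eventually_nhds_iff.1 hev
  exact ⟨R, g, L, B, ⟨hg, hBo, hB⟩, hxB⟩

/-- The parametrization of the graph of `γ` in the coordinates given by `R`. -/
def chartMap (R : Space ≃ₗᵢ[ℝ] Space) (γ : Plane → ℝ) (z : Plane) : Space :=
  R.symm (graphMap γ z)

@[simp] lemma apply_chartMap (R : Space ≃ₗᵢ[ℝ] Space) (γ : Plane → ℝ) (z : Plane) :
    R (chartMap R γ z) = lift z (γ z) := R.apply_symm_apply _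

lemma continuous_chartMap (R : Space ≃ₗᵢ[ℝ] Space) {γ : Plane → ℝ} (hγ : Continuous γ) :
    Continuous (chartMap R γ) :=
  R.symm.continuous.comp (continuous_graphMap hγ)

lemma measurableEmbedding_chartMap (R : Space ≃ₗᵢ[ℝ] Space) {γ : Plane → ℝ} (hγ : Continuous γ) :
    MeasurableEmbedding (chartMap R γ) :=
  (continuous_chartMap R hγ).measurableEmbedding
    (R.symm.injective.comp (graphMap_injective γ))

/-- The measure on the parameter plane that corresponds to the surface measure. -/
def areaMeasure (γ : Plane → ℝ) : Measure Plane :=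
  volume.withDensity fun z => ENNReal.ofReal (areaDensity γ z)

lemma one_le_areaDensity (γ : Plane → ℝ) (z : Plane) : 1 ≤ areaDensity γ z :=
  one_le_sqrt_one_add_sq _

/-- The density is at least 1. This carries properties valid almost everywhere on the boundary to
almost every parameter. -/
lemma volume_absolutelyContinuous_areaMeasure (γ : Plane → ℝ) :
    (volume : Measure Plane) ≪ areaMeasure γ := by
  refine withDensity_absolutelyContinuous' ?_ (Eventually.of_forall fun z => ?_)
  · exact (measurable_areaDensity γ).ennreal_ofReal.aemeasurable
  · simpa using (one_le_areaDensity γ z).trans_lt' one_pos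

lemma surf_restrict_range_chartMap (R : Space ≃ₗᵢ[ℝ] Space) {γ : Plane → ℝ} {L : NNReal}
    (hγ : LipschitzWith L γ) :
    surf.restrict (range (chartMap R γ)) = (areaMeasure γ).map (chartMap R γ) := by
  have hemb := measurableEmbedding_chartMap R hγ.continuous
  ext T hT
  rw [Measure.restrict_apply hT, hemb.map_apply, ← image_preimage_eq_inter_range, areaMeasure,
    withDensity_apply _ (hemb.measurable hT), ← surf_graph_image hγ (hemb.measurable hT)]
  rw [← R.symm.isometry.euclideanHausdorffMeasure_image (graphMap γ '' _), ← image_comp]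
  rfl

/-! ### Frontier, normal and surface integrals in one graph chart -/

namespace IsGraphChart

variable {Ω : Set Space} {R : Space ≃ₗᵢ[ℝ] Space} {γ : Plane → ℝ} {L : NNReal} {B : Set Space}

/-- A point of the closure outside the open set `Ω` is neither above the graph, by the chart, nor
below it, by continuity. Conversely a point on the graph is the limit of its vertical upward
translates, which lie in `Ω`. -/
lemma mem_frontier_iff (h : IsGraphChart Ω R γ L B) (hΩ : IsOpen Ω) {y : Space} (hy : y ∈ B) :
    y ∈ frontier Ω ↔ R y 2 = γ (proj (R y)) := by
  have hγ := h.lipschitz.continuous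
  have hc1 : Continuous fun y => R y 2 := by fun_prop
  have hc2 : Continuous fun y => γ (proj (R y)) :=
    hγ.comp (continuous_proj.comp R.continuous)
  rw [hΩ.frontier_eq]
  constructor
  · rintro ⟨h1, h2⟩
    rw [h.mem_iff y hy, not_lt] at h2
    refine le_antisymm h2 ?_
    have h3 : y ∈ closure (Ω ∩ B) := by
      rw [inter_comm]
      exact h.isOpen.inter_closure ⟨hy, h1⟩
    have h4 : Ω ∩ B ⊆ {y | γ (proj (R y)) ≤ R y 2} := fun w hw =>
      ((h.mem_iff w hw.2).1 hw.1).le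
    exact closure_minimal h4 (isClosed_le hc2 hc1) h3
  · intro he
    refine ⟨?_, fun h2 => ((h.mem_iff y hy).1 h2).ne' he⟩
    have hlim : Tendsto (fun t : ℝ => R.symm (lift (proj (R y)) (R y 2 + t))) (𝓝[>] 0) (𝓝 y) := by
      have : Continuous fun t : ℝ => R.symm (lift (proj (R y)) (R y 2 + t)) :=
        R.symm.continuous.comp (continuous_lift.comp
          (continuous_const.prodMk (continuous_const.add continuous_id)))
      simpa using (this.tendsto 0).mono_left nhdsWithin_le_nhds
    refine mem_closure_of_tendsto hlim ?_
    filter_upwards [hlim (h.isOpen.mem_nhds hy), self_mem_nhdsWithin] with t ht1 ht2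
    have ht2 : 0 < t := ht2
    refine (h.mem_iff _ ht1).2 ?_
    simp [he, ht2]

lemma chartMap_mem_frontier (h : IsGraphChart Ω R γ L B) (hΩ : IsOpen Ω) {z : Plane}
    (hz : chartMap R γ z ∈ B) : chartMap R γ z ∈ frontier Ω := by
  rw [h.mem_frontier_iff hΩ hz]; simp

lemma frontier_inter_subset_range (h : IsGraphChart Ω R γ L B) (hΩ : IsOpen Ω) :
    frontier Ω ∩ B ⊆ range (chartMap R γ) := by
  rintro y ⟨hy, hyB⟩
  refine ⟨proj (R y), ?_⟩
  rw [chartMap, graphMap, ← (h.mem_frontier_iff hΩ hyB).1 hy, lift_proj, R.symm_apply_apply]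

lemma preimage_frontier_inter (h : IsGraphChart Ω R γ L B) (hΩ : IsOpen Ω) :
    chartMap R γ ⁻¹' (frontier Ω ∩ B) = chartMap R γ ⁻¹' B := by
  ext z
  exact ⟨fun hz => hz.2, fun hz => ⟨h.chartMap_mem_frontier hΩ hz, hz⟩⟩

lemma surf_restrict (h : IsGraphChart Ω R γ L B) (hΩ : IsOpen Ω) :
    surf.restrict (frontier Ω ∩ B) =
      ((areaMeasure γ).restrict (chartMap R γ ⁻¹' B)).map (chartMap R γ) := by
  have hm : MeasurableSet (frontier Ω ∩ B) := isClosed_frontier.measurableSet.inter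
    h.isOpen.measurableSet
  have hemb := measurableEmbedding_chartMap R h.lipschitz.continuous
  rw [← h.preimage_frontier_inter hΩ, ← hemb.restrict_map, ← surf_restrict_range_chartMap R
    h.lipschitz, Measure.restrict_restrict hm,
    inter_eq_left.2 (h.frontier_inter_subset_range hΩ)]

lemma ae_of_ae_frontier (h : IsGraphChart Ω R γ L B) (hΩ : IsOpen Ω) {P : Space → Prop}
    (hP : ∀ᵐ y ∂surf.restrict (frontier Ω), P y) :
    ∀ᵐ z : Plane, chartMap R γ z ∈ B → P (chartMap R γ z) := by
  have h1 : ∀ᵐ y ∂surf.restrict (frontier Ω ∩ B), P y :=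
    ae_mono (Measure.restrict_mono inter_subset_left le_rfl) hP
  have hemb := measurableEmbedding_chartMap R h.lipschitz.continuous
  rw [h.surf_restrict hΩ, hemb.ae_map_iff,
    ae_restrict_iff' (hemb.measurable h.isOpen.measurableSet)] at h1
  exact (volume_absolutelyContinuous_areaMeasure γ).ae_le h1

lemma setIntegral_frontier (h : IsGraphChart Ω R γ L B) (hΩ : IsOpen Ω) (f : Space → ℝ) :
    ∫ y in frontier Ω ∩ B, f y ∂surf =
      ∫ z in chartMap R γ ⁻¹' B, areaDensity γ z * f (chartMap R γ z) := by
  have hemb := measurableEmbedding_chartMap R h.lipschitz.continuous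
  have hm : MeasurableSet (chartMap R γ ⁻¹' B) := hemb.measurable h.isOpen.measurableSet
  rw [h.surf_restrict hΩ, hemb.integral_map, areaMeasure,
    setIntegral_withDensity_eq_setIntegral_toReal_smul
      (measurable_areaDensity γ).ennreal_ofReal (by simp) _ hm]
  refine integral_congr_ae (Eventually.of_forall fun z => ?_)
  simp only [smul_eq_mul]
  rw [ENNReal.toReal_ofReal (one_pos.le.trans (one_le_areaDensity γ z))]

/-- The vector `(∇γ, -1)`, normal to the graph of `γ`, in the coordinates given by `R`. -/
def conormal (R : Space ≃ₗᵢ[ℝ] Space) (γ : Plane → ℝ) (z : Plane) : Space :=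
  R.symm (lift ((InnerProductSpace.toDual ℝ Plane).symm (fderiv ℝ γ z)) (-1))

lemma norm_conormal (z : Plane) : ‖conormal R γ z‖ = areaDensity γ z := by
  rw [conormal, LinearIsometryEquiv.norm_map, areaDensity, ← Real.sqrt_sq (norm_nonneg (lift _ _)),
    norm_lift_sq, LinearIsometryEquiv.norm_map]
  ring_nf

lemma inner_conormal (v : Space) (z : Plane) :
    ⟪v, conormal R γ z⟫ = fderiv ℝ γ z (proj (R v)) - R v 2 := by
  rw [conormal, ← R.inner_map_map, R.apply_symm_apply]
  conv_lhs => rw [← lift_proj (R v)]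
  rw [inner_lift, real_inner_comm, InnerProductSpace.toDual_symm_apply]
  ring

/-- The inner product of `y - x` with the conormal is the linearised increment of `γ` minus the
increment of height. Differentiability of `γ` therefore says that its sign decides the side of the
graph, up to an error `ε ‖y - x‖`. -/
lemma isOutwardNormal (h : IsGraphChart Ω R γ L B) {z : Plane}
    (hz : chartMap R γ z ∈ B) (hd : DifferentiableAt ℝ γ z) :
    IsOutwardNormal Ω (chartMap R γ z) ((areaDensity γ z)⁻¹ • conormal R γ z) := by
  set J := areaDensity γ z
  have hJ : 1 ≤ J := one_le_areaDensity γ z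
  have hJ0 : 0 < J := one_pos.trans_le hJ
  constructor
  · rw [norm_smul, norm_conormal, Real.norm_of_nonneg (by positivity), inv_mul_cancel₀ hJ0.ne']
  intro ε hε
  have hlim : Tendsto (fun y => proj (R y)) (𝓝 (chartMap R γ z)) (𝓝 z) := by
    have := (continuous_proj.comp R.continuous).tendsto (chartMap R γ z)
    simpa [Function.comp_def] using this
  have hlin := hlim.eventually ((hasFDerivAt_iff_isLittleO.1 hd.hasFDerivAt).def hε)
  filter_upwards [hlin, h.isOpen.mem_nhds hz] with y hy hyB
  rw [h.mem_iff y hyB, inner_smul_right, inner_conormal, map_sub, proj_sub, apply_chartMap,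
    proj_lift, PiLp.sub_apply, lift_two]
  have hle : ‖proj (R y) - z‖ ≤ ‖y - chartMap R γ z‖ := by
    have := norm_proj_le (R (y - chartMap R γ z))
    rwa [map_sub, proj_sub, apply_chartMap, proj_lift, ← apply_chartMap R, ← map_sub,
      R.norm_map] at this
  have hle' := mul_le_mul_of_nonneg_left hle hε.le
  have hpos : 0 ≤ ε * ‖y - chartMap R γ z‖ := by positivity
  rw [Real.norm_eq_abs, abs_le] at hy
  -- Normalisation divides by `J ≥ 1`; clearing it only enlarges the margin, so the same `ε` serves.
  have hJm : ε * ‖y - chartMap R γ z‖ ≤ J * (ε * ‖y - chartMap R γ z‖) :=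
    le_mul_of_one_le_left hpos hJ
  constructor
  · intro h1
    rw [inv_mul_lt_iff₀ hJ0] at h1
    nlinarith
  · intro h1
    rw [lt_inv_mul_iff₀ hJ0] at h1
    nlinarith

/-- The normalisation of the normal cancels the area density. Flux integrals thus become plane
integrals that are affine in the derivative of `γ`, a form in which smooth approximations of `γ`
pass to the limit. -/
lemma areaDensity_smul_normal (h : IsGraphChart Ω R γ L B) {z : Plane}
    (hz : chartMap R γ z ∈ B) (hd : DifferentiableAt ℝ γ z) :
    areaDensity γ z • normal Ω (chartMap R γ z) = conormal R γ z := by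
  rw [normal_eq_of_isOutwardNormal (h.isOutwardNormal hz hd), smul_smul,
    mul_inv_cancel₀ (one_pos.trans_le (one_le_areaDensity γ z)).ne', one_smul]

lemma measurable_conormal : Measurable (conormal R γ) := by
  unfold conormal
  have h1 := measurable_fderiv ℝ γ
  have h2 : Continuous fun ℓ : Plane →L[ℝ] ℝ =>
      R.symm (lift ((InnerProductSpace.toDual ℝ Plane).symm ℓ) (-1)) :=
    R.symm.continuous.comp (continuous_lift.comp
      ((LinearIsometryEquiv.continuous _).prodMk continuous_const))
  exact h2.measurable.comp h1

/-- The normal field is defined by choice at each point; measurability comes from its almost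
everywhere agreement with the explicit chart formula. -/
lemma aestronglyMeasurable_normal (h : IsGraphChart Ω R γ L B) (hΩ : IsOpen Ω) :
    AEStronglyMeasurable (normal Ω) (surf.restrict (frontier Ω ∩ B)) := by
  have hemb := measurableEmbedding_chartMap R h.lipschitz.continuous
  have hm : MeasurableSet (chartMap R γ ⁻¹' B) := hemb.measurable h.isOpen.measurableSet
  rw [h.surf_restrict hΩ, hemb.aestronglyMeasurable_map_iff]
  refine AEStronglyMeasurable.congr (f := fun z => (areaDensity γ z)⁻¹ • conormal R γ z) ?_ ?_
  · exact ((measurable_areaDensity γ).inv.smul measurable_conormal).aestronglyMeasurable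
  · rw [EventuallyEq, ae_restrict_iff' hm]
    refine (withDensity_absolutelyContinuous _ _).ae_le ?_
    filter_upwards [h.lipschitz.ae_differentiableAt] with z hz hzB
    exact (normal_eq_of_isOutwardNormal (h.isOutwardNormal hzB hz)).symm

/-- The chart domain may be unbounded; the unit ball confines the parameters to a disc, over which
the Lipschitz graph has finite area. -/
lemma surf_inter_lt_top (h : IsGraphChart Ω R γ L B) (hΩ : IsOpen Ω) (x : Space) :
    surf (frontier Ω ∩ (B ∩ Metric.ball x 1)) < ⊤ := by
  have hsub : frontier Ω ∩ (B ∩ Metric.ball x 1) ⊆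
      R.symm '' (graphMap γ '' Metric.ball (proj (R x)) 1) := by
    rintro y ⟨hy, hyB, hyx⟩
    obtain ⟨z, rfl⟩ := h.frontier_inter_subset_range hΩ ⟨hy, hyB⟩
    refine ⟨_, ⟨z, ?_, rfl⟩, rfl⟩
    rw [Metric.mem_ball, dist_eq_norm] at hyx ⊢
    refine lt_of_le_of_lt ?_ hyx
    have := norm_proj_le (R (chartMap R γ z - x))
    rwa [R.norm_map, map_sub, proj_sub, apply_chartMap, proj_lift] at this
  refine (measure_mono hsub).trans_lt ?_
  rw [R.symm.isometry.euclideanHausdorffMeasure_image]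
  refine (surf_graph_le h.lipschitz _).trans_lt ?_
  exact ENNReal.mul_lt_top (by simp) measure_ball_lt_top

end IsGraphChart

/-! ### Global properties of the boundary by compactness -/

namespace IsLipschitzDomain

variable {Ω : Set Space}

lemma isCompact_frontier (hΩ : IsLipschitzDomain Ω) : IsCompact (frontier Ω) :=
  Metric.isCompact_of_isClosed_isBounded isClosed_frontier
    (hΩ.2.1.closure.subset frontier_subset_closure)

lemma surf_frontier_lt_top (hΩ : IsLipschitzDomain Ω) : surf (frontier Ω) < ⊤ := by
  refine hΩ.isCompact_frontier.measure_lt_top_of_nhdsWithin fun x hx => ?_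
  obtain ⟨R, γ, L, B, h, hxB⟩ := hΩ.exists_isGraphChart hx
  refine ⟨frontier Ω ∩ (B ∩ Metric.ball x 1), ?_, h.surf_inter_lt_top hΩ.1 x⟩
  exact inter_mem_nhdsWithin _ ((h.isOpen.inter Metric.isOpen_ball).mem_nhds ⟨hxB, by simp⟩)

lemma isFiniteMeasure_surf (hΩ : IsLipschitzDomain Ω) :
    IsFiniteMeasure (surf.restrict (frontier Ω)) :=
  ⟨by simpa using hΩ.surf_frontier_lt_top⟩

lemma isFiniteMeasure_volume (hΩ : IsLipschitzDomain Ω) :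
    IsFiniteMeasure ((volume : Measure Space).restrict Ω) :=
  ⟨by simpa using hΩ.2.1.measure_lt_top⟩

lemma aestronglyMeasurable_normal (hΩ : IsLipschitzDomain Ω) :
    AEStronglyMeasurable (normal Ω) (surf.restrict (frontier Ω)) := by
  have hch : ∀ x ∈ frontier Ω, ∃ B, IsOpen B ∧ x ∈ B ∧
      AEStronglyMeasurable (normal Ω) (surf.restrict (frontier Ω ∩ B)) := by
    intro x hx
    obtain ⟨R, γ, L, B, h, hxB⟩ := hΩ.exists_isGraphChart hx
    exact ⟨B, h.isOpen, hxB, h.aestronglyMeasurable_normal hΩ.1⟩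
  choose! B hBo hBx hBm using hch
  obtain ⟨t, ht, hcov⟩ := hΩ.isCompact_frontier.elim_nhds_subcover B
    fun x hx => (hBo x hx).mem_nhds (hBx x hx)
  have heq : frontier Ω = ⋃ x : t, frontier Ω ∩ B x := by
    rw [← inter_iUnion, eq_comm, inter_eq_left]
    intro y hy
    obtain ⟨x, hx, hyx⟩ := mem_iUnion₂.1 (hcov hy)
    exact mem_iUnion.2 ⟨⟨x, hx⟩, hyx⟩
  rw [heq, aestronglyMeasurable_iUnion_iff]
  exact fun x => hBm x (ht x x.2)

end IsLipschitzDomain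

section

open scoped Convolution

/-! ### Mollification -/

/-- A sequence of bump functions whose supports shrink to a point. -/
def bumpSeq (E : Type*) [NormedAddCommGroup E] (k : ℕ) : ContDiffBump (0 : E) where
  rIn := 1 / ((k : ℝ) + 1)
  rOut := 2 / ((k : ℝ) + 1)
  rIn_pos := by positivity
  rIn_lt_rOut := by gcongr; norm_num

lemma tendsto_rOut_bumpSeq (E : Type*) [NormedAddCommGroup E] :
    Tendsto (fun k => (bumpSeq E k).rOut) atTop (𝓝 0) := by
  have := (tendsto_one_div_add_atTop_nhds_zero_nat (𝕜 := ℝ)).const_mul 2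
  rw [mul_zero] at this
  refine this.congr fun k => ?_
  simp [bumpSeq, div_eq_mul_inv]

/-- The bounded ratio of the radii is what gives convergence of mollifications of a locally
integrable function at almost every point. -/
lemma rOut_bumpSeq_le (E : Type*) [NormedAddCommGroup E] (k : ℕ) :
    (bumpSeq E k).rOut ≤ 2 * (bumpSeq E k).rIn := by
  simp [bumpSeq, div_eq_mul_inv]

/-- A Lipschitz function is a uniform limit of smooth functions with the same Lipschitz bound and
with derivatives that converge almost everywhere. -/
lemma _root_.LipschitzWith.exists_smooth_approx {γ : Plane → ℝ} {L : NNReal}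
    (hγ : LipschitzWith L γ) :
    ∃ (γs : ℕ → Plane → ℝ) (δ : ℕ → ℝ), (∀ k, 0 < δ k) ∧ Tendsto δ atTop (𝓝 0) ∧
      (∀ k, ContDiff ℝ ∞ (γs k)) ∧ (∀ k z, |γs k z - γ z| ≤ δ k) ∧
      (∀ k z, ‖fderiv ℝ (γs k) z‖ ≤ L) ∧
      ∀ᵐ z, Tendsto (fun k => fderiv ℝ (γs k) z) atTop (𝓝 (fderiv ℝ γ z)) := by
  set ρ : ℕ → Plane → ℝ := fun k => (bumpSeq Plane k).normed volume
  set γs : ℕ → Plane → ℝ := fun k => ρ k ⋆[ContinuousLinearMap.lsmul ℝ ℝ, volume] γ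
  have hρi : ∀ k, Integrable (ρ k) := fun k => (bumpSeq Plane k).integrable_normed
  have hρ0 : ∀ k x, 0 ≤ ρ k x := fun k x => (bumpSeq Plane k).nonneg_normed x
  have hρ1 : ∀ k, ∫ x, ρ k x = 1 := fun k => (bumpSeq Plane k).integral_normed
  have hmf := measurable_fderiv ℝ γ
  -- The derivative is put on `γ`, where it exists almost everywhere, instead of on the kernel. Then
  -- the derivative of the mollification is the mollification of the derivative, which yields both
  -- the bound `L` and the almost everywhere convergence.
  have hder : ∀ k z, HasFDerivAt (γs k)
      ((ρ k ⋆[ContinuousLinearMap.lsmul ℝ ℝ, volume] fderiv ℝ γ) z) z := by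
    intro k z
    refine (hasFDerivAt_integral_of_dominated_loc_of_lip (s := univ)
      (F := fun x a => ContinuousLinearMap.lsmul ℝ ℝ (ρ k a) (γ (x - a)))
      (F' := fun a => ContinuousLinearMap.lsmul ℝ ℝ (ρ k a) (fderiv ℝ γ (z - a)))
      (bound := fun a => ρ k a * L) univ_mem ?_ ?_ ?_ ?_ ?_ ?_).2
    · refine Eventually.of_forall fun x => ?_
      have h1 : Continuous (ρ k) := (bumpSeq Plane k).continuous_normed
      have h2 := hγ.continuous
      exact Continuous.aestronglyMeasurable (by simp only [ContinuousLinearMap.lsmul_apply]; fun_prop)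
    · have h1 : Continuous (ρ k) := (bumpSeq Plane k).continuous_normed
      have h2 := hγ.continuous
      refine Continuous.integrable_of_hasCompactSupport
        (by simp only [ContinuousLinearMap.lsmul_apply]; fun_prop) ?_
      exact (bumpSeq Plane k).hasCompactSupport_normed.smul_right
    · simp only [ContinuousLinearMap.lsmul_apply]
      refine ((hρi k).aestronglyMeasurable).smul ?_
      exact (hmf.comp (measurable_const.sub measurable_id)).aestronglyMeasurable
    · refine Eventually.of_forall fun a => ?_
      refine LipschitzOnWith.of_dist_le_mul fun x _ y _ => ?_
      simp only [ContinuousLinearMap.lsmul_apply, smul_eq_mul]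
      rw [Real.dist_eq, ← mul_sub, abs_mul, Real.coe_nnabs, abs_mul, NNReal.abs_eq, mul_assoc]
      have := hγ.dist_le_mul (x - a) (y - a)
      rw [dist_sub_right, Real.dist_eq] at this
      gcongr
    · exact (hρi k).mul_const _
    · have h1 : ∀ᵐ a, DifferentiableAt ℝ γ (z - a) :=
        (quasiMeasurePreserving_sub_left volume z).ae hγ.ae_differentiableAt
      filter_upwards [h1] with a ha
      have h2 : HasFDerivAt (fun x => γ (x - a)) (fderiv ℝ γ (z - a)) z := by
        have := ha.hasFDerivAt.comp z ((hasFDerivAt_id z).sub_const a)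
        simpa [Function.comp_def] using this
      exact h2.const_smul (ρ k a)
  -- `L` times the kernel radius bounds the uniform error; the extra 1 keeps `δ` positive when `L =
  -- 0`.
  refine ⟨γs, fun k => (L + 1) * (bumpSeq Plane k).rOut, fun k => ?_, ?_, fun k => ?_,
    fun k z => ?_, fun k z => ?_, ?_⟩
  · have := (bumpSeq Plane k).rOut_pos
    positivity
  · simpa using (tendsto_rOut_bumpSeq Plane).const_mul ((L : ℝ) + 1)
  · exact HasCompactSupport.contDiff_convolution_left _
      (bumpSeq Plane k).hasCompactSupport_normed (bumpSeq Plane k).contDiff_normed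
      hγ.continuous.locallyIntegrable
  · rw [← Real.dist_eq]
    refine ContDiffBump.dist_normed_convolution_le hγ.continuous.aestronglyMeasurable ?_
    intro x hx
    have h1 := hγ.dist_le_mul x z
    have h2 := (Metric.mem_ball.1 hx).le
    have h3 := (bumpSeq Plane k).rOut_pos
    nlinarith [mul_le_mul_of_nonneg_left h2 L.2]
  · rw [(hder k z).fderiv]
    rw [MeasureTheory.convolution_def]
    refine (norm_integral_le_of_norm_le ((hρi k).mul_const (L : ℝ))
      (Eventually.of_forall fun a => ?_)).trans ?_
    · rw [ContinuousLinearMap.lsmul_apply, norm_smul, Real.norm_of_nonneg (hρ0 k a)]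
      exact mul_le_mul_of_nonneg_left (norm_fderiv_le_of_lipschitz ℝ hγ) (hρ0 k a)
    · rw [integral_mul_const, hρ1, one_mul]
  · have hloc : LocallyIntegrable (fderiv ℝ γ) (volume : Measure Plane) := by
      have hb : LocallyIntegrable (fun _ : Plane => (L : ℝ)) volume :=
        continuous_const.locallyIntegrable
      refine hb.mono hmf.aestronglyMeasurable (Eventually.of_forall fun z => ?_)
      exact (norm_fderiv_le_of_lipschitz ℝ hγ).trans (le_abs_self _)
    have := ContDiffBump.ae_convolution_tendsto_right_of_locallyIntegrable
      (tendsto_rOut_bumpSeq Plane) (Eventually.of_forall (rOut_bumpSeq_le Plane)) hloc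
    filter_upwards [this] with z hz
    exact hz.congr fun k => ((hder k z).fderiv).symm

end

/-! ### A change of variables adapted to graphs -/

lemma measurePreserving_lift : MeasurePreserving fun p : Plane × ℝ => lift p.1 p.2 := by
  have h1 : MeasurePreserving (fun p : Plane × ℝ => (p.2, WithLp.ofLp p.1))
      volume volume :=
    ((MeasurePreserving.id volume).prod (PiLp.volume_preserving_ofLp (Fin 2))).comp
      Measure.measurePreserving_swap
  have h2 := (volume_preserving_piFinSuccAbove (fun _ : Fin 3 => ℝ) 2).symm.comp h1
  have h3 := (PiLp.volume_preserving_toLp (Fin 3)).comp h2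
  convert! h3 using 1
  funext p
  ext i
  fin_cases i <;> rfl

/-- The point at height `γ z + δ s` over `z`, in the coordinates given by `R`. -/
def shearMap (R : Space ≃ₗᵢ[ℝ] Space) (γ : Plane → ℝ) (δ : ℝ) (p : Plane × ℝ) : Space :=
  R.symm (lift p.1 (γ p.1 + δ * p.2))

lemma continuous_shearMap (R : Space ≃ₗᵢ[ℝ] Space) {γ : Plane → ℝ} (hγ : Continuous γ) (δ : ℝ) :
    Continuous (shearMap R γ δ) :=
  R.symm.continuous.comp (continuous_lift.comp (continuous_fst.prodMk
    ((hγ.comp continuous_fst).add (continuous_const.mul continuous_snd))))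

lemma measurableEmbedding_shearMap (R : Space ≃ₗᵢ[ℝ] Space) {γ : Plane → ℝ} (hγ : Continuous γ)
    {δ : ℝ} (hδ : δ ≠ 0) : MeasurableEmbedding (shearMap R γ δ) := by
  refine (continuous_shearMap R hγ δ).measurableEmbedding fun p q h => ?_
  have h1 := R.symm.injective h
  have h2 : p.1 = q.1 := by simpa using congrArg proj h1
  have h3 : p.2 = q.2 := by
    have := congrArg (fun y : Space => y 2) h1
    simpa [h2, hδ] using this
  exact Prod.ext h2 h3

/-- Translating every vertical line by `γ z` preserves volume without any differentiability of `γ`,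
and `R` is an isometry. Only the scaling of the height contributes a factor. -/
lemma map_shearMap (R : Space ≃ₗᵢ[ℝ] Space) {γ : Plane → ℝ} (hγ : Continuous γ)
    {δ : ℝ} (hδ : 0 < δ) :
    (volume : Measure (Plane × ℝ)).map (shearMap R γ δ) = ENNReal.ofReal δ⁻¹ • volume := by
  have h1 : MeasurePreserving (fun p : Plane × ℝ => (p.1, γ p.1 + p.2)) volume volume := by
    refine (MeasurePreserving.id volume).skew_product (g := fun z t => γ z + t) ?_ ?_
    · have := hγ.measurable
      fun_prop
    · exact Eventually.of_forall fun z => map_add_left_eq_self volume (γ z)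
  have h2 : (volume : Measure (Plane × ℝ)).map (Prod.map id (δ * ·)) =
      ENNReal.ofReal δ⁻¹ • volume := by
    rw [Measure.volume_eq_prod, ← Measure.map_prod_map _ _ measurable_id (by fun_prop),
      Measure.map_id, Real.map_volume_mul_left hδ.ne', Measure.prod_smul_right,
      abs_of_pos (by positivity)]
  have h3 := R.symm.measurePreserving.comp (measurePreserving_lift.comp h1)
  have h5 : Measurable (Prod.map id (δ * ·) : Plane × ℝ → Plane × ℝ) := by fun_prop
  refine (Measure.map_map h3.measurable h5).symm.trans ?_
  rw [h2, Measure.map_smul, h3.map_eq]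

lemma quasiMeasurePreserving_shearMap (R : Space ≃ₗᵢ[ℝ] Space) {γ : Plane → ℝ} (hγ : Continuous γ)
    {δ : ℝ} (hδ : 0 < δ) : Measure.QuasiMeasurePreserving (shearMap R γ δ) := by
  refine ⟨(continuous_shearMap R hγ δ).measurable, ?_⟩
  rw [map_shearMap R hγ hδ]
  exact Measure.smul_absolutelyContinuous

lemma integral_comp_shearMap (R : Space ≃ₗᵢ[ℝ] Space) {γ : Plane → ℝ} (hγ : Continuous γ)
    {δ : ℝ} (hδ : 0 < δ) (f : Space → ℝ) :
    ∫ y, f y = δ * ∫ p, f (shearMap R γ δ p) := by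
  rw [← (measurableEmbedding_shearMap R hγ hδ.ne').integral_map, map_shearMap R hγ hδ,
    integral_smul_measure, ENNReal.toReal_ofReal (by positivity), smul_eq_mul,
    mul_inv_cancel_left₀ hδ.ne']

/-! ### A smooth cutoff function -/

/-- A smooth function that is `0` for `t ≤ 2` and `1` for `3 ≤ t`. -/
def cutoff (t : ℝ) : ℝ := Real.smoothTransition (t - 2)

lemma contDiff_cutoff : ContDiff ℝ ∞ cutoff :=
  Real.smoothTransition.contDiff.comp (contDiff_id.sub contDiff_const)

lemma cutoff_of_le {t : ℝ} (h : t ≤ 2) : cutoff t = 0 :=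
  Real.smoothTransition.zero_of_nonpos (by linarith)

lemma cutoff_of_ge {t : ℝ} (h : 3 ≤ t) : cutoff t = 1 :=
  Real.smoothTransition.one_of_one_le (by linarith)

lemma abs_cutoff_le (t : ℝ) : |cutoff t| ≤ 1 := by
  rw [cutoff, abs_of_nonneg (Real.smoothTransition.nonneg _)]
  exact Real.smoothTransition.le_one _

lemma hasDerivAt_cutoff (t : ℝ) : HasDerivAt cutoff (deriv cutoff t) t :=
  (contDiff_cutoff.differentiable (by simp) t).hasDerivAt

lemma continuous_deriv_cutoff : Continuous (deriv cutoff) :=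
  contDiff_cutoff.continuous_deriv (by simp)

lemma deriv_cutoff_eq_zero {t : ℝ} (h : t ∉ Icc 2 3) : deriv cutoff t = 0 := by
  rw [mem_Icc, not_and_or, not_le, not_le] at h
  rcases h with h | h
  · have : cutoff =ᶠ[𝓝 t] fun _ => 0 := by
      filter_upwards [Iio_mem_nhds h] with s hs using cutoff_of_le (le_of_lt hs)
    rw [this.deriv_eq, deriv_const]
  · have : cutoff =ᶠ[𝓝 t] fun _ => 1 := by
      filter_upwards [Ioi_mem_nhds h] with s hs using cutoff_of_ge (le_of_lt hs)
    rw [this.deriv_eq, deriv_const]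

lemma hasCompactSupport_deriv_cutoff : HasCompactSupport (deriv cutoff) :=
  HasCompactSupport.intro isCompact_Icc fun _ ht => deriv_cutoff_eq_zero ht

lemma integral_deriv_cutoff : ∫ t, deriv cutoff t = 1 := by
  have h := integral_of_hasDerivAt_of_tendsto hasDerivAt_cutoff
    (continuous_deriv_cutoff.integrable_of_hasCompactSupport hasCompactSupport_deriv_cutoff)
    (m := 0) (n := 1) ?_ ?_
  · simpa using h
  · refine tendsto_const_nhds.congr' ?_
    filter_upwards [Iic_mem_atBot 2] with t ht using (cutoff_of_le ht).symm
  · refine tendsto_const_nhds.congr' ?_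
    filter_upwards [Ici_mem_atTop 3] with t ht using (cutoff_of_ge ht).symm

/-! ### Weak divergence -/

/-- The integrable function `g` is the weak divergence of the field `F` in `Ω`. -/
def HasWeakDiv (Ω : Set Space) (F : Space → Space) (g : Space → ℝ) : Prop :=
  ∀ η : Space → ℝ, ContDiff ℝ ∞ η → HasCompactSupport η → tsupport η ⊆ Ω →
    ∫ x in Ω, η x * g x = -∫ x in Ω, fderiv ℝ η x (F x)

/-- A bounded measurable vector field whose value at almost every boundary point is the limit from
inside `Ω`. -/
structure IsTraceField (Ω : Set Space) (F : Space → Space) (C : ℝ) : Prop where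
  nonneg : 0 ≤ C
  bounded : ∀ x ∈ closure Ω, ‖F x‖ ≤ C
  meas_interior : AEStronglyMeasurable F (volume.restrict Ω)
  meas_boundary : AEStronglyMeasurable F (surf.restrict (frontier Ω))
  limit : ∀ᵐ x ∂(surf.restrict (frontier Ω)), Tendsto F (𝓝[Ω] x) (𝓝 (F x))

/-- The projection to the horizontal plane as a continuous linear map. -/
def projL : Space →L[ℝ] Plane :=
  LinearMap.toContinuousLinearMap
    { toFun := proj
      map_add' := fun x y => by ext i; fin_cases i <;> rfl
      map_smul' := fun c x => by ext i; fin_cases i <;> rfl }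

@[simp] lemma projL_apply (y : Space) : projL y = proj y := rfl

/-- The function that increases from `0` to `1` between the heights `γ + 2δ` and `γ + 3δ`. -/
def layer (R : Space ≃ₗᵢ[ℝ] Space) (γ : Plane → ℝ) (δ : ℝ) (y : Space) : ℝ :=
  cutoff ((R y 2 - γ (proj (R y))) / δ)

lemma contDiff_layer (R : Space ≃ₗᵢ[ℝ] Space) {γ : Plane → ℝ} (hγ : ContDiff ℝ ∞ γ) (δ : ℝ) :
    ContDiff ℝ ∞ (layer R γ δ) := by
  have h1 : ContDiff ℝ ∞ fun y => γ (proj (R y)) :=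
    hγ.comp (projL.contDiff.comp R.contDiff)
  have h2 : ContDiff ℝ ∞ fun y => R y 2 :=
    (EuclideanSpace.proj (𝕜 := ℝ) (2 : Fin 3)).contDiff.comp R.contDiff
  exact contDiff_cutoff.comp ((h2.sub h1).div_const δ)

/-- In the sheared coordinates the layer function is just the cutoff of the rescaled height. Its
gradient is `-1/δ` times the derivative of the cutoff times the conormal, and this `1/δ` cancels the
Jacobian `δ` of the shear. -/
lemma fderiv_layer_shearMap (R : Space ≃ₗᵢ[ℝ] Space) {γ : Plane → ℝ} (hγ : ContDiff ℝ ∞ γ) {δ : ℝ}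
    (hδ : δ ≠ 0) (p : Plane × ℝ) (v : Space) :
    fderiv ℝ (layer R γ δ) (shearMap R γ δ p) v =
      deriv cutoff p.2 / δ * (R v 2 - fderiv ℝ γ p.1 (proj (R v))) := by
  set y := shearMap R γ δ p
  have hy : R y = lift p.1 (γ p.1 + δ * p.2) := R.apply_symm_apply _
  have hR : HasFDerivAt (fun y => R y) (R.toContinuousLinearEquiv : Space →L[ℝ] Space) y :=
    R.toContinuousLinearEquiv.hasFDerivAt
  have h1 : HasFDerivAt (fun y => γ (proj (R y)))
      ((fderiv ℝ γ p.1).comp (projL.comp (R.toContinuousLinearEquiv : Space →L[ℝ] Space))) y := by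
    have h0 : HasFDerivAt γ (fderiv ℝ γ p.1) (projL (R y)) := by
      rw [hy, projL_apply, proj_lift]
      exact (hγ.differentiable (by simp) _).hasFDerivAt
    exact h0.comp y ((projL.hasFDerivAt).comp y hR)
  have h2 : HasFDerivAt (fun y => R y 2)
      ((EuclideanSpace.proj (𝕜 := ℝ) (2 : Fin 3)).comp
        (R.toContinuousLinearEquiv : Space →L[ℝ] Space)) y :=
    ((EuclideanSpace.proj (𝕜 := ℝ) (2 : Fin 3)).hasFDerivAt).comp y hR
  have h3 : HasFDerivAt (fun y => (R y 2 - γ (proj (R y))) * δ⁻¹) _ y :=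
    (h2.sub h1).mul_const δ⁻¹
  have hval : (R y 2 - γ (proj (R y))) * δ⁻¹ = p.2 := by
    rw [hy]; simp; field_simp
  have h4 : HasDerivAt cutoff (deriv cutoff p.2) ((R y 2 - γ (proj (R y))) * δ⁻¹) := by
    rw [hval]; exact hasDerivAt_cutoff _
  have h6 : layer R γ δ = cutoff ∘ fun y => (R y 2 - γ (proj (R y))) * δ⁻¹ := by
    funext y; simp [layer, div_eq_mul_inv]
  rw [h6, (h4.comp_hasFDerivAt y h3).fderiv]
  simp
  ring

/-! ### The divergence theorem -/

section LocalDivergence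

variable {Ω : Set Space} {F : Space → Space} {C : ℝ}

lemma IsTraceField.integrable_apply (hF : IsTraceField Ω F C) (hΩ : IsLipschitzDomain Ω)
    {ℓ : Space → Space →L[ℝ] ℝ} (hℓ : Continuous ℓ) (hc : HasCompactSupport ℓ) :
    IntegrableOn (fun x => ℓ x (F x)) Ω := by
  have := hΩ.isFiniteMeasure_volume
  obtain ⟨A, hA⟩ := hc.exists_bound_of_continuous hℓ
  refine Integrable.of_bound (C := A * C) ?_ ?_
  · have hb : Continuous fun q : (Space →L[ℝ] ℝ) × Space => q.1 q.2 := by fun_prop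
    exact hb.comp_aestronglyMeasurable
      (hℓ.aestronglyMeasurable.prodMk hF.meas_interior)
  · filter_upwards [ae_restrict_mem hΩ.1.measurableSet] with x hx
    exact (ℓ x).le_of_opNorm_le_of_le (hA x) (hF.bounded x (subset_closure hx))

lemma IsTraceField.norm_indicator_le (hF : IsTraceField Ω F C) (x : Space) :
    ‖Ω.indicator F x‖ ≤ C := by
  by_cases hx : x ∈ Ω
  · rw [indicator_of_mem hx]; exact hF.bounded x (subset_closure hx)
  · rw [indicator_of_notMem hx, norm_zero]; exact hF.nonneg

lemma fderiv_mul_apply {χ η : Space → ℝ} (hχ : ContDiff ℝ ∞ χ) (hη : ContDiff ℝ ∞ η)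
    (x v : Space) : fderiv ℝ (fun y => χ y * η y) x v =
      χ x * fderiv ℝ η x v + η x * fderiv ℝ χ x v := by
  rw [fderiv_fun_mul (hχ.differentiable (by simp) x) (hη.differentiable (by simp) x)]
  simp

/-- The weak divergence is tested with `χ` times the layer function. The term containing the
gradient of the layer, rewritten in sheared coordinates, becomes an integral over a slab independent
of `δ`. -/
lemma integral_layer_mul {R : Space ≃ₗᵢ[ℝ] Space} {γ : Plane → ℝ}
    {L : NNReal} {B : Set Space} {g χ : Space → ℝ} (hΩ : IsLipschitzDomain Ω)
    (hF : IsTraceField Ω F C) (hdiv : HasWeakDiv Ω F g) (hg : IntegrableOn g Ω)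
    (h : IsGraphChart Ω R γ L B) (hχ : ContDiff ℝ ∞ χ) (hχc : HasCompactSupport χ)
    (hχB : tsupport χ ⊆ B) {γ' : Plane → ℝ} (hγ' : ContDiff ℝ ∞ γ') {δ : ℝ} (hδ : 0 < δ)
    (hclose : ∀ z, |γ' z - γ z| ≤ δ) :
    ∫ x in Ω, layer R γ' δ x * (χ x * g x + fderiv ℝ χ x (F x)) =
      ∫ p, deriv cutoff p.2 * (χ (shearMap R γ' δ p) *
        (fderiv ℝ γ' p.1 (proj (R (Ω.indicator F (shearMap R γ' δ p)))) -
          R (Ω.indicator F (shearMap R γ' δ p)) 2)) := by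
  set η := layer R γ' δ
  have hη : ContDiff ℝ ∞ η := contDiff_layer R hγ' δ
  have hηb : ∀ x, ‖η x‖ ≤ 1 := fun x => abs_cutoff_le _
  -- This is why the cutoff starts at 2: its support lies at height at least `γ' + 2δ`, hence at
  -- least `γ + δ`, strictly inside `Ω`.
  have hsupp : tsupport (fun y => χ y * η y) ⊆ Ω := by
    have h1 : tsupport (fun y => χ y * η y) ⊆ tsupport χ := tsupport_mul_subset_left
    have h2 : tsupport (fun y => χ y * η y) ⊆ {y | γ' (proj (R y)) + 2 * δ ≤ R y 2} := by
      refine closure_minimal (fun y hy => ?_) ?_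
      · by_contra hlt
        refine hy ?_
        simp only [mem_ofPred_eq, not_le] at hlt
        have : η y = 0 := cutoff_of_le (by rw [div_le_iff₀ hδ]; linarith)
        simp [this]
      · refine isClosed_le ?_ ?_
        · exact (hγ'.continuous.comp (continuous_proj.comp R.continuous)).add continuous_const
        · fun_prop
    intro y hy
    refine (h.mem_iff y (hχB (h1 hy))).2 ?_
    have h3 : γ' (proj (R y)) + 2 * δ ≤ R y 2 := h2 hy
    have h4 := abs_le.1 (hclose (proj (R y)))
    linarith [h4.1]
  have hid := hdiv _ (hχ.mul hη) hχc.mul_right hsupp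
  have hIχη : IntegrableOn (fun x => χ x * fderiv ℝ η x (F x)) Ω := by
    refine hF.integrable_apply hΩ (ℓ := fun x => χ x • fderiv ℝ η x)
      (hχ.continuous.smul (hη.continuous_fderiv (by simp))) hχc.smul_right
  have hIχ : IntegrableOn (fun x => fderiv ℝ χ x (F x)) Ω :=
    hF.integrable_apply hΩ (hχ.continuous_fderiv (by simp)) (hχc.fderiv ℝ)
  have hIηχ : IntegrableOn (fun x => η x * fderiv ℝ χ x (F x)) Ω :=
    hIχ.bdd_mul hη.continuous.aestronglyMeasurable (Eventually.of_forall hηb)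
  obtain ⟨A, hA⟩ := hχc.exists_bound_of_continuous hχ.continuous
  have hIg : IntegrableOn (fun x => χ x * g x) Ω :=
    hg.bdd_mul hχ.continuous.aestronglyMeasurable (Eventually.of_forall hA)
  have hIηg : IntegrableOn (fun x => η x * (χ x * g x)) Ω :=
    hIg.bdd_mul hη.continuous.aestronglyMeasurable (Eventually.of_forall hηb)
  have e1 : ∫ x in Ω, layer R γ' δ x * (χ x * g x + fderiv ℝ χ x (F x)) =
      -∫ x in Ω, χ x * fderiv ℝ η x (F x) := by
    simp_rw [mul_add]
    rw [integral_add hIηg hIηχ]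
    simp_rw [fderiv_mul_apply hχ hη] at hid
    rw [integral_add hIχη hIηχ] at hid
    have : ∫ x in Ω, η x * (χ x * g x) = ∫ x in Ω, χ x * η x * g x := by
      congr 1; funext x; ring
    linarith
  have e2 : ∫ x in Ω, χ x * fderiv ℝ η x (F x) =
      ∫ x, χ x * fderiv ℝ η x (Ω.indicator F x) := by
    rw [← integral_indicator hΩ.1.measurableSet]
    congr 1; funext x
    by_cases hx : x ∈ Ω <;> simp [hx]
  rw [e1, e2, integral_comp_shearMap R hγ'.continuous hδ, ← integral_const_mul, ← integral_neg]
  congr 1; funext p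
  rw [fderiv_layer_shearMap R hγ' hδ.ne']
  field_simp
  ring

lemma tendsto_clm_apply {ℓs : ℕ → Plane →L[ℝ] ℝ} {vs : ℕ → Plane} {ℓ : Plane →L[ℝ] ℝ} {v : Plane}
    (h1 : Tendsto ℓs atTop (𝓝 ℓ)) (h2 : Tendsto vs atTop (𝓝 v)) :
    Tendsto (fun k => ℓs k (vs k)) atTop (𝓝 (ℓ v)) := by
  have hc : Continuous fun q : (Plane →L[ℝ] ℝ) × Plane => q.1 q.2 := by fun_prop
  exact (hc.tendsto (ℓ, v)).comp (h1.prodMk_nhds h2)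

/-- For rescaled height in `[2, 3]` the sheared points tend to the boundary point from inside `Ω`,
so the boundary limit of `F` applies. If the boundary point is outside `B`, then `χ` vanishes near
it; for other heights the derivative of the cutoff is zero. -/
lemma tendsto_layer_integrand {R : Space ≃ₗᵢ[ℝ] Space} {γ : Plane → ℝ}
    {L : NNReal} {B : Set Space} {χ : Space → ℝ} (h : IsGraphChart Ω R γ L B)
    (hχ : ContDiff ℝ ∞ χ) (hχB : tsupport χ ⊆ B) {γs : ℕ → Plane → ℝ} {δ : ℕ → ℝ}
    (hδ : ∀ k, 0 < δ k) (hδ0 : Tendsto δ atTop (𝓝 0)) (hclose : ∀ k z, |γs k z - γ z| ≤ δ k)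
    {p : Plane × ℝ} (hfd : Tendsto (fun k => fderiv ℝ (γs k) p.1) atTop (𝓝 (fderiv ℝ γ p.1)))
    (hFp : chartMap R γ p.1 ∈ B →
      Tendsto F (𝓝[Ω] chartMap R γ p.1) (𝓝 (F (chartMap R γ p.1)))) :
    Tendsto (fun k => deriv cutoff p.2 *
      (χ (shearMap R (γs k) (δ k) p) *
        (fderiv ℝ (γs k) p.1 (proj (R (Ω.indicator F (shearMap R (γs k) (δ k) p)))) -
          R (Ω.indicator F (shearMap R (γs k) (δ k) p)) 2))) atTop
      (𝓝 (deriv cutoff p.2 *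
        (χ (chartMap R γ p.1) * ⟪F (chartMap R γ p.1), IsGraphChart.conormal R γ p.1⟫))) := by
  have hχ0 : ∀ x, x ∉ B → χ x = 0 := fun x hx => image_eq_zero_of_notMem_tsupport fun h' =>
    hx (hχB h')
  by_cases hs : p.2 ∈ Icc (2 : ℝ) 3
  swap
  · simp [deriv_cutoff_eq_zero hs]
  refine Tendsto.const_mul _ ?_
  have hγlim : Tendsto (fun k => γs k p.1) atTop (𝓝 (γ p.1)) := by
    refine tendsto_iff_dist_tendsto_zero.2 (squeeze_zero (fun _ => dist_nonneg) (fun k => ?_)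
      hδ0)
    rw [Real.dist_eq]; exact hclose k p.1
  have hP : Tendsto (fun k => shearMap R (γs k) (δ k) p) atTop (𝓝 (chartMap R γ p.1)) := by
    have h1 : Tendsto (fun k => (p.1, γs k p.1 + δ k * p.2)) atTop (𝓝 (p.1, γ p.1)) := by
      refine tendsto_const_nhds.prodMk_nhds ?_
      simpa using hγlim.add (hδ0.mul_const p.2)
    exact ((R.symm.continuous.comp continuous_lift).tendsto (p.1, γ p.1)).comp h1
  by_cases hB : chartMap R γ p.1 ∈ B
  · refine ((hχ.continuous.tendsto _).comp hP).mul ?_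
    rw [IsGraphChart.inner_conormal]
    have hPΩ : ∀ᶠ k in atTop, shearMap R (γs k) (δ k) p ∈ Ω := by
      filter_upwards [hP (h.isOpen.mem_nhds hB)] with k hk
      refine (h.mem_iff _ hk).2 ?_
      have e : R (shearMap R (γs k) (δ k) p) = lift p.1 (γs k p.1 + δ k * p.2) :=
        R.apply_symm_apply _
      rw [e, proj_lift, lift_two]
      have := abs_le.1 (hclose k p.1)
      nlinarith [hδ k, hs.1, this.1]
    have hFl : Tendsto (fun k => Ω.indicator F (shearMap R (γs k) (δ k) p)) atTop
        (𝓝 (F (chartMap R γ p.1))) := by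
      have h1 := (hFp hB).comp (tendsto_nhdsWithin_iff.2 ⟨hP, hPΩ⟩)
      refine h1.congr' ?_
      filter_upwards [hPΩ] with k hk
      rw [Function.comp_apply, indicator_of_mem hk]
    have hRF : Tendsto (fun k => R (Ω.indicator F (shearMap R (γs k) (δ k) p))) atTop
        (𝓝 (R (F (chartMap R γ p.1)))) := (R.continuous.tendsto _).comp hFl
    refine Tendsto.sub ?_ ?_
    · exact tendsto_clm_apply hfd ((continuous_proj.tendsto _).comp hRF)
    · exact ((EuclideanSpace.proj (𝕜 := ℝ) (2 : Fin 3)).continuous.tendsto _).comp hRF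
  · rw [hχ0 _ hB, zero_mul]
    have hmem : (tsupport χ)ᶜ ∈ 𝓝 (chartMap R γ p.1) :=
      (isClosed_tsupport χ).isOpen_compl.mem_nhds fun h' => hB (hχB h')
    refine tendsto_const_nhds.congr' ?_
    filter_upwards [hP hmem] with k hk
    rw [image_eq_zero_of_notMem_tsupport hk, zero_mul]

/-- The divergence theorem for fields multiplied by a function supported in a graph chart. -/
lemma integral_divergence_of_isGraphChart {R : Space ≃ₗᵢ[ℝ] Space} {γ : Plane → ℝ}
    {L : NNReal} {B : Set Space} {g χ : Space → ℝ} (hΩ : IsLipschitzDomain Ω)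
    (hF : IsTraceField Ω F C) (hdiv : HasWeakDiv Ω F g) (hg : IntegrableOn g Ω)
    (h : IsGraphChart Ω R γ L B) (hχ : ContDiff ℝ ∞ χ) (hχc : HasCompactSupport χ)
    (hχB : tsupport χ ⊆ B) :
    ∫ x in Ω, (χ x * g x + fderiv ℝ χ x (F x)) =
      ∫ x in frontier Ω, χ x * ⟪F x, normal Ω x⟫ ∂surf := by
  have hχ0 : ∀ x, x ∉ B → χ x = 0 := fun x hx => image_eq_zero_of_notMem_tsupport fun h' =>
    hx (hχB h')
  have hemb := measurableEmbedding_chartMap R h.lipschitz.continuous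
  obtain ⟨A, hA⟩ := hχc.exists_bound_of_continuous hχ.continuous
  obtain ⟨T, hT⟩ := hasCompactSupport_deriv_cutoff.exists_bound_of_continuous
    continuous_deriv_cutoff
  have hA0 : 0 ≤ A := (norm_nonneg _).trans (hA 0)
  have hT0 : 0 ≤ T := (norm_nonneg _).trans (hT 0)
  obtain ⟨γs, δ, hδ, hδ0, hγs, hclose, hbd, hlimd⟩ := h.lipschitz.exists_smooth_approx
  -- the surface integral in the parameter plane
  have hsurf : ∫ x in frontier Ω, χ x * ⟪F x, normal Ω x⟫ ∂surf =
      ∫ z, χ (chartMap R γ z) * ⟪F (chartMap R γ z), IsGraphChart.conormal R γ z⟫ := by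
    rw [setIntegral_eq_of_subset_of_forall_sdiff_eq_zero isClosed_frontier.measurableSet
      (inter_subset_left (t := B)) (fun x hx => by
        rw [hχ0 x fun hxB => hx.2 ⟨hx.1, hxB⟩, zero_mul]),
      h.setIntegral_frontier hΩ.1]
    rw [← setIntegral_eq_integral_of_forall_compl_eq_zero (s := chartMap R γ ⁻¹' B)
      (f := fun z => χ (chartMap R γ z) * ⟪F (chartMap R γ z), IsGraphChart.conormal R γ z⟫)
      (fun z hz => by rw [hχ0 _ hz, zero_mul])]
    refine setIntegral_congr_ae (hemb.measurable h.isOpen.measurableSet) ?_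
    filter_upwards [h.lipschitz.ae_differentiableAt] with z hz hzB
    rw [← h.areaDensity_smul_normal hzB hz, inner_smul_right]
    ring
  -- the volume integrals with the layer functions
  have hIχ : IntegrableOn (fun x => fderiv ℝ χ x (F x)) Ω :=
    hF.integrable_apply hΩ (hχ.continuous_fderiv (by simp)) (hχc.fderiv ℝ)
  have hIg : IntegrableOn (fun x => χ x * g x) Ω :=
    hg.bdd_mul hχ.continuous.aestronglyMeasurable (Eventually.of_forall hA)
  have hlim1 : Tendsto (fun k => ∫ x in Ω, layer R (γs k) (δ k) x *
      (χ x * g x + fderiv ℝ χ x (F x))) atTop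
      (𝓝 (∫ x in Ω, (χ x * g x + fderiv ℝ χ x (F x)))) := by
    refine tendsto_integral_of_dominated_convergence
      (fun x => ‖χ x * g x + fderiv ℝ χ x (F x)‖) (fun k => ?_) (hIg.add hIχ).norm
      (fun k => Eventually.of_forall fun x => ?_) ?_
    · exact (contDiff_layer R (hγs k) (δ k)).continuous.aestronglyMeasurable.mul
        (hIg.add hIχ).aestronglyMeasurable
    · rw [norm_mul]
      exact mul_le_of_le_one_left (norm_nonneg _) (abs_cutoff_le _)
    · filter_upwards [ae_restrict_mem hΩ.1.measurableSet] with x hx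
      by_cases hxB : x ∈ B
      · refine tendsto_const_nhds.congr' ?_
        have hpos : 0 < R x 2 - γ (proj (R x)) := sub_pos.2 ((h.mem_iff x hxB).1 hx)
        -- Three multiples of `δ` complete the cutoff and a fourth absorbs the distance from `γs k`
        -- to `γ`.
        have hev : ∀ᶠ k in atTop, δ k < (R x 2 - γ (proj (R x))) / 4 :=
          hδ0.eventually (gt_mem_nhds (by positivity))
        filter_upwards [hev] with k hk
        have : layer R (γs k) (δ k) x = 1 := by
          refine cutoff_of_ge ?_
          rw [le_div_iff₀ (hδ k)]
          have := abs_le.1 (hclose k (proj (R x)))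
          linarith [this.2]
        rw [this, one_mul]
      · have h1 : χ x = 0 := hχ0 x hxB
        have h2 : fderiv ℝ χ x = 0 := fderiv_of_notMem_tsupport ℝ fun h' => hxB (hχB h')
        simp [h1, h2]
  have hlim2 : Tendsto (fun k => ∫ p : Plane × ℝ, deriv cutoff p.2 *
      (χ (shearMap R (γs k) (δ k) p) *
        (fderiv ℝ (γs k) p.1 (proj (R (Ω.indicator F (shearMap R (γs k) (δ k) p)))) -
          R (Ω.indicator F (shearMap R (γs k) (δ k) p)) 2))) atTop
      (𝓝 (∫ p : Plane × ℝ, deriv cutoff p.2 *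
        (χ (chartMap R γ p.1) * ⟪F (chartMap R γ p.1), IsGraphChart.conormal R γ p.1⟫))) := by
    obtain ⟨r, hr⟩ := hχc.isCompact.isBounded.subset_closedBall 0
    -- All integrands vanish off one compact set: the derivative of the cutoff confines the rescaled
    -- height, and the support of `χ` confines the horizontal part, whose norm is at most that of
    -- the point.
    set K : Set (Plane × ℝ) := Metric.closedBall 0 r ×ˢ Icc 2 3
    have hK : IsCompact K := (isCompact_closedBall 0 r).prod isCompact_Icc
    refine tendsto_integral_of_dominated_convergence
      (K.indicator fun _ => T * (A * (L * C + C))) (fun k => ?_) ?_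
      (fun k => Eventually.of_forall fun p => ?_) ?_
    · have hFi : AEStronglyMeasurable (fun p => Ω.indicator F (shearMap R (γs k) (δ k) p))
          (volume : Measure (Plane × ℝ)) :=
        ((aestronglyMeasurable_indicator_iff hΩ.1.measurableSet).2
          hF.meas_interior).comp_quasiMeasurePreserving
          (quasiMeasurePreserving_shearMap R (hγs k).continuous (hδ k))
      have hsc := continuous_shearMap R (hγs k).continuous (δ k)
      have hdc : Continuous (fderiv ℝ (γs k)) := (hγs k).continuous_fderiv (by simp)
      have hcont : Continuous fun q : (Plane × ℝ) × Space => deriv cutoff q.1.2 *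
          (χ (shearMap R (γs k) (δ k) q.1) * (fderiv ℝ (γs k) q.1.1 (projL (R q.2)) -
            EuclideanSpace.proj (𝕜 := ℝ) (2 : Fin 3) (R q.2))) := by
        have h1 := continuous_deriv_cutoff
        have h2 := hχ.continuous
        have h3 := R.continuous
        fun_prop
      exact hcont.comp_aestronglyMeasurable (aestronglyMeasurable_id.prodMk hFi)
    · exact (integrable_indicator_iff hK.measurableSet).2
        (integrableOn_const hK.measure_lt_top.ne)
    · by_cases hp : p ∈ K
      · rw [indicator_of_mem hp, norm_mul, norm_mul]
        set v := Ω.indicator F (shearMap R (γs k) (δ k) p)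
        have hv : ‖R v‖ ≤ C := by rw [R.norm_map]; exact hF.norm_indicator_le _
        have h1 : ‖fderiv ℝ (γs k) p.1 (proj (R v))‖ ≤ L * C :=
          (fderiv ℝ (γs k) p.1).le_of_opNorm_le_of_le (hbd k p.1) ((norm_proj_le _).trans hv)
        have h2 : ‖R v 2‖ ≤ C := (PiLp.norm_apply_le _ _).trans hv
        gcongr
        · exact hT _
        · exact hA _
        · exact (norm_sub_le _ _).trans (add_le_add h1 h2)
      · rw [indicator_of_notMem hp]
        rw [mem_prod, not_and_or] at hp
        rcases hp with hp | hp
        · have : χ (shearMap R (γs k) (δ k) p) = 0 := by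
            refine image_eq_zero_of_notMem_tsupport fun h' => hp ?_
            have h2 := hr h'
            rw [mem_closedBall_zero_iff] at h2 ⊢
            refine le_trans ?_ h2
            rw [shearMap, R.symm.norm_map]
            exact norm_le_norm_lift _ _
          simp [this]
        · rw [deriv_cutoff_eq_zero hp]; simp
    · have hae : ∀ᵐ z : Plane, Tendsto (fun k => fderiv ℝ (γs k) z) atTop (𝓝 (fderiv ℝ γ z)) ∧
          (chartMap R γ z ∈ B → Tendsto F (𝓝[Ω] chartMap R γ z) (𝓝 (F (chartMap R γ z)))) :=
        hlimd.and (h.ae_of_ae_frontier hΩ.1 hF.limit)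
      have hae' : ∀ᵐ p : Plane × ℝ, _ := Measure.quasiMeasurePreserving_fst.ae hae
      filter_upwards [hae'] with p hp
      exact tendsto_layer_integrand h hχ hχB hδ hδ0 hclose hp.1 hp.2
  have heq := fun k => integral_layer_mul hΩ hF hdiv hg h hχ hχc hχB (hγs k) (hδ k) (hclose k)
  simp_rw [heq] at hlim1
  -- Equating the two limits leaves a product integrand; its height factor integrates to 1.
  rw [tendsto_nhds_unique hlim1 hlim2, hsurf]
  simp_rw [mul_comm (deriv cutoff _)]
  rw [Measure.volume_eq_prod, integral_prod_mul (fun z => χ (chartMap R γ z) *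
    ⟪F (chartMap R γ z), IsGraphChart.conormal R γ z⟫) (deriv cutoff), integral_deriv_cutoff,
    mul_one]

end LocalDivergence

/-- **Divergence theorem** on a bounded Lipschitz domain for bounded vector fields with boundary
values and an integrable weak divergence. -/
theorem integral_weakDiv {Ω : Set Space} {F : Space → Space} {C : ℝ} {g : Space → ℝ}
    (hΩ : IsLipschitzDomain Ω) (hF : IsTraceField Ω F C) (hdiv : HasWeakDiv Ω F g)
    (hg : IntegrableOn g Ω) :
    ∫ x in Ω, g x = ∫ x in frontier Ω, ⟪F x, normal Ω x⟫ ∂surf := by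
  -- Around an interior point `Ω` itself serves, where the identity is the definition of weak
  -- divergence and the boundary term is zero. Boundedness of `U` makes the supports of the
  -- partition functions compact.
  have hloc : ∀ x ∈ closure Ω, ∃ U : Set Space, IsOpen U ∧ x ∈ U ∧ Bornology.IsBounded U ∧
      ∀ χ : Space → ℝ, ContDiff ℝ ∞ χ → HasCompactSupport χ → tsupport χ ⊆ U →
        ∫ x in Ω, (χ x * g x + fderiv ℝ χ x (F x)) =
          ∫ x in frontier Ω, χ x * ⟪F x, normal Ω x⟫ ∂surf := by
    intro x hx
    by_cases hxΩ : x ∈ Ω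
    · refine ⟨Ω, hΩ.1, hxΩ, hΩ.2.1, fun χ hχ hχc hχΩ => ?_⟩
      have hIχ : IntegrableOn (fun x => fderiv ℝ χ x (F x)) Ω :=
        hF.integrable_apply hΩ (hχ.continuous_fderiv (by simp)) (hχc.fderiv ℝ)
      obtain ⟨A, hA⟩ := hχc.exists_bound_of_continuous hχ.continuous
      have hIg : IntegrableOn (fun x => χ x * g x) Ω :=
        hg.bdd_mul hχ.continuous.aestronglyMeasurable (Eventually.of_forall hA)
      rw [integral_add hIg hIχ, hdiv χ hχ hχc hχΩ, neg_add_cancel, eq_comm]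
      refine setIntegral_eq_zero_of_forall_eq_zero fun y hy => ?_
      have hy' : y ∉ tsupport χ := fun h' => by
        rw [hΩ.1.frontier_eq] at hy
        exact hy.2 (hχΩ h')
      rw [image_eq_zero_of_notMem_tsupport hy', zero_mul]
    · have hxf : x ∈ frontier Ω := by rw [hΩ.1.frontier_eq]; exact ⟨hx, hxΩ⟩
      obtain ⟨R, γ, L, B, h, hxB⟩ := hΩ.exists_isGraphChart hxf
      refine ⟨B ∩ Metric.ball x 1, h.isOpen.inter Metric.isOpen_ball, ⟨hxB, by simp⟩,
        Metric.isBounded_ball.subset inter_subset_right, fun χ hχ hχc hχB => ?_⟩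
      exact integral_divergence_of_isGraphChart hΩ hF hdiv hg h hχ hχc
        (hχB.trans inter_subset_left)
  choose! U hUo hxU hUb hU using hloc
  have hcomp : IsCompact (closure Ω) := hΩ.2.1.isCompact_closure
  obtain ⟨t, ht, hcov⟩ := hcomp.elim_nhds_subcover U fun x hx => (hUo x hx).mem_nhds (hxU x hx)
  obtain ⟨f, hf⟩ := SmoothPartitionOfUnity.exists_isSubordinate (modelWithCornersSelf ℝ Space)
    isClosed_closure (fun i : t => U i) (fun i => hUo i (ht i i.2))
    (fun y hy => by
      obtain ⟨x, hx, hyx⟩ := mem_iUnion₂.1 (hcov hy)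
      exact mem_iUnion.2 ⟨⟨x, hx⟩, hyx⟩)
  have hfs : ∀ i, ContDiff ℝ ∞ (f i) := fun i => (f i).contMDiff.contDiff
  have hfc : ∀ i, HasCompactSupport (f i) := fun i =>
    Metric.isCompact_of_isClosed_isBounded (isClosed_tsupport _)
      ((hUb i (ht i i.2)).subset (hf i))
  have hfP := fun i : t => hU i (ht i i.2) (f i) (hfs i) (hfc i) (hf i)
  have hsum : ∀ x ∈ closure Ω, ∑ i, f i x = 1 := fun x hx => by
    rw [← finsum_eq_sum_of_fintype]; exact f.sum_eq_one hx
  -- The partition sums to 1 on an open set, so the gradient terms of the local identities cancel on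
  -- summation.
  have hdsum : ∀ x ∈ Ω, ∑ i, fderiv ℝ (f i) x = 0 := fun x hx => by
    rw [← fderiv_fun_sum fun i _ => ((hfs i).differentiable (by simp) x)]
    have : (fun y => ∑ i, f i y) =ᶠ[𝓝 x] fun _ => 1 := by
      filter_upwards [hΩ.1.mem_nhds hx] with y hy using hsum y (subset_closure hy)
    rw [this.fderiv_eq, fderiv_fun_const]; rfl
  have hfb : ∀ i x, ‖f i x‖ ≤ 1 := fun i x => by
    rw [Real.norm_of_nonneg (f.nonneg i x)]; exact f.le_one i x
  have hI1 : ∀ i, IntegrableOn (fun x => f i x * g x + fderiv ℝ (f i) x (F x)) Ω := fun i =>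
    (hg.bdd_mul (hfs i).continuous.aestronglyMeasurable (Eventually.of_forall (hfb i))).add
      (hF.integrable_apply hΩ ((hfs i).continuous_fderiv (by simp)) ((hfc i).fderiv ℝ))
  have hn : IntegrableOn (fun x => ⟪F x, normal Ω x⟫) (frontier Ω) surf := by
    have := hΩ.isFiniteMeasure_surf
    refine Integrable.of_bound (C := C * 1)
      (hF.meas_boundary.inner hΩ.aestronglyMeasurable_normal) ?_
    filter_upwards [ae_restrict_mem isClosed_frontier.measurableSet] with x hx
    exact (norm_inner_le_norm _ _).trans (mul_le_mul (hF.bounded x (frontier_subset_closure hx))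
      (norm_normal_le Ω x) (norm_nonneg _) hF.nonneg)
  have hI2 : ∀ i, IntegrableOn (fun x => f i x * ⟪F x, normal Ω x⟫) (frontier Ω) surf := fun i =>
    hn.bdd_mul (hfs i).continuous.aestronglyMeasurable (Eventually.of_forall (hfb i))
  calc ∫ x in Ω, g x = ∫ x in Ω, ∑ i, (f i x * g x + fderiv ℝ (f i) x (F x)) := by
        refine setIntegral_congr_fun hΩ.1.measurableSet fun x hx => ?_
        have := congrArg (fun ℓ => ℓ (F x)) (hdsum x hx)
        simp only [sum_apply, zero_apply] at this
        simp only [Finset.sum_add_distrib, this, add_zero, ← Finset.sum_mul,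
          hsum x (subset_closure hx), one_mul]
    _ = ∑ i, ∫ x in frontier Ω, f i x * ⟪F x, normal Ω x⟫ ∂surf := by
        rw [integral_finsetSum _ fun i _ => hI1 i]
        exact Finset.sum_congr rfl fun i _ => hfP i
    _ = ∫ x in frontier Ω, ⟪F x, normal Ω x⟫ ∂surf := by
        rw [← integral_finsetSum _ fun i _ => hI2 i]
        refine setIntegral_congr_fun isClosed_frontier.measurableSet fun x hx => ?_
        simp only [← Finset.sum_mul, hsum x (frontier_subset_closure hx), one_mul]

section

open scoped Convolution

/-! ### The stress power flux -/

/-- The vector `S v`, where `S` is the symmetric matrix with Voigt components `s`. -/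
def flux (s : Fin 6 → ℝ) (v : Fin 3 → ℝ) : Space :=
  !₂[s 0 * v 0 + s 3 * v 1 + s 5 * v 2,
     s 3 * v 0 + s 1 * v 1 + s 4 * v 2,
     s 5 * v 0 + s 4 * v 1 + s 2 * v 2]

/-- `flux` as a continuous bilinear map. -/
def fluxL : (Fin 6 → ℝ) →L[ℝ] (Fin 3 → ℝ) →L[ℝ] Space :=
  LinearMap.toContinuousBilinearMap <|
    LinearMap.mk₂ ℝ flux
      (fun s s' v => by ext i; fin_cases i <;> simp [flux] <;> ring)
      (fun c s v => by ext i; fin_cases i <;> simp [flux] <;> ring)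
      (fun s v v' => by ext i; fin_cases i <;> simp [flux] <;> ring)
      (fun c s v => by ext i; fin_cases i <;> simp [flux] <;> ring)

@[simp] lemma fluxL_apply (s : Fin 6 → ℝ) (v : Fin 3 → ℝ) : fluxL s v = flux s v := rfl

/-- The dot product as a continuous bilinear map. -/
def dotL (m : ℕ) : (Fin m → ℝ) →L[ℝ] (Fin m → ℝ) →L[ℝ] ℝ :=
  LinearMap.toContinuousBilinearMap <|
    LinearMap.mk₂ ℝ (fun v w => v ⬝ᵥ w) (fun _ _ _ => add_dotProduct _ _ _)
      (fun _ _ _ => smul_dotProduct _ _ _) (fun _ _ _ => dotProduct_add _ _ _)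
      (fun _ _ _ => dotProduct_smul _ _ _)

@[simp] lemma dotL_apply {m : ℕ} (v w : Fin m → ℝ) : dotL m v w = v ⬝ᵥ w := rfl

lemma continuous_flux : Continuous fun q : (Fin 6 → ℝ) × (Fin 3 → ℝ) => flux q.1 q.2 := by
  have : Continuous fun q : (Fin 6 → ℝ) × (Fin 3 → ℝ) => fluxL q.1 q.2 := by fun_prop
  exact this

lemma norm_flux_le (s : Fin 6 → ℝ) (v : Fin 3 → ℝ) : ‖flux s v‖ ≤ ‖fluxL‖ * ‖s‖ * ‖v‖ :=
  fluxL.le_opNorm₂ s v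

lemma clm_apply_eq (ℓ : Space →L[ℝ] ℝ) (v : Space) :
    ℓ v = v 0 * ℓ (EuclideanSpace.single 0 1) + v 1 * ℓ (EuclideanSpace.single 1 1) +
      v 2 * ℓ (EuclideanSpace.single 2 1) := by
  have : v = v 0 • EuclideanSpace.single 0 (1 : ℝ) + v 1 • EuclideanSpace.single 1 (1 : ℝ) +
      v 2 • EuclideanSpace.single 2 (1 : ℝ) := by
    ext i; fin_cases i <;> simp
  conv_lhs => rw [this]
  simp only [map_add, map_smul, smul_eq_mul]

lemma pd_smul_const {m : ℕ} {f : Space → ℝ} {x : Space} (hf : DifferentiableAt ℝ f x)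
    (c : Fin m → ℝ) (i : Fin 3) (j : Fin m) :
    pd i (fun y => (f y • c) j) x = fderiv ℝ f x (EuclideanSpace.single i 1) * c j := by
  simp only [pd, Pi.smul_apply, smul_eq_mul]
  rw [fderiv_mul_const hf]
  simp [mul_comm]

/-- For a scalar function times a constant vector, `D` reduces to a directional derivative along the
flux. Freezing one field in the doubled-variable argument produces exactly such test fields. -/
lemma classicalD_smul_const_dotProduct {f : Space → ℝ} {x : Space} (hf : DifferentiableAt ℝ f x)
    (c : Fin 3 → ℝ) (s : Fin 6 → ℝ) :
    classicalD (fun y => f y • c) x ⬝ᵥ s = fderiv ℝ f x (flux s c) := by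
  rw [clm_apply_eq]
  simp only [classicalD, pd_smul_const hf, dotProduct, Fin.sum_univ_six]
  simp [flux]
  ring

lemma classicalDT_smul_const_dotProduct {f : Space → ℝ} {x : Space} (hf : DifferentiableAt ℝ f x)
    (c : Fin 6 → ℝ) (v : Fin 3 → ℝ) :
    classicalDT (fun y => f y • c) x ⬝ᵥ v = fderiv ℝ f x (flux c v) := by
  rw [clm_apply_eq]
  simp only [classicalDT, pd_smul_const hf, dotProduct, Fin.sum_univ_three]
  simp [flux]
  ring

/-- `Nᵀ s` is `S n`, and `S` is symmetric, so it can be moved onto `v`. -/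
lemma dotProduct_normalMatrix_transpose_mulVec (Ω : Set Space) (x : Space) (v : Fin 3 → ℝ)
    (s : Fin 6 → ℝ) :
    v ⬝ᵥ ((normalMatrix Ω x)ᵀ *ᵥ s) = ⟪flux s v, normal Ω x⟫ := by
  simp [normalMatrix, dotProduct, Matrix.mulVec, Fin.sum_univ_six, Fin.sum_univ_three, flux,
    PiLp.inner_apply]
  ring

/-! ### The product rule for weak derivatives -/

lemma integrable_prod_kernel {E : Type*} [NormedAddCommGroup E] [NormedSpace ℝ E]
    {μ : Measure Space} [IsFiniteMeasure μ] {ℓ : Space → E →L[ℝ] ℝ} (hℓ : Integrable ℓ μ)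
    {s : Space → E} (hs : AEStronglyMeasurable s μ) {C : ℝ} (hC : ∀ᵐ y ∂μ, ‖s y‖ ≤ C)
    {κ : Space × Space → ℝ} (hκ : Continuous κ) {A : ℝ} (hA : ∀ q, ‖κ q‖ ≤ A) :
    Integrable (fun q : Space × Space => κ q * ℓ q.1 (s q.2)) (μ.prod μ) := by
  have h1 : Integrable (fun q : Space × Space => ‖ℓ q.1‖ * C) (μ.prod μ) :=
    hℓ.norm.mul_prod (integrable_const C)
  refine Integrable.bdd_mul (c := A) ?_ hκ.aestronglyMeasurable (Eventually.of_forall hA)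
  refine h1.mono' ?_ ?_
  · have hb : Continuous fun q : (E →L[ℝ] ℝ) × E => q.1 q.2 := by fun_prop
    exact hb.comp_aestronglyMeasurable (hℓ.aestronglyMeasurable.comp_fst.prodMk hs.comp_snd)
  · filter_upwards [Measure.quasiMeasurePreserving_snd.ae hC] with q hq
    exact (ℓ q.1).le_opNorm_of_le hq

/-- Integrating first in the second variable applies `ℓ x` to a mollification of `s` extended by
zero. This converges almost everywhere and is bounded by `|C|`, so integrability of `ℓ` gives
domination. The double integral is kept in the statement so that Fubini can be used in the other
order as well. -/
lemma tendsto_integral_prod_mollifier {E : Type*} [NormedAddCommGroup E] [NormedSpace ℝ E]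
    [CompleteSpace E]
    {Ω : Set Space} (hΩ : MeasurableSet Ω) [IsFiniteMeasure ((volume : Measure Space).restrict Ω)]
    {ℓ : Space → E →L[ℝ] ℝ} (hℓ : IntegrableOn ℓ Ω) {s : Space → E}
    (hs : AEStronglyMeasurable s (volume.restrict Ω)) {C : ℝ} (hC : ∀ y ∈ Ω, ‖s y‖ ≤ C) :
    Tendsto (fun k => ∫ q : Space × Space, (bumpSeq Space k).normed volume (q.1 - q.2) *
      ℓ q.1 (s q.2) ∂((volume.restrict Ω).prod (volume.restrict Ω))) atTop
      (𝓝 (∫ x in Ω, ℓ x (s x))) := by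
  set μ := (volume : Measure Space).restrict Ω
  set ρ : ℕ → Space → ℝ := fun k => (bumpSeq Space k).normed volume
  have hρc : ∀ k, Continuous (ρ k) := fun k => (bumpSeq Space k).continuous_normed
  have hρi : ∀ k, Integrable (ρ k) := fun k => (bumpSeq Space k).integrable_normed
  have hρ0 : ∀ k x, 0 ≤ ρ k x := fun k x => (bumpSeq Space k).nonneg_normed x
  have hρ1 : ∀ k, ∫ x, ρ k x = 1 := fun k => (bumpSeq Space k).integral_normed
  have hCae : ∀ᵐ y ∂μ, ‖s y‖ ≤ C := by
    filter_upwards [ae_restrict_mem hΩ] with y hy using hC y hy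
  have hsi : Integrable s μ := Integrable.of_bound hs C hCae
  have hsΩ : Integrable (Ω.indicator s) := (integrable_indicator_iff hΩ).2 hsi
  have hint : ∀ k, Integrable (fun q : Space × Space => ρ k (q.1 - q.2) * ℓ q.1 (s q.2))
      (μ.prod μ) := fun k => by
    obtain ⟨A, hA⟩ := ((bumpSeq Space k).hasCompactSupport_normed
      (μ := volume)).exists_bound_of_continuous (hρc k)
    exact integrable_prod_kernel hℓ hs hCae ((hρc k).comp (continuous_fst.sub continuous_snd))
      fun q => hA _
  set sk : ℕ → Space → E := fun k => ρ k ⋆[ContinuousLinearMap.lsmul ℝ ℝ, volume] Ω.indicator s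
  have hsk : ∀ k x, sk k x = ∫ y, ρ k (x - y) • s y ∂μ := by
    intro k x
    rw [← integral_indicator hΩ]
    simp only [sk, convolution_eq_swap, ContinuousLinearMap.lsmul_apply]
    congr 1; funext y
    by_cases hy : y ∈ Ω <;> simp [hy]
  have hρx : ∀ k x, Integrable (fun y => ρ k (x - y) • s y) μ := by
    intro k x
    obtain ⟨A, hA⟩ := ((bumpSeq Space k).hasCompactSupport_normed
      (μ := volume)).exists_bound_of_continuous (hρc k)
    exact hsi.bdd_smul A ((hρc k).comp (continuous_const.sub continuous_id)).aestronglyMeasurable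
      (Eventually.of_forall fun y => hA _)
  have hinner : ∀ k x, ∫ y, ρ k (x - y) * ℓ x (s y) ∂μ = ℓ x (sk k x) := by
    intro k x
    rw [hsk, ← (ℓ x).integral_comp_comm (hρx k x)]
    simp
  have hnorm : ∀ k x, ‖sk k x‖ ≤ |C| := by
    intro k x
    simp only [sk, convolution_eq_swap, ContinuousLinearMap.lsmul_apply]
    refine (norm_integral_le_of_norm_le (((hρi k).comp_sub_left x).mul_const |C|)
      (Eventually.of_forall fun y => ?_)).trans ?_
    · rw [norm_smul, Real.norm_of_nonneg (hρ0 k _)]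
      refine mul_le_mul_of_nonneg_left ?_ (hρ0 k _)
      by_cases hy : y ∈ Ω
      · rw [indicator_of_mem hy]; exact (hC y hy).trans (le_abs_self C)
      · rw [indicator_of_notMem hy, norm_zero]; exact abs_nonneg C
    · rw [integral_mul_const, integral_sub_left_eq_self (ρ k) volume x, hρ1, one_mul]
  have hae : ∀ᵐ x ∂μ, Tendsto (fun k => sk k x) atTop (𝓝 (s x)) := by
    have h1 := ContDiffBump.ae_convolution_tendsto_right_of_locallyIntegrable
      (tendsto_rOut_bumpSeq Space) (Eventually.of_forall (rOut_bumpSeq_le Space))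
      hsΩ.locallyIntegrable
    filter_upwards [ae_restrict_of_ae h1, ae_restrict_mem hΩ] with x hx hxΩ
    rwa [indicator_of_mem hxΩ] at hx
  have heq : ∀ k, ∫ q : Space × Space, ρ k (q.1 - q.2) * ℓ q.1 (s q.2) ∂(μ.prod μ) =
      ∫ x, ℓ x (sk k x) ∂μ := fun k => by
    rw [integral_prod _ (hint k)]
    exact integral_congr_ae (Eventually.of_forall fun x => hinner k x)
  refine Tendsto.congr (fun k => (heq k).symm) ?_
  refine tendsto_integral_of_dominated_convergence (fun x => ‖ℓ x‖ * |C|) (fun k => ?_)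
    (hℓ.norm.mul_const _) (fun k => Eventually.of_forall fun x => ?_) ?_
  · exact (hint k).integral_prod_left.aestronglyMeasurable.congr
      (Eventually.of_forall fun x => hinner k x)
  · exact (ℓ x).le_opNorm_of_le (hnorm k x)
  · filter_upwards [hae] with x hx
    exact ((ℓ x).continuous.tendsto _).comp hx

/-- The product rule: the flux of a stress field with weak `Dᵀ` and a velocity field with weak `D`
has a weak divergence. -/
theorem hasWeakDiv_flux {Ω : Set Space} (hΩ : IsLipschitzDomain Ω) {v r : Space → Fin 3 → ℝ}
    {s w : Space → Fin 6 → ℝ} (hv : IsWeakD Ω v w) (hs : IsWeakDT Ω s r) {Cv Cs : ℝ}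
    (hCv : ∀ x ∈ Ω, ‖v x‖ ≤ Cv) (hCs : ∀ x ∈ Ω, ‖s x‖ ≤ Cs) :
    HasWeakDiv Ω (fun x => flux (s x) (v x)) (fun x => v x ⬝ᵥ r x + w x ⬝ᵥ s x) := by
  intro χ hχ hχc hχΩ
  have hfin := hΩ.isFiniteMeasure_volume
  have hΩm := hΩ.1.measurableSet
  set μ := (volume : Measure Space).restrict Ω with hμ
  set ρ : ℕ → Space → ℝ := fun k => (bumpSeq Space k).normed volume with hρ
  have hρs : ∀ k, ContDiff ℝ ∞ (ρ k) := fun k => (bumpSeq Space k).contDiff_normed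
  have hρd : ∀ k, Differentiable ℝ (ρ k) := fun k => (hρs k).differentiable (by simp)
  have hχd : Differentiable ℝ χ := hχ.differentiable (by simp)
  have hsm : AEStronglyMeasurable s μ := hs.1.aestronglyMeasurable
  have hvm : AEStronglyMeasurable v μ := hv.1.aestronglyMeasurable
  have hwi : Integrable w μ := hv.2.1.integrable one_le_two
  have hri : Integrable r μ := hs.2.1.integrable one_le_two
  have hCvae : ∀ᵐ x ∂μ, ‖v x‖ ≤ Cv := by
    filter_upwards [ae_restrict_mem hΩm] with x hx using hCv x hx
  have hCsae : ∀ᵐ x ∂μ, ‖s x‖ ≤ Cs := by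
    filter_upwards [ae_restrict_mem hΩm] with x hx using hCs x hx
  obtain ⟨A, hA⟩ := hχc.exists_bound_of_continuous hχ.continuous
  have hdχ : Continuous (fderiv ℝ χ) := hχ.continuous_fderiv (by simp)
  obtain ⟨A', hA'⟩ := (hχc.fderiv ℝ).exists_bound_of_continuous hdχ
  have hfm : AEStronglyMeasurable (fun q : Space × Space => flux (s q.2) (v q.1)) (μ.prod μ) :=
    continuous_flux.comp_aestronglyMeasurable (hsm.comp_snd.prodMk hvm.comp_fst)
  have hfb : ∀ᵐ q : Space × Space ∂(μ.prod μ), ‖flux (s q.2) (v q.1)‖ ≤ ‖fluxL‖ * Cs * Cv := by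
    filter_upwards [Measure.quasiMeasurePreserving_snd.ae hCsae,
      Measure.quasiMeasurePreserving_fst.ae hCvae] with q h1 h2
    refine (norm_flux_le _ _).trans ?_
    gcongr
    exact mul_nonneg fluxL.opNorm_nonneg ((norm_nonneg _).trans h1)
  -- the three functionals of the limit
  set ℓ₁ : Space → (Fin 6 → ℝ) →L[ℝ] ℝ := fun x => χ x • dotL 6 (w x)
  set ℓ₂ : Space → (Fin 3 → ℝ) →L[ℝ] ℝ := fun y => dotL 3 (r y)
  set ℓ₃ : Space → (Fin 6 → ℝ) →L[ℝ] ℝ := fun x => (fderiv ℝ χ x).comp (fluxL.flip (v x))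
  have hℓ₁ : Integrable ℓ₁ μ :=
    ((dotL 6).integrable_comp hwi).bdd_smul A hχ.continuous.aestronglyMeasurable
      (Eventually.of_forall hA)
  have hℓ₂ : Integrable ℓ₂ μ := (dotL 3).integrable_comp hri
  have hℓ₃ : Integrable ℓ₃ μ := by
    refine Integrable.of_bound (C := A' * (‖fluxL.flip‖ * Cv)) ?_ ?_
    · have hb : Continuous fun q : (Space →L[ℝ] ℝ) × (Fin 3 → ℝ) => q.1.comp (fluxL.flip q.2) := by
        fun_prop
      exact hb.comp_aestronglyMeasurable (hdχ.aestronglyMeasurable.prodMk hvm)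
    · filter_upwards [hCvae] with x hx
      refine (ContinuousLinearMap.opNorm_comp_le _ _).trans ?_
      gcongr
      · exact (norm_nonneg _).trans (hA' x)
      · exact hA' x
      · exact fluxL.flip.le_opNorm_of_le hx
  have hχv : AEStronglyMeasurable (fun x => χ x • v x) μ :=
    hχ.continuous.aestronglyMeasurable.smul hvm
  have hχvb : ∀ x ∈ Ω, ‖χ x • v x‖ ≤ A * Cv := fun x hx => by
    rw [norm_smul]
    exact mul_le_mul (hA x) (hCv x hx) (norm_nonneg _) ((norm_nonneg _).trans (hA x))
  have hlim₁ := tendsto_integral_prod_mollifier hΩm hℓ₁ hsm hCs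
  have hlim₂ := tendsto_integral_prod_mollifier hΩm hℓ₂ hχv hχvb
  have hlim₃ := tendsto_integral_prod_mollifier hΩm hℓ₃ hsm hCs
  -- the kernels stay inside the domain
  obtain ⟨d, hd, hdΩ⟩ := hχc.isCompact.exists_cthickening_subset_open hΩ.1 hχΩ
  have hev : ∀ᶠ k in atTop, (bumpSeq Space k).rOut < d :=
    (tendsto_rOut_bumpSeq Space).eventually (gt_mem_nhds hd)
  -- The weak `D` of `v` is tested, in `x`, with `χ(x) ρ(x - y) s(y)`; the weak `Dᵀ` of `s` is
  -- tested, in `y`, with `χ(x) ρ(x - y) v(x)`. The derivatives of `ρ` in `x` and in `y` are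
  -- opposite and cancel, leaving only the gradient of `χ`.
  have key : ∀ᶠ k in atTop,
      ∫ q : Space × Space, ρ k (q.1 - q.2) * ℓ₁ q.1 (s q.2) ∂(μ.prod μ) +
        ∫ q : Space × Space, ρ k (q.1 - q.2) * ℓ₂ q.1 (χ q.2 • v q.2) ∂(μ.prod μ) =
        -∫ q : Space × Space, ρ k (q.1 - q.2) * ℓ₃ q.1 (s q.2) ∂(μ.prod μ) := by
    filter_upwards [hev] with k hk
    have hρc : Continuous (ρ k) := (hρs k).continuous
    have hdρ : Continuous (fderiv ℝ (ρ k)) := (hρs k).continuous_fderiv (by simp)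
    have hρcs : HasCompactSupport (ρ k) := (bumpSeq Space k).hasCompactSupport_normed
    have hρneg : ∀ x y, ρ k (x - y) = ρ k (y - x) := fun x y => by
      rw [← neg_sub, hρ]; exact (bumpSeq Space k).normed_neg _
    obtain ⟨T, hT⟩ := hρcs.exists_bound_of_continuous hρc
    obtain ⟨T', hT'⟩ := (hρcs.fderiv ℝ).exists_bound_of_continuous hdρ
    have hκ : Continuous fun q : Space × Space => ρ k (q.1 - q.2) := by fun_prop
    have hI₁ := integrable_prod_kernel hℓ₁ hsm hCsae hκ fun q => hT _
    have hI₂ := integrable_prod_kernel hℓ₂ hχv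
      (by filter_upwards [ae_restrict_mem hΩm] with x hx using hχvb x hx) hκ fun q => hT _
    have hI₃ := integrable_prod_kernel hℓ₃ hsm hCsae hκ fun q => hT _
    have hI₄ : Integrable (fun q : Space × Space => χ q.1 *
        fderiv ℝ (ρ k) (q.1 - q.2) (flux (s q.2) (v q.1))) (μ.prod μ) := by
      refine Integrable.of_bound (C := A * (T' * (‖fluxL‖ * Cs * Cv))) ?_ ?_
      · have hb : Continuous fun q : (Space × Space) × Space => χ q.1.1 *
            fderiv ℝ (ρ k) (q.1.1 - q.1.2) q.2 := by
          have := hχ.continuous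
          fun_prop
        exact hb.comp_aestronglyMeasurable (aestronglyMeasurable_id.prodMk hfm)
      · filter_upwards [hfb] with q hq
        rw [norm_mul]
        exact mul_le_mul (hA _) ((fderiv ℝ (ρ k) _).le_of_opNorm_le_of_le (hT' _) hq)
          (norm_nonneg _) ((norm_nonneg _).trans (hA q.1))
    have hgx : ∀ x y, fderiv ℝ (fun x => χ x * ρ k (x - y)) x =
        χ x • fderiv ℝ (ρ k) (x - y) + ρ k (x - y) • fderiv ℝ χ x := by
      intro x y
      have h1 : HasFDerivAt (fun x => ρ k (x - y)) (fderiv ℝ (ρ k) (x - y)) x := by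
        have := (hρd k (x - y)).hasFDerivAt.comp x ((hasFDerivAt_id x).sub_const y)
        simpa [Function.comp_def] using this
      exact ((hχd x).hasFDerivAt.mul h1).fderiv
    have hgy : ∀ x y, fderiv ℝ (fun y => χ x * ρ k (x - y)) y =
        -(χ x • fderiv ℝ (ρ k) (x - y)) := by
      intro x y
      have h1 : HasFDerivAt (fun y => ρ k (x - y))
          ((fderiv ℝ (ρ k) (x - y)).comp (-ContinuousLinearMap.id ℝ Space)) y :=
        (hρd k (x - y)).hasFDerivAt.comp y ((hasFDerivAt_id y).const_sub x)
      rw [(h1.const_mul (χ x)).fderiv]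
      ext u; simp
    have hA₁ : ∀ y, ∫ x, ρ k (x - y) * ℓ₁ x (s y) ∂μ =
        -∫ x, (ρ k (x - y) * ℓ₃ x (s y) +
          χ x * fderiv ℝ (ρ k) (x - y) (flux (s y) (v x))) ∂μ := by
      intro y
      have hsm' : ContDiff ℝ ∞ fun x => χ x * ρ k (x - y) :=
        hχ.mul ((hρs k).comp (contDiff_id.sub contDiff_const))
      have htest : IsTestField Ω fun x => (χ x * ρ k (x - y)) • s y := by
        refine ⟨hsm'.smul contDiff_const, (hχc.mul_right).smul_right, ?_⟩
        refine subset_trans ?_ hχΩ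
        refine closure_mono fun x hx h0 => hx ?_
        simp [h0]
      have h := hv.2.2 _ htest
      simp_rw [classicalDT_smul_const_dotProduct (hsm'.differentiable (by simp) _), hgx] at h
      refine Eq.trans ?_ (h.trans ?_)
      · congr 1; funext x
        simp only [ℓ₁, smul_apply, dotL_apply, smul_dotProduct, smul_eq_mul]
        rw [dotProduct_comm (w x)]; ring
      · congr 2; funext x
        simp only [ℓ₃, add_apply, smul_apply, smul_eq_mul,
          ContinuousLinearMap.comp_apply, ContinuousLinearMap.flip_apply, fluxL_apply]
        ring
    -- The names are exchanged: here the integration variable `y` is the first coordinate of the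
    -- pair and the frozen `x` the second. Evenness of the kernel reconciles this with `hA₁`.
    have hA₂ : ∀ x, ∫ y, ρ k (y - x) * ℓ₂ y (χ x • v x) ∂μ =
        ∫ y, χ x * fderiv ℝ (ρ k) (x - y) (flux (s y) (v x)) ∂μ := by
      intro x
      by_cases hx : x ∈ tsupport χ
      swap
      · simp [image_eq_zero_of_notMem_tsupport hx]
      have hsm' : ContDiff ℝ ∞ fun y => χ x * ρ k (x - y) :=
        contDiff_const.mul ((hρs k).comp (contDiff_const.sub contDiff_id))
      have hts : tsupport (fun y => (χ x * ρ k (x - y)) • v x) ⊆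
          Metric.closedBall x (bumpSeq Space k).rOut := by
        refine closure_minimal (fun y hy => ?_) Metric.isClosed_closedBall
        by_contra hyb
        refine hy ?_
        have : ρ k (x - y) = 0 := by
          have hns : x - y ∉ Function.support (ρ k) := by
            rw [hρ, (bumpSeq Space k).support_normed_eq, mem_ball_zero_iff, not_lt,
              ← dist_eq_norm, dist_comm]
            exact (not_le.1 hyb).le
          exact Function.notMem_support.1 hns
        simp [this]
      have htest : IsTestField Ω fun y => (χ x * ρ k (x - y)) • v x := by
        refine ⟨hsm'.smul contDiff_const,
          (isCompact_closedBall x _).of_isClosed_subset (isClosed_tsupport _) hts, ?_⟩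
        refine hts.trans (subset_trans ?_ hdΩ)
        exact (Metric.closedBall_subset_closedBall hk.le).trans
          (Metric.closedBall_subset_cthickening hx d)
      have h := hs.2.2 _ htest
      simp_rw [classicalD_smul_const_dotProduct (hsm'.differentiable (by simp) _), hgy] at h
      refine Eq.trans ?_ (h.trans ?_)
      · congr 1; funext y
        simp only [ℓ₂, dotL_apply, smul_dotProduct, dotProduct_smul, smul_eq_mul]
        rw [dotProduct_comm (r y), hρneg y x]; ring
      · rw [← integral_neg]
        congr 1; funext y
        simp
    -- The kernel-derivative term is integrated in one order in `hS` and in the other in `hS'`; its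
    -- integrability `hI₄` makes the two agree.
    have hS : ∫ q : Space × Space, (ρ k (q.1 - q.2) * ℓ₃ q.1 (s q.2) +
          χ q.1 * fderiv ℝ (ρ k) (q.1 - q.2) (flux (s q.2) (v q.1))) ∂(μ.prod μ) =
        ∫ y, ∫ x, (ρ k (x - y) * ℓ₃ x (s y) +
          χ x * fderiv ℝ (ρ k) (x - y) (flux (s y) (v x))) ∂μ ∂μ :=
      integral_prod_symm _ (hI₃.add hI₄)
    have hS' : ∫ q : Space × Space,
          χ q.1 * fderiv ℝ (ρ k) (q.1 - q.2) (flux (s q.2) (v q.1)) ∂(μ.prod μ) =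
        ∫ x, ∫ y, χ x * fderiv ℝ (ρ k) (x - y) (flux (s y) (v x)) ∂μ ∂μ :=
      integral_prod _ hI₄
    rw [integral_prod_symm _ hI₁, integral_prod_symm _ hI₂]
    simp_rw [hA₁, hA₂]
    rw [integral_neg, ← hS, ← hS', integral_add hI₃ hI₄]
    ring
  have hfinal := tendsto_nhds_unique_of_eventuallyEq (hlim₁.add hlim₂) hlim₃.neg key
  have hi₁ : Integrable (fun x => ℓ₁ x (s x)) μ := by
    refine (hℓ₁.norm.mul_const Cs).mono' ?_ ?_
    · have hb : Continuous fun q : ((Fin 6 → ℝ) →L[ℝ] ℝ) × (Fin 6 → ℝ) => q.1 q.2 := by fun_prop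
      exact hb.comp_aestronglyMeasurable (hℓ₁.aestronglyMeasurable.prodMk hsm)
    · filter_upwards [hCsae] with x hx using (ℓ₁ x).le_opNorm_of_le hx
  have hi₂ : Integrable (fun x => ℓ₂ x (χ x • v x)) μ := by
    refine (hℓ₂.norm.mul_const (A * Cv)).mono' ?_ ?_
    · have hb : Continuous fun q : ((Fin 3 → ℝ) →L[ℝ] ℝ) × (Fin 3 → ℝ) => q.1 q.2 := by fun_prop
      exact hb.comp_aestronglyMeasurable (hℓ₂.aestronglyMeasurable.prodMk hχv)
    · filter_upwards [ae_restrict_mem hΩm] with x hx using (ℓ₂ x).le_opNorm_of_le (hχvb x hx)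
  rw [← integral_add hi₁ hi₂] at hfinal
  refine Eq.trans ?_ (hfinal.trans ?_)
  · congr 1; funext x
    simp only [ℓ₁, ℓ₂, smul_apply, dotL_apply, smul_eq_mul, dotProduct_smul]
    rw [dotProduct_comm (v x)]; ring
  · rfl

end

/-! ### Integrals of bilinear expressions -/

lemma integrable_dotProduct_mulVec {m m' : ℕ} {μ : Measure Space} {u : Space → Fin m → ℝ}
    {v : Space → Fin m' → ℝ} {T : Space → Matrix (Fin m) (Fin m') ℝ} {C : ℝ} (hu : MemLp u 2 μ)
    (hv : MemLp v 2 μ) (hT : ∀ i j, AEStronglyMeasurable (fun x => T x i j) μ)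
    (hC : ∀ x i j, ‖T x i j‖ ≤ C) : Integrable (fun x => u x ⬝ᵥ (T x *ᵥ v x)) μ := by
  simp only [dotProduct, Matrix.mulVec]
  refine integrable_finsetSum _ fun i _ => ?_
  simp_rw [Finset.mul_sum]
  refine integrable_finsetSum _ fun j _ => ?_
  have h := ((hu.eval i).integrable_mul (hv.eval j)).bdd_mul (hT i j)
    (Eventually.of_forall fun x => hC x i j)
  refine h.congr (Eventually.of_forall fun x => ?_)
  simp only [Pi.mul_apply]
  ring

lemma integrable_dotProduct {m : ℕ} {μ : Measure Space} {u v : Space → Fin m → ℝ}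
    (hu : MemLp u 2 μ) (hv : MemLp v 2 μ) : Integrable (fun x => u x ⬝ᵥ v x) μ := by
  simp only [dotProduct]
  exact integrable_finsetSum _ fun i _ => (hu.eval i).integrable_mul (hv.eval i)

lemma exists_norm_apply_le {m m' : ℕ} (T : Matrix (Fin m) (Fin m') ℝ) :
    ∃ C : ℝ, ∀ i j, ‖T i j‖ ≤ C := by
  refine ⟨∑ i, ∑ j, ‖T i j‖, fun i j => ?_⟩
  exact (Finset.single_le_sum (f := fun j => ‖T i j‖) (fun _ _ => norm_nonneg _)
    (Finset.mem_univ j)).trans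
    (Finset.single_le_sum (f := fun i => ∑ j, ‖T i j‖)
      (fun _ _ => Finset.sum_nonneg fun _ _ => norm_nonneg _) (Finset.mem_univ i))

lemma integrable_dotProduct_const_mulVec {m m' : ℕ} {μ : Measure Space} {u : Space → Fin m → ℝ}
    {v : Space → Fin m' → ℝ} (T : Matrix (Fin m) (Fin m') ℝ) (hu : MemLp u 2 μ)
    (hv : MemLp v 2 μ) : Integrable (fun x => u x ⬝ᵥ (T *ᵥ v x)) μ := by
  obtain ⟨C, hC⟩ := exists_norm_apply_le T
  exact integrable_dotProduct_mulVec hu hv (fun _ _ => aestronglyMeasurable_const)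
    fun _ => hC

/-! ### Galerkin fields and the matrices of bilinear forms -/

section Field

variable {m m' : ℕ} {ι κ : Type*} [Fintype ι] [Fintype κ]

lemma field_dotProduct_mulVec_field (b : ι → Space → Fin m → ℝ) (b' : κ → Space → Fin m' → ℝ)
    (T : Matrix (Fin m) (Fin m') ℝ) (c : ι → ℝ) (c' : κ → ℝ) (x : Space) :
    field b c x ⬝ᵥ (T *ᵥ field b' c' x) =
      ∑ i, ∑ j, c i * (c' j * (b i x ⬝ᵥ (T *ᵥ b' j x))) := by
  simp only [field, Matrix.mulVec_sum, Matrix.mulVec_smul, sum_dotProduct, dotProduct_sum,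
    smul_dotProduct, dotProduct_smul, smul_eq_mul, Finset.mul_sum]
  refine Finset.sum_comm.trans (Finset.sum_congr rfl fun i _ => Finset.sum_congr rfl fun j _ => ?_)
  ring

lemma dotProduct_of_mulVec (I : ι → κ → ℝ) (c : ι → ℝ) (c' : κ → ℝ) :
    c ⬝ᵥ (Matrix.of I *ᵥ c') = ∑ i, ∑ j, c i * (c' j * I i j) := by
  simp only [dotProduct, Matrix.mulVec, Matrix.of_apply, Finset.mul_sum, mul_comm (I _ _)]

/-- With `T` equal to `ρ` times the identity, `E⁻¹`, `N` or `Nᵀ`, this turns the mass, input and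
boundary integrals into matrix expressions. -/
lemma integral_field_mulVec_field {μ : Measure Space} {b : ι → Space → Fin m → ℝ}
    {b' : κ → Space → Fin m' → ℝ} {T : Space → Matrix (Fin m) (Fin m') ℝ}
    (h : ∀ i j, Integrable (fun x => b i x ⬝ᵥ (T x *ᵥ b' j x)) μ) (c : ι → ℝ) (c' : κ → ℝ) :
    ∫ x, field b c x ⬝ᵥ (T x *ᵥ field b' c' x) ∂μ =
      c ⬝ᵥ ((Matrix.of fun i j => ∫ x, b i x ⬝ᵥ (T x *ᵥ b' j x) ∂μ) *ᵥ c') := by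
  simp_rw [field_dotProduct_mulVec_field]
  rw [integral_finsetSum _ fun i _ => integrable_finsetSum _ fun j _ =>
    ((h i j).const_mul _).const_mul _]
  rw [dotProduct_of_mulVec]
  refine Finset.sum_congr rfl fun i _ => ?_
  rw [integral_finsetSum _ fun j _ => ((h i j).const_mul _).const_mul _]
  refine Finset.sum_congr rfl fun j _ => ?_
  rw [integral_const_mul, integral_const_mul]

lemma integral_field_dotProduct_field {μ : Measure Space} {b : ι → Space → Fin m → ℝ}
    {b' : κ → Space → Fin m → ℝ}
    (h : ∀ i j, Integrable (fun x => b i x ⬝ᵥ b' j x) μ) (c : ι → ℝ) (c' : κ → ℝ) :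
    ∫ x, field b c x ⬝ᵥ field b' c' x ∂μ =
      c ⬝ᵥ ((Matrix.of fun i j => ∫ x, b i x ⬝ᵥ b' j x ∂μ) *ᵥ c') := by
  have := integral_field_mulVec_field (T := fun _ => 1) (μ := μ) (b := b) (b' := b')
    (by simpa using h) c c'
  simpa using this

lemma memLp_field {μ : Measure Space} {p : ENNReal} {b : ι → Space → Fin m → ℝ}
    (h : ∀ i, MemLp (b i) p μ) (c : ι → ℝ) : MemLp (field b c) p μ := by
  have := memLp_finsetSum (s := Finset.univ) (f := fun i x => c i • b i x)
    fun i _ => (h i).const_smul (c i)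
  exact this

lemma HasBoundaryValues.field {Ω : Set Space} {b : ι → Space → Fin m → ℝ}
    (h : ∀ i, HasBoundaryValues Ω (b i)) (c : ι → ℝ) :
    HasBoundaryValues Ω (Elastodynamics.field b c) where
  bounded := by
    choose C hC using fun i => (h i).bounded
    refine ⟨∑ i, ‖c i‖ * C i, fun x hx => ?_⟩
    refine (norm_sum_le _ _).trans (Finset.sum_le_sum fun i _ => ?_)
    rw [norm_smul]
    exact mul_le_mul_of_nonneg_left (hC i x hx) (norm_nonneg _)
  meas_interior := Finset.aestronglyMeasurable_fun_sum _ fun i _ =>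
    (h i).meas_interior.const_smul (c i)
  meas_boundary := Finset.aestronglyMeasurable_fun_sum _ fun i _ =>
    (h i).meas_boundary.const_smul (c i)
  limit := by
    filter_upwards [ae_all_iff.2 fun i => (h i).limit] with x hx
    exact tendsto_finsetSum _ fun i _ => (hx i).const_smul (c i)

lemma deriv_field {b : ι → Space → Fin m → ℝ} {c : ℝ → ι → ℝ} {t : ℝ}
    (hc : DifferentiableAt ℝ c t) (x : Space) :
    deriv (fun r => field b (c r) x) t = field b (deriv c t) x := by
  have h1 := hasDerivAt_pi.1 hc.hasDerivAt
  have h2 : HasDerivAt (fun r => ∑ i, c r i • b i x) (∑ i, deriv c t i • b i x) t :=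
    HasDerivAt.fun_sum fun i _ => (h1 i).smul_const (b i x)
  exact h2.deriv

end Field

/-! ### Uniqueness and linearity of the weak derivatives -/

/-- The fundamental lemma of the calculus of variations, applied to each component with test fields
`g • e_j`. -/
lemma ae_eq_of_forall_isTestField {m : ℕ} {Ω : Set Space} (hΩ : IsLipschitzDomain Ω)
    {w w' : Space → Fin m → ℝ} (hw : MemLp w 2 (volume.restrict Ω))
    (hw' : MemLp w' 2 (volume.restrict Ω))
    (h : ∀ η, IsTestField Ω η → ∫ x in Ω, η x ⬝ᵥ w x = ∫ x in Ω, η x ⬝ᵥ w' x) :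
    w =ᵐ[volume.restrict Ω] w' := by
  have hfin := hΩ.isFiniteMeasure_volume
  have hcomp : ∀ j, ∀ᵐ x ∂volume.restrict Ω, w x j = w' x j := by
    intro j
    have hd : IntegrableOn (fun x => w x j - w' x j) Ω :=
      ((hw.eval j).integrable one_le_two).sub ((hw'.eval j).integrable one_le_two)
    have key := hΩ.1.ae_eq_zero_of_integral_contDiff_smul_eq_zero
      (μ := volume.restrict Ω) (f := fun x => w x j - w' x j)
      (hd.locallyIntegrable.locallyIntegrableOn Ω) ?_
    · filter_upwards [key, ae_restrict_mem hΩ.1.measurableSet] with x hx hxΩ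
      exact sub_eq_zero.1 (hx hxΩ)
    · intro g hg hgc hgΩ
      have htest : IsTestField Ω fun x => g x • (Pi.single j 1 : Fin m → ℝ) := by
        refine ⟨hg.smul contDiff_const, hgc.smul_right, subset_trans (closure_mono ?_) hgΩ⟩
        intro x hx h0
        exact hx (by simp [h0])
      have h1 := h _ htest
      simp only [smul_dotProduct, single_dotProduct, one_mul, smul_eq_mul] at h1
      obtain ⟨A, hA⟩ := hgc.exists_bound_of_continuous hg.continuous
      have hi : ∀ {u : Space → Fin m → ℝ}, MemLp u 2 (volume.restrict Ω) →
          IntegrableOn (fun x => g x * u x j) Ω := fun hu =>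
        ((hu.eval j).integrable one_le_two).bdd_mul hg.continuous.aestronglyMeasurable
          (Eventually.of_forall hA)
      simp only [smul_eq_mul, mul_sub]
      rw [integral_sub (hi hw) (hi hw'), h1, sub_self]
  filter_upwards [ae_all_iff.2 hcomp] with x hx
  exact funext hx

lemma memLp_of_continuous_of_hasCompactSupport {m : ℕ} {Ω : Set Space} {η : Space → Fin m → ℝ}
    (hη : Continuous η) (hc : HasCompactSupport η) : MemLp η 2 (volume.restrict Ω) :=
  (hη.memLp_of_hasCompactSupport hc).restrict Ω

lemma IsTestField.memLp {m : ℕ} {Ω : Set Space} {η : Space → Fin m → ℝ} (h : IsTestField Ω η) :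
    MemLp η 2 (volume.restrict Ω) :=
  memLp_of_continuous_of_hasCompactSupport h.1.continuous h.2.1

lemma IsTestField.memLp_pd {m : ℕ} {Ω : Set Space} {η : Space → Fin m → ℝ} (h : IsTestField Ω η)
    (i : Fin 3) (j : Fin m) : MemLp (pd i fun x => η x j) 2 (volume.restrict Ω) := by
  have h1 : ContDiff ℝ ∞ fun x => η x j := contDiff_pi.1 h.1 j
  have h2 : HasCompactSupport fun x => η x j := 
    HasCompactSupport.comp_left (g := fun v : Fin m → ℝ => v j) h.2.1 rfl
  have h3 : Continuous (pd i fun x => η x j) :=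
    (h1.continuous_fderiv (by simp)).clm_apply continuous_const
  have h4 : HasCompactSupport (pd i fun x => η x j) :=
    (h2.fderiv ℝ).comp_left (g := fun ℓ : Space →L[ℝ] ℝ => ℓ (EuclideanSpace.single i 1)) rfl
  exact (h3.memLp_of_hasCompactSupport h4).restrict Ω

lemma IsTestField.memLp_classicalD {Ω : Set Space} {η : Space → Fin 3 → ℝ}
    (h : IsTestField Ω η) : MemLp (classicalD η) 2 (volume.restrict Ω) := by
  refine memLp_pi_iff.2 fun j => ?_
  have hp := h.memLp_pd
  fin_cases j
  exacts [hp 0 0, hp 1 1, hp 2 2, (hp 1 0).add (hp 0 1), (hp 2 1).add (hp 1 2),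
    (hp 2 0).add (hp 0 2)]

lemma IsTestField.memLp_classicalDT {Ω : Set Space} {η : Space → Fin 6 → ℝ}
    (h : IsTestField Ω η) : MemLp (classicalDT η) 2 (volume.restrict Ω) := by
  refine memLp_pi_iff.2 fun j => ?_
  have hp := h.memLp_pd
  fin_cases j
  exacts [((hp 0 0).add (hp 1 3)).add (hp 2 5), ((hp 1 1).add (hp 0 3)).add (hp 2 4),
    ((hp 2 2).add (hp 1 4)).add (hp 0 5)]

lemma integral_dotProduct_field {m : ℕ} {ι : Type*} [Fintype ι] {μ : Measure Space}
    {u : Space → Fin m → ℝ} {b : ι → Space → Fin m → ℝ} (hu : MemLp u 2 μ)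
    (hb : ∀ i, MemLp (b i) 2 μ) (c : ι → ℝ) :
    ∫ x, u x ⬝ᵥ field b c x ∂μ = ∑ i, c i * ∫ x, u x ⬝ᵥ b i x ∂μ := by
  simp only [field, dotProduct_sum, dotProduct_smul, smul_eq_mul]
  rw [integral_finsetSum _ fun i _ => (integrable_dotProduct hu (hb i)).const_mul (c i)]
  simp_rw [integral_const_mul]

section WeakDerivatives

variable {Ω : Set Space} {ι : Type*} [Fintype ι]

lemma isWeakD_weakD {v : Space → Fin 3 → ℝ} (h : ∃ w, IsWeakD Ω v w) :
    IsWeakD Ω v (weakD Ω v) := by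
  rw [weakD, dif_pos h]; exact h.choose_spec

lemma isWeakDT_weakDT {s : Space → Fin 6 → ℝ} (h : ∃ w, IsWeakDT Ω s w) :
    IsWeakDT Ω s (weakDT Ω s) := by
  rw [weakDT, dif_pos h]; exact h.choose_spec

lemma IsWeakD.field {b : ι → Space → Fin 3 → ℝ} {w : ι → Space → Fin 6 → ℝ}
    (h : ∀ i, IsWeakD Ω (b i) (w i)) (c : ι → ℝ) :
    IsWeakD Ω (Elastodynamics.field b c) (Elastodynamics.field w c) := by
  refine ⟨memLp_field (fun i => (h i).1) c, memLp_field (fun i => (h i).2.1) c, fun η hη => ?_⟩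
  rw [integral_dotProduct_field hη.memLp fun i => (h i).2.1,
    integral_dotProduct_field hη.memLp_classicalDT fun i => (h i).1, ← Finset.sum_neg_distrib]
  exact Finset.sum_congr rfl fun i _ => by rw [(h i).2.2 η hη, mul_neg]

lemma IsWeakDT.field {b : ι → Space → Fin 6 → ℝ} {w : ι → Space → Fin 3 → ℝ}
    (h : ∀ i, IsWeakDT Ω (b i) (w i)) (c : ι → ℝ) :
    IsWeakDT Ω (Elastodynamics.field b c) (Elastodynamics.field w c) := by
  refine ⟨memLp_field (fun i => (h i).1) c, memLp_field (fun i => (h i).2.1) c, fun η hη => ?_⟩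
  rw [integral_dotProduct_field hη.memLp fun i => (h i).2.1,
    integral_dotProduct_field hη.memLp_classicalD fun i => (h i).1, ← Finset.sum_neg_distrib]
  exact Finset.sum_congr rfl fun i _ => by rw [(h i).2.2 η hη, mul_neg]

/-- `weakD` is a chosen representative, so it is linear only up to null sets: both sides are weak
derivatives of the same field, and these are unique almost everywhere. -/
lemma weakD_field_ae_eq (hΩ : IsLipschitzDomain Ω) {b : ι → Space → Fin 3 → ℝ}
    (h : ∀ i, ∃ w, IsWeakD Ω (b i) w) (c : ι → ℝ) :
    weakD Ω (field b c) =ᵐ[volume.restrict Ω] field (fun i => weakD Ω (b i)) c := by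
  have h1 := IsWeakD.field (fun i => isWeakD_weakD (h i)) c
  have h2 := isWeakD_weakD ⟨_, h1⟩
  exact ae_eq_of_forall_isTestField hΩ h2.2.1 h1.2.1 fun η hη =>
    (h2.2.2 η hη).trans (h1.2.2 η hη).symm

end WeakDerivatives

/-! ### Green's formula -/

section Green

variable {Ω : Set Space}

lemma HasBoundaryValues.memLp_interior {m : ℕ} {f : Space → Fin m → ℝ} (hΩ : IsLipschitzDomain Ω)
    (h : HasBoundaryValues Ω f) : MemLp f 2 (volume.restrict Ω) := by
  have := hΩ.isFiniteMeasure_volume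
  obtain ⟨C, hC⟩ := h.bounded
  refine MemLp.of_bound h.meas_interior C ?_
  filter_upwards [ae_restrict_mem hΩ.1.measurableSet] with x hx using hC x (subset_closure hx)

lemma HasBoundaryValues.memLp_boundary {m : ℕ} {f : Space → Fin m → ℝ} (hΩ : IsLipschitzDomain Ω)
    (h : HasBoundaryValues Ω f) : MemLp f 2 (surf.restrict (frontier Ω)) := by
  have := hΩ.isFiniteMeasure_surf
  obtain ⟨C, hC⟩ := h.bounded
  refine MemLp.of_bound h.meas_boundary C ?_
  filter_upwards [ae_restrict_mem isClosed_frontier.measurableSet] with x hx using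
    hC x (frontier_subset_closure hx)

lemma IsLipschitzDomain.aestronglyMeasurable_normalMatrix (hΩ : IsLipschitzDomain Ω) (i : Fin 6)
    (j : Fin 3) :
    AEStronglyMeasurable (fun x => normalMatrix Ω x i j) (surf.restrict (frontier Ω)) := by
  have hn : ∀ k, AEStronglyMeasurable (fun x => normal Ω x k) (surf.restrict (frontier Ω)) :=
    fun k => (EuclideanSpace.proj (𝕜 := ℝ) k : Space →L[ℝ] ℝ).continuous.comp_aestronglyMeasurable
      hΩ.aestronglyMeasurable_normal
  fin_cases i <;> fin_cases j <;>
    first | exact hn 0 | exact hn 1 | exact hn 2 | exact aestronglyMeasurable_const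

lemma norm_normalMatrix_apply_le (x : Space) (i : Fin 6) (j : Fin 3) :
    ‖normalMatrix Ω x i j‖ ≤ 1 := by
  have hn : ∀ k, ‖normal Ω x k‖ ≤ 1 := fun k =>
    (PiLp.norm_apply_le _ k).trans (norm_normal_le Ω x)
  have h0 : ‖(0 : ℝ)‖ ≤ 1 := by simp
  fin_cases i <;> fin_cases j <;>
    first | exact hn 0 | exact hn 1 | exact hn 2 | exact h0

lemma integrableOn_dotProduct_normalMatrix {S : Set Space} (hΩ : IsLipschitzDomain Ω)
    (hS : S ⊆ frontier Ω) {s : Space → Fin 6 → ℝ} {v : Space → Fin 3 → ℝ}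
    (hs : MemLp s 2 (surf.restrict S)) (hv : MemLp v 2 (surf.restrict S)) :
    IntegrableOn (fun x => s x ⬝ᵥ (normalMatrix Ω x *ᵥ v x)) S surf :=
  integrable_dotProduct_mulVec hs hv
    (fun i j => (hΩ.aestronglyMeasurable_normalMatrix i j).mono_measure
      (Measure.restrict_mono hS le_rfl))
    fun x i j => norm_normalMatrix_apply_le x i j

lemma dotProduct_transpose_mulVec_comm {m m' : Type*} [Fintype m] [Fintype m']
    (T : Matrix m' m ℝ) (v : m → ℝ) (s : m' → ℝ) : v ⬝ᵥ (Tᵀ *ᵥ s) = s ⬝ᵥ (T *ᵥ v) := by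
  rw [Matrix.mulVec_transpose, Matrix.dotProduct_mulVec, dotProduct_comm]

/-- **Green's formula** for a velocity field and a stress field on a bounded Lipschitz domain. -/
theorem integral_weakDT_add_integral_weakD (hΩ : IsLipschitzDomain Ω) {v : Space → Fin 3 → ℝ}
    {s : Space → Fin 6 → ℝ} (hv : HasBoundaryValues Ω v) (hs : HasBoundaryValues Ω s)
    (hvD : ∃ w, IsWeakD Ω v w) (hsD : ∃ w, IsWeakDT Ω s w) :
    (∫ x in Ω, v x ⬝ᵥ weakDT Ω s x) + ∫ x in Ω, weakD Ω v x ⬝ᵥ s x =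
      ∫ x in frontier Ω, v x ⬝ᵥ ((normalMatrix Ω x)ᵀ *ᵥ s x) ∂surf := by
  have hv' := isWeakD_weakD hvD
  have hs' := isWeakDT_weakDT hsD
  obtain ⟨Cv, hCv⟩ := hv.bounded
  obtain ⟨Cs, hCs⟩ := hs.bounded
  have hi₁ := integrable_dotProduct hv'.1 hs'.2.1
  have hi₂ := integrable_dotProduct hv'.2.1 hs'.1
  have hdiv := hasWeakDiv_flux hΩ hv' hs' (fun x hx => hCv x (subset_closure hx))
    fun x hx => hCs x (subset_closure hx)
  have htr : IsTraceField Ω (fun x => flux (s x) (v x)) (‖fluxL‖ * |Cs| * |Cv|) := by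
    refine ⟨?_, fun x hx => ?_, ?_, ?_, ?_⟩
    · exact mul_nonneg (mul_nonneg fluxL.opNorm_nonneg (abs_nonneg _)) (abs_nonneg _)
    · refine (norm_flux_le _ _).trans ?_
      have h1 := (hCs x hx).trans (le_abs_self Cs)
      have h2 := (hCv x hx).trans (le_abs_self Cv)
      gcongr
    · exact continuous_flux.comp_aestronglyMeasurable (hs.meas_interior.prodMk hv.meas_interior)
    · exact continuous_flux.comp_aestronglyMeasurable (hs.meas_boundary.prodMk hv.meas_boundary)
    · filter_upwards [hs.limit, hv.limit] with x h1 h2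
      exact (continuous_flux.tendsto (s x, v x)).comp (h1.prodMk_nhds h2)
  have := integral_weakDiv hΩ htr hdiv (hi₁.add hi₂)
  rw [integral_add hi₁ hi₂] at this
  rw [this]
  simp_rw [dotProduct_normalMatrix_transpose_mulVec]

end Green

/-! ### Quadratic forms -/

section Quadratic

variable {ι : Type*} [Fintype ι]

lemma dotProduct_mulVec_comm {A : Matrix ι ι ℝ} (hA : Aᵀ = A) (x y : ι → ℝ) :
    x ⬝ᵥ (A *ᵥ y) = y ⬝ᵥ (A *ᵥ x) := by
  conv_rhs => rw [Matrix.dotProduct_mulVec, ← Matrix.mulVec_transpose, hA, dotProduct_comm]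

lemma transpose_inv_of_posDef [DecidableEq ι] {A : Matrix ι ι ℝ} (hA : A.PosDef) :
    (A⁻¹)ᵀ = A⁻¹ := by
  rw [← Matrix.conjTranspose_eq_transpose_of_trivial]
  exact hA.inv.isHermitian.eq

/-- Symmetry makes the two halves of the product rule equal, cancelling the factor `1/2`. It is used
for `M⁻¹` at the point `M e`, and for `M` along a trajectory. -/
lemma hasGradientAt_quadH [DecidableEq ι] {A : Matrix ι ι ℝ} (hA : Aᵀ = A) (e : ι → ℝ) :
    HasGradientAt (fun p : EuclideanSpace ℝ ι => quadH A (WithLp.ofLp p))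
      (WithLp.toLp 2 (A *ᵥ e)) (WithLp.toLp 2 e) := by
  rw [hasGradientAt_iff_hasFDerivAt]
  set T := Matrix.toEuclideanCLM (n := ι) (𝕜 := ℝ) A
  have hT : ∀ p, WithLp.ofLp (T p) = A *ᵥ WithLp.ofLp p := fun p =>
    Matrix.ofLp_toEuclideanCLM A p
  have h1 : (fun p : EuclideanSpace ℝ ι => quadH A (WithLp.ofLp p)) =
      fun p => (1 / 2) * ⟪p, T p⟫ := by
    funext p
    simp only [quadH, EuclideanSpace.inner_eq_star_dotProduct, hT, star_trivial]
    rw [dotProduct_comm]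
  rw [h1]
  have h2 := ((hasFDerivAt_id (𝕜 := ℝ) (WithLp.toLp 2 e)).inner ℝ
    (T.hasFDerivAt (x := WithLp.toLp 2 e))).const_mul (1 / 2)
  convert! h2 using 1
  ext v
  simp only [InnerProductSpace.toDual_apply_apply, smul_apply,
    ContinuousLinearMap.comp_apply, fderivInnerCLM_apply, ContinuousLinearMap.prod_apply,
    ContinuousLinearMap.id_apply, id_eq, EuclideanSpace.inner_eq_star_dotProduct, hT, star_trivial,
    smul_eq_mul]
  rw [dotProduct_comm (A *ᵥ _) e, dotProduct_mulVec_comm hA e, dotProduct_comm (A *ᵥ e),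
    dotProduct_mulVec_comm hA v]
  rw [dotProduct_mulVec_comm hA e, dotProduct_comm]
  ring

lemma hasDerivAt_quadH {A : Matrix ι ι ℝ} (hA : Aᵀ = A) {e : ℝ → ι → ℝ} {e' : ι → ℝ}
    {t : ℝ} (he : HasDerivAt e e' t) :
    HasDerivAt (fun r => quadH A (e r)) (e t ⬝ᵥ (A *ᵥ e')) t := by
  classical
  have h1 := (hasGradientAt_quadH hA (e t)).hasFDerivAt
  have h2 : HasDerivAt (fun r => WithLp.toLp 2 (e r)) (WithLp.toLp 2 e') t :=
    (PiLp.hasFDerivAt_toLp (𝕜 := ℝ) 2 (e t)).comp_hasDerivAt t he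
  have h3 := h1.comp_hasDerivAt t h2
  convert! h3 using 1
  simp only [InnerProductSpace.toDual_apply_apply, EuclideanSpace.inner_eq_star_dotProduct,
    star_trivial]
  rw [dotProduct_mulVec_comm hA]

end Quadratic

lemma hasDerivAt_sumElim {ι κ : Type*} [Fintype ι] [Fintype κ] {v : ℝ → ι → ℝ} {s : ℝ → κ → ℝ}
    {v' : ι → ℝ} {s' : κ → ℝ} {t : ℝ} (hv : HasDerivAt v v' t) (hs : HasDerivAt s s' t) :
    HasDerivAt (fun r => Sum.elim (v r) (s r)) (Sum.elim v' s') t := by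
  refine hasDerivAt_pi.2 fun i => ?_
  cases i with
  | inl i => exact hasDerivAt_pi.1 hv i
  | inr j => exact hasDerivAt_pi.1 hs j

/-! ### The matrices of the discretized system -/

section Structure

variable {Ω SN SD : Set Space} {rho : ℝ} {E : Matrix (Fin 6) (Fin 6) ℝ} {ι κ α β : Type*}
  {φ : ι → Space → Fin 3 → ℝ} {ψ : κ → Space → Fin 6 → ℝ}
  {ξ : α → Space → Fin 3 → ℝ} {ζ : β → Space → Fin 3 → ℝ}

lemma massV_transpose : (massV Ω rho φ)ᵀ = massV Ω rho φ := by
  ext i j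
  simp only [massV, Matrix.transpose_apply, Matrix.of_apply, dotProduct_smul]
  simp_rw [dotProduct_comm (φ j _)]

lemma massS_transpose (hE : (E⁻¹)ᵀ = E⁻¹) : (massS Ω E ψ)ᵀ = massS Ω E ψ := by
  ext i j
  simp only [massS, Matrix.transpose_apply, Matrix.of_apply]
  congr 1; funext x
  exact dotProduct_mulVec_comm hE _ _

lemma interJ_transpose : (interJ Ω SD φ ψ)ᵀ = -interJ Ω SD φ ψ := by
  simp [interJ, Matrix.fromBlocks_transpose, Matrix.fromBlocks_neg]

lemma inputG_transpose : (inputG Ω SN SD φ ψ ξ ζ)ᵀ =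
    Matrix.fromBlocks (inputV SN φ ξ)ᵀ 0 0 (inputS Ω SD ψ ζ)ᵀ := by
  rw [inputG, Matrix.fromBlocks_transpose, Matrix.transpose_zero, Matrix.transpose_zero]

lemma inputG_mulVec [Fintype α] [Fintype β] (a : α → ℝ) (b : β → ℝ) :
    inputG Ω SN SD φ ψ ξ ζ *ᵥ Sum.elim a b =
      Sum.elim (inputV SN φ ξ *ᵥ a) (inputS Ω SD ψ ζ *ᵥ b) := by
  simp [inputG, Matrix.fromBlocks_mulVec, Function.comp_def]

lemma massM_transpose (hE : (E⁻¹)ᵀ = E⁻¹) : (massM Ω rho E φ ψ)ᵀ = massM Ω rho E φ ψ := by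
  rw [massM, Matrix.fromBlocks_transpose, massV_transpose, massS_transpose hE,
    Matrix.transpose_zero, Matrix.transpose_zero]

end Structure

/-! ### Mass positivity, energy, and residuals as matrix equations -/

section System

variable {Ω SN SD : Set Space} {rho : ℝ} {E : Matrix (Fin 6) (Fin 6) ℝ}
  {ι κ α β : Type*} [Fintype ι] [Fintype κ] [Fintype α] [Fintype β]
  {φ : ι → Space → Fin 3 → ℝ} {ψ : κ → Space → Fin 6 → ℝ}
  {ξ : α → Space → Fin 3 → ℝ} {ζ : β → Space → Fin 3 → ℝ}

lemma integral_massV (hφ : ∀ i, MemLp (φ i) 2 (volume.restrict Ω)) (c c' : ι → ℝ) :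
    ∫ x in Ω, field φ c x ⬝ᵥ (rho • field φ c' x) = c ⬝ᵥ (massV Ω rho φ *ᵥ c') := by
  have := integral_field_mulVec_field (μ := volume.restrict Ω) (b := φ) (b' := φ)
    (T := fun _ => rho • (1 : Matrix (Fin 3) (Fin 3) ℝ))
    (fun i j => integrable_dotProduct_const_mulVec _ (hφ i) (hφ j)) c c'
  simpa [Matrix.smul_mulVec, massV] using this

lemma integral_massS (hψ : ∀ j, MemLp (ψ j) 2 (volume.restrict Ω)) (d d' : κ → ℝ) :
    ∫ x in Ω, field ψ d x ⬝ᵥ (E⁻¹ *ᵥ field ψ d' x) = d ⬝ᵥ (massS Ω E ψ *ᵥ d') :=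
  integral_field_mulVec_field (μ := volume.restrict Ω) (T := fun _ => E⁻¹)
    (fun i j => integrable_dotProduct_const_mulVec _ (hψ i) (hψ j)) d d'

/-- The quadratic form is the integral of `ρ |v|²`. If it vanishes, the field is zero almost
everywhere, and linear independence in `L²` gives zero coefficients. -/
lemma massV_pos (hφ : ∀ i, MemLp (φ i) 2 (volume.restrict Ω)) (hli : LinIndepOn Ω φ)
    (hrho : 0 < rho) (c : ι → ℝ) :
    0 ≤ c ⬝ᵥ (massV Ω rho φ *ᵥ c) ∧ (c ⬝ᵥ (massV Ω rho φ *ᵥ c) = 0 → c = 0) := by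
  rw [← integral_massV hφ]
  have hpt : ∀ x, 0 ≤ field φ c x ⬝ᵥ (rho • field φ c x) := fun x => by
    rw [dotProduct_smul, smul_eq_mul]
    exact mul_nonneg hrho.le (Finset.sum_nonneg fun i _ => mul_self_nonneg _)
  refine ⟨integral_nonneg hpt, fun h0 => hli c ?_⟩
  rw [integral_eq_zero_iff_of_nonneg hpt (integrable_dotProduct (memLp_field hφ c)
    ((memLp_field hφ c).const_smul rho))] at h0
  filter_upwards [h0] with x hx
  simp only [dotProduct_smul, smul_eq_mul, Pi.zero_apply, mul_eq_zero, hrho.ne', false_or] at hx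
  exact dotProduct_self_eq_zero.1 hx

lemma massS_pos (hψ : ∀ j, MemLp (ψ j) 2 (volume.restrict Ω)) (hli : LinIndepOn Ω ψ)
    (hE : (E⁻¹).PosDef) (d : κ → ℝ) :
    0 ≤ d ⬝ᵥ (massS Ω E ψ *ᵥ d) ∧ (d ⬝ᵥ (massS Ω E ψ *ᵥ d) = 0 → d = 0) := by
  rw [← integral_massS hψ]
  have hpos : ∀ u : Fin 6 → ℝ, u ≠ 0 → 0 < u ⬝ᵥ (E⁻¹ *ᵥ u) := fun u hu => by
    simpa using hE.dotProduct_mulVec_pos hu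
  have hpt : ∀ x, 0 ≤ field ψ d x ⬝ᵥ (E⁻¹ *ᵥ field ψ d x) := fun x => by
    by_cases h : field ψ d x = 0
    · simp [h]
    · exact (hpos _ h).le
  refine ⟨integral_nonneg hpt, fun h0 => hli d ?_⟩
  rw [integral_eq_zero_iff_of_nonneg hpt (integrable_dotProduct_const_mulVec _
    (memLp_field hψ d) (memLp_field hψ d))] at h0
  filter_upwards [h0] with x hx
  by_contra hne
  exact (hpos _ hne).ne' hx

lemma massM_mulVec (c : ι → ℝ) (d : κ → ℝ) :
    massM Ω rho E φ ψ *ᵥ Sum.elim c d = Sum.elim (massV Ω rho φ *ᵥ c) (massS Ω E ψ *ᵥ d) := by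
  simp [massM, Matrix.fromBlocks_mulVec, Function.comp_def]

lemma interJ_mulVec (c : ι → ℝ) (d : κ → ℝ) :
    interJ Ω SD φ ψ *ᵥ Sum.elim c d =
      Sum.elim (-(stiffK Ω SD φ ψ *ᵥ d)) ((stiffK Ω SD φ ψ)ᵀ *ᵥ c) := by
  simp [interJ, Matrix.fromBlocks_mulVec, Function.comp_def, Matrix.neg_mulVec]

lemma posDef_massM (hφ : ∀ i, MemLp (φ i) 2 (volume.restrict Ω))
    (hψ : ∀ j, MemLp (ψ j) 2 (volume.restrict Ω)) (hφli : LinIndepOn Ω φ) (hψli : LinIndepOn Ω ψ)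
    (hrho : 0 < rho) (hE : E.PosDef) : (massM Ω rho E φ ψ).PosDef := by
  have hEt := transpose_inv_of_posDef hE
  refine Matrix.PosDef.of_dotProduct_mulVec_pos ?_ fun x hx => ?_
  · rw [Matrix.IsHermitian, Matrix.conjTranspose_eq_transpose_of_trivial]
    exact massM_transpose hEt
  · obtain ⟨c, d, rfl⟩ : ∃ c d, x = Sum.elim c d :=
      ⟨x ∘ Sum.inl, x ∘ Sum.inr, (Sum.elim_comp_inl_inr x).symm⟩
    rw [star_trivial, massM_mulVec, sumElim_dotProduct_sumElim]
    obtain ⟨hc, hc0⟩ := massV_pos hφ hφli hrho c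
    obtain ⟨hd, hd0⟩ := massS_pos hψ hψli hE.inv d
    refine lt_of_le_of_ne (add_nonneg hc hd) fun h => hx ?_
    rw [hc0 (by linarith), hd0 (by linarith)]
    exact Sum.elim_zero_zero

/-- With `ε = E⁻¹ σ`, the density `ε · E ε` is `σ · E⁻¹ σ`, the integrand of the stress mass. -/
lemma energy_eq_quadH (hφ : ∀ i, MemLp (φ i) 2 (volume.restrict Ω))
    (hψ : ∀ j, MemLp (ψ j) 2 (volume.restrict Ω)) (hE : E.PosDef) (c : ι → ℝ) (d : κ → ℝ) :
    energy Ω rho E (field φ c) (fun x => E⁻¹ *ᵥ field ψ d x) =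
      quadH (massM Ω rho E φ ψ) (Sum.elim c d) := by
  have hdet : IsUnit E.det := (Matrix.isUnit_iff_isUnit_det E).1 hE.isUnit
  rw [energy, quadH, massM_mulVec, sumElim_dotProduct_sumElim, ← integral_massV hφ,
    ← integral_massS hψ, ← integral_add]
  · congr 2; funext x
    rw [Matrix.mulVec_mulVec, Matrix.mul_nonsing_inv _ hdet, Matrix.one_mulVec, dotProduct_smul,
      smul_eq_mul, dotProduct_comm (E⁻¹ *ᵥ _)]
  · exact integrable_dotProduct (memLp_field hφ c) ((memLp_field hφ c).const_smul rho)
  · exact integrable_dotProduct_const_mulVec _ (memLp_field hψ d) (memLp_field hψ d)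

/-- The bilinear form of the matrix `K` is the partially integrated form of the stress power. -/
lemma dotProduct_stiffK_mulVec (hΩ : IsLipschitzDomain Ω) (hSD : SD ⊆ frontier Ω)
    (hφ : ∀ i, HasBoundaryValues Ω (φ i)) (hφD : ∀ i, ∃ w, IsWeakD Ω (φ i) w)
    (hψ : ∀ j, HasBoundaryValues Ω (ψ j)) (c : ι → ℝ) (d : κ → ℝ) :
    c ⬝ᵥ (stiffK Ω SD φ ψ *ᵥ d) = (∫ x in Ω, weakD Ω (field φ c) x ⬝ᵥ field ψ d x) -
      ∫ x in SD, field φ c x ⬝ᵥ ((normalMatrix Ω x)ᵀ *ᵥ field ψ d x) ∂surf := by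
  have hK : stiffK Ω SD φ ψ =
      Matrix.of (fun i j => ∫ x in Ω, weakD Ω (φ i) x ⬝ᵥ ψ j x) -
      Matrix.of (fun i j => ∫ x in SD, φ i x ⬝ᵥ ((normalMatrix Ω x)ᵀ *ᵥ ψ j x) ∂surf) := rfl
  have h1 : ∫ x in Ω, weakD Ω (field φ c) x ⬝ᵥ field ψ d x =
      ∫ x in Ω, field (fun i => weakD Ω (φ i)) c x ⬝ᵥ field ψ d x := by
    refine integral_congr_ae ?_
    filter_upwards [weakD_field_ae_eq hΩ hφD c] with x hx
    rw [hx]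
  rw [h1, integral_field_dotProduct_field, integral_field_mulVec_field, hK, Matrix.sub_mulVec,
    dotProduct_sub]
  · intro i j
    simp_rw [dotProduct_transpose_mulVec_comm]
    exact integrableOn_dotProduct_normalMatrix hΩ hSD
      (((hψ j).memLp_boundary hΩ).mono_measure (Measure.restrict_mono hSD le_rfl))
      (((hφ i).memLp_boundary hΩ).mono_measure (Measure.restrict_mono hSD le_rfl))
  · exact fun i j => integrable_dotProduct (isWeakD_weakD (hφD i)).2.1 ((hψ j).memLp_interior hΩ)

/-- The stress term and the Dirichlet boundary term together are the bilinear form of `K`; Green's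
formula is not needed. -/
lemma residualVInt_eq (hΩ : IsLipschitzDomain Ω) (hSD : SD ⊆ frontier Ω) (hSN : SN ⊆ frontier Ω)
    (hφ : ∀ i, HasBoundaryValues Ω (φ i)) (hφD : ∀ i, ∃ w, IsWeakD Ω (φ i) w)
    (hψ : ∀ j, HasBoundaryValues Ω (ψ j)) (hξ : ∀ k, MemLp (ξ k) 2 (surf.restrict SN))
    (c c' : ι → ℝ) (d : κ → ℝ) (a : α → ℝ) :
    residualVInt Ω SN SD rho (field φ c) (field φ c') (field ψ d) (field ξ a) =
      c ⬝ᵥ (massV Ω rho φ *ᵥ c' + stiffK Ω SD φ ψ *ᵥ d - inputV SN φ ξ *ᵥ a) := by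
  have h1 : ∫ x in SN, field φ c x ⬝ᵥ field ξ a x ∂surf = c ⬝ᵥ (inputV SN φ ξ *ᵥ a) :=
    integral_field_dotProduct_field (fun i k => integrable_dotProduct
      (((hφ i).memLp_boundary hΩ).mono_measure (Measure.restrict_mono hSN le_rfl)) (hξ k)) c a
  rw [residualVInt, integral_massV fun i => (hφ i).memLp_interior hΩ, h1, dotProduct_sub,
    dotProduct_add, dotProduct_stiffK_mulVec hΩ hSD hφ hφD hψ]
  ring

/-- The domain term and the velocity part of the Dirichlet term form minus the bilinear form of `K`
with trial and test roles exchanged. This is the origin of the skew-symmetry of `J`. -/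
lemma residualS_eq (hΩ : IsLipschitzDomain Ω) (hSD : SD ⊆ frontier Ω)
    (hφ : ∀ i, HasBoundaryValues Ω (φ i)) (hφD : ∀ i, ∃ w, IsWeakD Ω (φ i) w)
    (hψ : ∀ j, HasBoundaryValues Ω (ψ j)) (hζ : ∀ l, MemLp (ζ l) 2 (surf.restrict SD))
    (d d' : κ → ℝ) (c : ι → ℝ) (b : β → ℝ) :
    residualS Ω SD E (field ψ d) (field ψ d') (field φ c) (field ζ b) =
      d ⬝ᵥ (massS Ω E ψ *ᵥ d' - (stiffK Ω SD φ ψ)ᵀ *ᵥ c - inputS Ω SD ψ ζ *ᵥ b) := by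
  have hψi := memLp_field (fun j => (hψ j).memLp_interior hΩ)
  have hψb : ∀ j, MemLp (ψ j) 2 (surf.restrict SD) := fun j =>
    ((hψ j).memLp_boundary hΩ).mono_measure (Measure.restrict_mono hSD le_rfl)
  have hφb : ∀ i, MemLp (φ i) 2 (surf.restrict SD) := fun i =>
    ((hφ i).memLp_boundary hΩ).mono_measure (Measure.restrict_mono hSD le_rfl)
  have hwD := isWeakD_weakD ⟨_, IsWeakD.field (fun i => isWeakD_weakD (hφD i)) c⟩
  have h1 : ∫ x in SD, field ψ d x ⬝ᵥ (normalMatrix Ω x *ᵥ field ζ b x) ∂surf =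
      d ⬝ᵥ (inputS Ω SD ψ ζ *ᵥ b) :=
    integral_field_mulVec_field (fun j l => integrableOn_dotProduct_normalMatrix hΩ hSD (hψb j)
      (hζ l)) d b
  rw [residualS, integral_sub (integrable_dotProduct_const_mulVec _ (hψi d) (hψi d'))
    (integrable_dotProduct (hψi d) hwD.2.1),
    integral_massS fun j => (hψ j).memLp_interior hΩ]
  simp_rw [Matrix.mulVec_sub, dotProduct_sub]
  rw [integral_sub (integrableOn_dotProduct_normalMatrix hΩ hSD (memLp_field hψb d)
      (memLp_field hφb c))
    (integrableOn_dotProduct_normalMatrix hΩ hSD (memLp_field hψb d) (memLp_field hζ b)), h1,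
    dotProduct_transpose_mulVec_comm, dotProduct_stiffK_mulVec hΩ hSD hφ hφD hψ]
  simp_rw [dotProduct_transpose_mulVec_comm, dotProduct_comm (weakD Ω _ _)]
  ring

/-- The residual of the momentum balance agrees with its partially integrated form for stress
fields with a weak derivative. -/
lemma residualV_eq_residualVInt (hΩ : IsLipschitzDomain Ω)
    (hSNm : MeasurableSet SN) (hunion : SD ∪ SN = frontier Ω) (hinter : surf (SD ∩ SN) = 0)
    {v a τ : Space → Fin 3 → ℝ} {s : Space → Fin 6 → ℝ}
    (hv : HasBoundaryValues Ω v) (hs : HasBoundaryValues Ω s) (hvD : ∃ w, IsWeakD Ω v w)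
    (hsD : ∃ w, IsWeakDT Ω s w) (ha : MemLp a 2 (volume.restrict Ω))
    (hτ : MemLp τ 2 (surf.restrict SN)) :
    residualV Ω SN rho v a s τ = residualVInt Ω SN SD rho v a s τ := by
  have hSD : SD ⊆ frontier Ω := hunion ▸ subset_union_left
  have hSN : SN ⊆ frontier Ω := hunion ▸ subset_union_right
  have hvi := hv.memLp_interior hΩ
  have hint : ∀ {S : Set Space}, S ⊆ frontier Ω →
      IntegrableOn (fun x => v x ⬝ᵥ ((normalMatrix Ω x)ᵀ *ᵥ s x)) S surf := by
    intro S hS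
    simp_rw [dotProduct_transpose_mulVec_comm]
    exact integrableOn_dotProduct_normalMatrix hΩ hS
      ((hs.memLp_boundary hΩ).mono_measure (Measure.restrict_mono hS le_rfl))
      ((hv.memLp_boundary hΩ).mono_measure (Measure.restrict_mono hS le_rfl))
  have hgreen := integral_weakDT_add_integral_weakD hΩ hv hs hvD hsD
  -- The overlap is null, so the boundary term of Green's formula splits. Its Neumann part cancels
  -- the stress term of the residual and its Dirichlet part remains in the integrated form.
  rw [← hunion, setIntegral_union₀ hinter hSNm.nullMeasurableSet (hint hSD) (hint hSN)] at hgreen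
  have hia : IntegrableOn (fun x => v x ⬝ᵥ (rho • a x)) Ω :=
    integrable_dotProduct hvi (ha.const_smul rho)
  rw [residualV, residualVInt, integral_sub hia
    (integrable_dotProduct hvi (isWeakDT_weakDT hsD).2.1)]
  simp_rw [dotProduct_sub]
  rw [integral_sub (hint hSN) (integrable_dotProduct
    ((hv.memLp_boundary hΩ).mono_measure (Measure.restrict_mono hSN le_rfl)) hτ)]
  linarith

lemma forall_dotProduct_eq_zero_iff (A : ι → ℝ) : (∀ c, c ⬝ᵥ A = 0) ↔ A = 0 :=
  ⟨fun h => dotProduct_self_eq_zero.1 (h A), fun h c => by rw [h, dotProduct_zero]⟩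

/-- The partially integrated weak form is equivalent to the state equation. -/
lemma weakForm_iff_stateEquation (hΩ : IsLipschitzDomain Ω) (hSD : SD ⊆ frontier Ω)
    (hSN : SN ⊆ frontier Ω)
    (hφ : ∀ i, HasBoundaryValues Ω (φ i)) (hφD : ∀ i, ∃ w, IsWeakD Ω (φ i) w)
    (hψ : ∀ j, HasBoundaryValues Ω (ψ j)) (hξ : ∀ k, MemLp (ξ k) 2 (surf.restrict SN))
    (hζ : ∀ l, MemLp (ζ l) 2 (surf.restrict SD)) (c c' : ι → ℝ) (d d' : κ → ℝ) (a : α → ℝ)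
    (b : β → ℝ) :
    (∀ (δv : ι → ℝ) (δs : κ → ℝ),
      residualVInt Ω SN SD rho (field φ δv) (field φ c') (field ψ d) (field ξ a) = 0 ∧
      residualS Ω SD E (field ψ δs) (field ψ d') (field φ c) (field ζ b) = 0) ↔
    massM Ω rho E φ ψ *ᵥ Sum.elim c' d' =
      interJ Ω SD φ ψ *ᵥ Sum.elim c d + inputG Ω SN SD φ ψ ξ ζ *ᵥ Sum.elim a b := by
  simp_rw [residualVInt_eq hΩ hSD hSN hφ hφD hψ hξ, residualS_eq hΩ hSD hφ hφD hψ hζ]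
  rw [massM_mulVec, interJ_mulVec, inputG_mulVec]
  have hsplit : ∀ (A A' : ι → ℝ) (B B' : κ → ℝ),
      Sum.elim A B = Sum.elim A' B' ↔ A = A' ∧ B = B' := fun A A' B B' =>
    ⟨fun h => ⟨funext fun i => congrFun h (Sum.inl i), funext fun j => congrFun h (Sum.inr j)⟩,
      fun h => by rw [h.1, h.2]⟩
  rw [← Sum.elim_add_add, hsplit]
  constructor
  · intro h
    have h1 := (forall_dotProduct_eq_zero_iff _).1 fun δv => (h δv 0).1
    have h2 := (forall_dotProduct_eq_zero_iff _).1 fun δs => (h 0 δs).2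
    constructor
    · rw [sub_eq_zero] at h1
      rw [← h1]; abel
    · rw [sub_eq_zero] at h2
      rw [← h2]; abel
  · rintro ⟨h1, h2⟩ δv δs
    constructor
    · rw [h1]
      convert! dotProduct_zero δv using 2
      abel
    · rw [h2]
      convert! dotProduct_zero δs using 2
      abel

lemma dotProduct_interJ_mulVec_self (c : ι → ℝ) (d : κ → ℝ) :
    Sum.elim c d ⬝ᵥ (interJ Ω SD φ ψ *ᵥ Sum.elim c d) = 0 := by
  rw [interJ_mulVec, sumElim_dotProduct_sumElim, dotProduct_neg,
    dotProduct_transpose_mulVec_comm, neg_add_cancel]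

end System

end Elastodynamics

end

/-! ### The port-Hamiltonian theorem -/

open Elastodynamics in
theorem mainTheorem1
    -- domain, boundary decomposition and material parameters
    (Ω SN SD : Set Elastodynamics.Space) (hΩ : Elastodynamics.IsLipschitzDomain Ω)
    (hSN : MeasurableSet SN) (hSD : MeasurableSet SD) (hunion : SD ∪ SN = frontier Ω)
    (hinter : Elastodynamics.surf (SD ∩ SN) = 0)
    (rho lam G : ℝ) (hrho : 0 < rho) (hE : (Elastodynamics.hooke lam G).PosDef)
    -- bases for velocity, stress, traction input and velocity input
    {ι κ α β : Type*} [Fintype ι] [DecidableEq ι] [Fintype κ] [DecidableEq κ]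
    [Fintype α] [Fintype β]
    (φ : ι → Elastodynamics.Space → Fin 3 → ℝ) (ψ : κ → Elastodynamics.Space → Fin 6 → ℝ)
    (ξ : α → Elastodynamics.Space → Fin 3 → ℝ) (ζ : β → Elastodynamics.Space → Fin 3 → ℝ)
    (hφ : ∀ i, Elastodynamics.HasBoundaryValues Ω (φ i))
    (hφD : ∀ i, ∃ w, Elastodynamics.IsWeakD Ω (φ i) w)
    (hψ : ∀ j, Elastodynamics.HasBoundaryValues Ω (ψ j))
    (hξ : ∀ k, MemLp (ξ k) 2 (Elastodynamics.surf.restrict SN))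
    (hζ : ∀ l, MemLp (ζ l) 2 (Elastodynamics.surf.restrict SD))
    (hφli : Elastodynamics.LinIndepOn Ω φ) (hψli : Elastodynamics.LinIndepOn Ω ψ)
    -- the matrices of the discretized system
    (E : Matrix (Fin 6) (Fin 6) ℝ) (hEdef : E = Elastodynamics.hooke lam G)
    (M J : Matrix (ι ⊕ κ) (ι ⊕ κ) ℝ) (Gm : Matrix (ι ⊕ κ) (α ⊕ β) ℝ)
    (hM : M = Elastodynamics.massM Ω rho E φ ψ)
    (hJ : J = Elastodynamics.interJ Ω SD φ ψ)
    (hG : Gm = Elastodynamics.inputG Ω SN SD φ ψ ξ ζ) :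
    -- structure: `M` is symmetric positive definite and invertible, `J` is skew-symmetric,
    -- the output matrix is block diagonal
    (M.PosDef ∧ IsUnit M ∧ Jᵀ = -J ∧
      Gmᵀ = Matrix.fromBlocks (Elastodynamics.inputV SN φ ξ)ᵀ 0 0
        (Elastodynamics.inputS Ω SD ψ ζ)ᵀ) ∧
    -- the discrete Hamiltonian is the energy of the approximate fields
    (∀ (c : ι → ℝ) (d : κ → ℝ),
      Elastodynamics.energy Ω rho E (Elastodynamics.field φ c)
          (fun x => E⁻¹ *ᵥ Elastodynamics.field ψ d x) =
        Elastodynamics.quadH M (Sum.elim c d)) ∧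
    -- the state `e` is the gradient of the Hamiltonian with respect to the energy variable `M e`
    (∀ e : ι ⊕ κ → ℝ,
      Elastodynamics.quadH M⁻¹ (M *ᵥ e) = Elastodynamics.quadH M e ∧
      HasGradientAt
        (fun p : EuclideanSpace ℝ (ι ⊕ κ) => Elastodynamics.quadH M⁻¹ (WithLp.ofLp p))
        (WithLp.toLp 2 e) (WithLp.toLp 2 (M *ᵥ e))) ∧
    ∀ (vh : ℝ → ι → ℝ) (sh : ℝ → κ → ℝ) (τh : ℝ → α → ℝ) (νh : ℝ → β → ℝ) (t : ℝ),
      DifferentiableAt ℝ vh t → DifferentiableAt ℝ sh t →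
      -- the discretized weak form is the port-Hamiltonian state equation
      ((∀ j, ∃ w, Elastodynamics.IsWeakDT Ω (ψ j) w) →
        ((∀ (δv : ι → ℝ) (δs : κ → ℝ),
          Elastodynamics.residualV Ω SN rho (Elastodynamics.field φ δv)
              (fun x => deriv (fun r => Elastodynamics.field φ (vh r) x) t)
              (Elastodynamics.field ψ (sh t)) (Elastodynamics.field ξ (τh t)) = 0 ∧
          Elastodynamics.residualS Ω SD E (Elastodynamics.field ψ δs)
              (fun x => deriv (fun r => Elastodynamics.field ψ (sh r) x) t)
              (Elastodynamics.field φ (vh t)) (Elastodynamics.field ζ (νh t)) = 0) ↔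
          M *ᵥ deriv (fun r => Sum.elim (vh r) (sh r)) t =
            J *ᵥ Sum.elim (vh t) (sh t) + Gm *ᵥ Sum.elim (τh t) (νh t))) ∧
      -- the same with the partially integrated weak form, for arbitrary stress bases
      ((∀ (δv : ι → ℝ) (δs : κ → ℝ),
          Elastodynamics.residualVInt Ω SN SD rho (Elastodynamics.field φ δv)
              (fun x => deriv (fun r => Elastodynamics.field φ (vh r) x) t)
              (Elastodynamics.field ψ (sh t)) (Elastodynamics.field ξ (τh t)) = 0 ∧
          Elastodynamics.residualS Ω SD E (Elastodynamics.field ψ δs)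
              (fun x => deriv (fun r => Elastodynamics.field ψ (sh r) x) t)
              (Elastodynamics.field φ (vh t)) (Elastodynamics.field ζ (νh t)) = 0) ↔
        M *ᵥ deriv (fun r => Sum.elim (vh r) (sh r)) t =
          J *ᵥ Sum.elim (vh t) (sh t) + Gm *ᵥ Sum.elim (τh t) (νh t)) ∧
      -- power balance along solutions, with the collocated output `y = Gᵀ e`
      (M *ᵥ deriv (fun r => Sum.elim (vh r) (sh r)) t =
          J *ᵥ Sum.elim (vh t) (sh t) + Gm *ᵥ Sum.elim (τh t) (νh t) →
        HasDerivAt (fun r => Elastodynamics.quadH M (Sum.elim (vh r) (sh r)))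
          (vh t ⬝ᵥ (Elastodynamics.inputV SN φ ξ *ᵥ τh t) +
            sh t ⬝ᵥ (Elastodynamics.inputS Ω SD ψ ζ *ᵥ νh t)) t ∧
        vh t ⬝ᵥ (Elastodynamics.inputV SN φ ξ *ᵥ τh t) +
            sh t ⬝ᵥ (Elastodynamics.inputS Ω SD ψ ζ *ᵥ νh t) =
          (Gmᵀ *ᵥ Sum.elim (vh t) (sh t)) ⬝ᵥ Sum.elim (τh t) (νh t)) := by
  subst hEdef hM hJ hG
  have hφi := fun i => (hφ i).memLp_interior hΩ
  have hψi := fun j => (hψ j).memLp_interior hΩ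
  have hSDf : SD ⊆ frontier Ω := hunion ▸ subset_union_left
  have hSNf : SN ⊆ frontier Ω := hunion ▸ subset_union_right
  have hMpos := posDef_massM hφi hψi hφli hψli hrho hE
  have hMt := massM_transpose (Ω := Ω) (rho := rho) (φ := φ) (ψ := ψ) (transpose_inv_of_posDef hE)
  refine ⟨⟨hMpos, hMpos.isUnit, interJ_transpose, inputG_transpose⟩, energy_eq_quadH hφi hψi hE,
    fun e => ?_, fun vh sh τh νh t hvh hsh => ?_⟩
  · have hcancel : (massM Ω rho (hooke lam G) φ ψ)⁻¹ *ᵥ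
        (massM Ω rho (hooke lam G) φ ψ *ᵥ e) = e := by
      rw [Matrix.mulVec_mulVec, Matrix.nonsing_inv_mul _
        ((Matrix.isUnit_iff_isUnit_det _).1 hMpos.isUnit), Matrix.one_mulVec]
    constructor
    · rw [quadH, quadH, hcancel, dotProduct_comm]
    -- The gradient of the form of `M⁻¹` at the point `M e` is `M⁻¹ (M e)`.
    · have := hasGradientAt_quadH (transpose_inv_of_posDef hMpos)
        (massM Ω rho (hooke lam G) φ ψ *ᵥ e)
      rwa [hcancel] at this
  · have hd := hasDerivAt_sumElim hvh.hasDerivAt hsh.hasDerivAt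
    have hequiv := weakForm_iff_stateEquation (rho := rho) (E := hooke lam G) hΩ hSDf hSNf hφ hφD
      hψ hξ hζ (vh t) (deriv vh t) (sh t) (deriv sh t) (τh t) (νh t)
    simp_rw [deriv_field hvh, deriv_field hsh]
    rw [hd.deriv]
    refine ⟨fun hψD => ?_, hequiv, fun hS => ?_⟩
    · rw [← hequiv]
      -- The two weak forms share the kinematic residual, so only the momentum residual has to be
      -- converted.
      refine forall_congr' fun δv => forall_congr' fun δs => and_congr_left' ?_
      rw [residualV_eq_residualVInt hΩ hSN hunion hinter (HasBoundaryValues.field hφ δv)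
        (HasBoundaryValues.field hψ (sh t))
        ⟨_, IsWeakD.field (fun i => isWeakD_weakD (hφD i)) δv⟩
        ⟨_, IsWeakDT.field (fun j => isWeakDT_weakDT (hψD j)) (sh t)⟩
        (memLp_field hφi _) (memLp_field hξ _)]
    · have hin : Sum.elim (vh t) (sh t) ⬝ᵥ
          (inputG Ω SN SD φ ψ ξ ζ *ᵥ Sum.elim (τh t) (νh t)) =
          vh t ⬝ᵥ (inputV SN φ ξ *ᵥ τh t) + sh t ⬝ᵥ (inputS Ω SD ψ ζ *ᵥ νh t) := by
        rw [inputG_mulVec, sumElim_dotProduct_sumElim]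
      constructor
      · have h := hasDerivAt_quadH hMt hd
        -- The derivative of the energy is `e · M e'`; after insertion of the state equation the `J`
        -- term drops out by skew-symmetry.
        rwa [hS, dotProduct_add, dotProduct_interJ_mulVec_self, zero_add, hin] at h
      · rw [← hin, dotProduct_comm (_ *ᵥ _), dotProduct_transpose_mulVec_comm]
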